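/- **Theorem (linear convergence of the discrete modified Dirichlet–Neumann methods).** *Domains.* Let $d\ge 2$. Let $\Omega,\Omega_1,\Omega_2\subset\mathbb R^d$ be bounded Lipschitz domains with $\overline\Omega=\overline\Omega_1\cup\overline\Omega_2$, $\Omega_1\cap\Omega_2=\emptyset$, and let $\Gamma=(\partial\Omega_1\cap\partial\Omega_2)\setminus\partial\Omega$. The sets $\Gamma$ and $\partial\Omega\setminus\partial\Omega_i$ are $(d-1)$-dimensional Lipschitz manifolds. The $\Omega_i$ need not be connected, but the closure of each connected component of $\Omega_i$ meets $\partial\Omega\setminus\partial\Omega_j$, $j\ne i$ (for connected $\Omega_i$: $\partial\Omega\setminus\partial\Omega_j\neq\emptyset$). *Equation.* Let $\alpha:\Omega\times\mathbb R\times\mathbb R^d\to\mathbb R^d$ and $\beta:\Omega\times\mathbb R\times\mathbb R^d\to\mathbb R$ be measurable in $x$ for every $(y,z)$, with $\alpha(x,0,0)=0$ and $\beta(x,0,0)=0$ for a.e. $x$. Suppose that there are nonnegative $h_1,h_2,h_3\in L^\infty(\Omega)$ such that for a.e. $x$ and all $y,y',z,z'$ $$|\alpha(x,y,z)-\alpha(x,y',z')|\le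 h_1(x)(|z-z'|+|y-y'|),\qquad |\beta(x,y,z)-\beta(x,y',z')|\le h_1(x)(|z-z'|+|y-y'|),$$ $$(\alpha(x,y,z)-\alpha(x,y',z'))\cdot(z-z')+(\beta(x,y,z)-\beta(x,y',z'))(y-y')\ge h_2(x)|z-z'|^2-h_3(x)|y-y'|^2,$$ and $\operatorname{ess\,inf}h_2>C_p\operatorname{ess\,sup}h_3$. Here $C_p$ is the largest of the three Poincaré constants (least constants in $\|v\|_{L^2}^2\le C\|\nabla v\|_{L^2}^2$) of $V=H^1_0(\Omega)$ and of $V_i=\{v\in H^1(\Omega_i):v=0\text{ on }\partial\Omega_i\setminus\Gamma\}$, $i=1,2$. Let $f\in L^2(\Omega\times\mathbb R)$, and for $G\in\{\Omega,\Omega_1,\Omega_2\}$ put $$a_G(u,v)=\int_{\mathbb R}\int_G\partial_+^{1/2}u\,\partial_-^{1/2}v+\alpha(x,u,\nabla u)\cdot\nabla v+\beta(x,u,\nabla u)\,v\,dx\,dt,\qquad a=a_\Omega,\quad a_i=a_{\Omega_i},$$ where $\partial_+^{1/2},\partial_-^{1/2},\partial^{1/4}$ and the Hilbert transform $\mathcal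 H$ act in time as Fourier multipliers with symbols $\sqrt{i\omega}$, $\overline{\sqrt{i\omega}}$, $(i\omega)^{1/4}$ and $-i\,\mathrm{sgn}\,\omega$ ($\omega$ the angular frequency). Put $\mathcal H^\varphi=\cos\varphi\, I-\sin\varphi\,\mathcal H$. *Discretization.* Let $K_h$ be a finite conforming simplicial partition of $\overline\Omega$, each of whose simplices lies in $\overline\Omega_1$ or in $\overline\Omega_2$. Let $V^h$, $V_i^h$, $V_i^{0,h}$ be the continuous piecewise linear functions on $\overline\Omega$, $\overline\Omega_i$, $\overline\Omega_i$ that vanish on $\partial\Omega$, $\partial\Omega_i\setminus\Gamma$, $\partial\Omega_i$, respectively. Let $N\in\mathbb N$, $\tau>0$, $\kappa\ge N\tau$. For $j=0,\dots,N$ let $\psi_j\in L^2(\mathbb R)$ be the real function whose Fourier transform is the piecewise linear function on the grid $\tau\mathbb Z$ with value $1$ at $\pm j\tau$ and $0$ at all other grid points, set to zero for $|\omega|>\kappa$ (so $\kappa=N\tau$ gives basis functions with spectrum in $[-N\tau,N\tau]$, and $\kappa=(N+1)\tau$ gives uncut hat functions). Let $U=\operatorname{span}\{\psi_j,\mathcal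 H\psi_j:0\le j\le N\}$, which is invariant under $\mathcal H$. Put $W^h=U\otimes V^h$, $W_i^h=U\otimes V_i^h$, $W_i^{0,h}=U\otimes V_i^{0,h}$. Let $T_iv=v|_{\Gamma\times\mathbb R}$, and assume that $T_1W_1^h=T_2W_2^h=:Z^h$. The space $W_i^h$ carries the norm of $W_i=H^{1/2}(\mathbb R)\otimes L^2(\Omega_i)\cap L^2(\mathbb R)\otimes H^1(\Omega_i)$, and $Z^h$ that of $Z=H^{1/4}(\mathbb R)\otimes L^2(\Gamma)\cap L^2(\mathbb R)\otimes\Lambda$, where $\|\mu\|_\Lambda$ is the $H^{1/2}(\partial\Omega_i)$-norm (for $i=1$ or $i=2$) of the extension of $\mu$ by zero. Let $R_i:Z^h\to W_i^h$, $i=1,2$, be arbitrary linear maps with $T_iR_i\eta=\eta$. *Claim.* 1. For every $\eta\in Z^h$ there is a unique $F_i\eta\in W_i^h$ with $T_iF_i\eta=\eta$ and $a_i(F_i\eta,v)=(f,v)_{L^2(\Omega_i\times\mathbb R)}$ for all $v\in W_i^{0,h}$. Also, for every $\eta\in Z^h$ there is a unique $H_2\eta\in W_2^h$ with $T_2H_2\eta=\eta$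 and $\int_{\Omega_2}\nabla H_2\eta\cdot\nabla v\,dx=0$ in $L^2(\mathbb R)$ for all $v\in V_2^{0,h}$. 2. With $\langle S\eta,\mu\rangle=\sum_{i=1}^2\bigl(a_i(F_i\eta,R_i\mu)-(f,R_i\mu)_{L^2(\Omega_i\times\mathbb R)}\bigr)$, the discrete Steklov–Poincaré equation $\langle S\eta,\mu\rangle=0$ for all $\mu\in Z^h$ has a unique solution $\eta_h\in Z^h$. The discrete weak equation $a(u,v)=(f,v)_{L^2(\Omega\times\mathbb R)}$ for all $v\in W^h$ has a unique solution $u_h\in W^h$. 3. Let $P$ be $P_1$ or $P_2$, where $$\langle P_1\eta,\mu\rangle=\int_{\mathbb R}\int_{\Omega_2}\partial_+^{1/2}R_2\eta\,\partial_+^{1/2}R_2\mu+\nabla R_2\eta\cdot\nabla R_2\mu\,dx\,dt,$$ $$\langle P_2\eta,\mu\rangle=\int_{\mathbb R}\int_\Gamma\partial^{1/4}\eta\,\partial^{1/4}\mu\,dx\,dt+\int_{\mathbb R}\int_{\Omega_2}\nabla H_2\eta\cdot\nabla H_2\mu\,dx\,dt.$$ There are $\varphi_0,s_0>0$ such that for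 all $\varphi\in(0,\varphi_0)$ and $s\in(0,s_0)$ there exist $C>0$ and $L\in(0,1)$ with the following property. For every $\eta_h^0\in Z^h$ the iteration $$\langle P(\eta_h^{n+1}-\eta_h^n),\mu\rangle=-s\,\langle S\eta_h^n,\mathcal H^\varphi\mu\rangle\quad\text{for all }\mu\in Z^h,$$ that is, $\eta_h^{n+1}=\eta_h^n+sP^{-1}(\mathcal H^\varphi)^*(0-S\eta_h^n)$, defines a unique sequence in $Z^h$, and for all $n\ge0$ and $i=1,2$ $$\|\eta_h^n-\eta_h\|_Z\le CL^n\|\eta_h^0-\eta_h\|_Z,\qquad \|F_i\eta_h^n-u_h|_{\Omega_i\times\mathbb R}\|_{W_i}\le CL^n\|\eta_h^0-\eta_h\|_Z.$$ -/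

import Mathlib

open MeasureTheory Set Filter Topology FourierTransform
open scoped ENNReal NNReal ContDiff

noncomputable section

namespace MDN

/-- Physical space `ℝᵈ` with its Euclidean norm. -/
abbrev Space (d : ℕ) : Type := EuclideanSpace ℝ (Fin d)

/-- Real-valued square-integrable functions of time, `L²(ℝ)`. A function `u` of space and time is
represented by the map `x ↦ u(·, x)` from `ℝᵈ` into `L²(ℝ)`. -/
abbrev TimeL2 : Type := Lp ℝ 2 (volume : Measure ℝ)

/-! ### Temporal operators

`𝓕 v (ξ) = ∫ exp(-2πiξt) v(t) dt` is the (unitary) Fourier transform on `L²(ℝ; ℂ)`; the angular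
frequency of the ordinary frequency `ξ` is `om = 2πξ`. -/

/-- Fourier transform of a real `L²` function of time. -/
def timeFourier (v : TimeL2) : Lp ℂ 2 (volume : Measure ℝ) :=
  𝓕 (Complex.ofRealCLM.compLp v)

/-- The real function with Fourier transform `g`, for a Hermitian `g ∈ L²(ℝ; ℂ)`. -/
def fromSpectrum (g : ℝ → ℂ) : TimeL2 := by
  classical
  exact if h : MemLp g 2 (volume : Measure ℝ) then Complex.reCLM.compLp (𝓕⁻ (h.toLp g)) else 0

/-- The Fourier multiplier `v ↦ 𝓕⁻¹ (m · 𝓕 v)`, the symbol `m` being a function of the angular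
frequency. -/
def timeMult (m : ℝ → ℂ) (v : TimeL2) : TimeL2 :=
  fromSpectrum fun ξ => m (2 * Real.pi * ξ) * timeFourier v ξ

/-- Hilbert transform, symbol `-i sgn om` in the angular frequency `om`. -/
def hilbert : TimeL2 → TimeL2 := timeMult fun om => -Complex.I * (SignType.sign om : ℝ)

/-- Half-derivative `∂₊^{1/2}`, symbol `√(i om)`. -/
def halfPlus : TimeL2 → TimeL2 := timeMult fun om => (Complex.I * om) ^ (1 / 2 : ℂ)

/-- Half-derivative `∂₋^{1/2}`, whose symbol is the conjugate of `√(i om)`. -/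
def halfMinus : TimeL2 → TimeL2 :=
  timeMult fun om => (starRingEnd ℂ) ((Complex.I * om) ^ (1 / 2 : ℂ))

/-- Quarter-derivative `∂^{1/4}`, symbol `(i om)^{1/4}`. -/
def quarterDeriv : TimeL2 → TimeL2 := timeMult fun om => (Complex.I * om) ^ (1 / 4 : ℂ)

/-- Squared norm of `Hˢ(ℝ)`. -/
def sobolevSq (s : ℝ) (v : TimeL2) : ℝ :=
  ∫ ξ : ℝ, (1 + (2 * Real.pi * ξ) ^ 2) ^ s * ‖timeFourier v ξ‖ ^ 2

/-- The even piecewise linear function on the grid `τℤ` that is `1` at `±jτ` and `0` at the other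
grid points, cut off outside `[-κ, κ]`. -/
def spectralHat (τ κ : ℝ) (j : ℕ) (om : ℝ) : ℝ :=
  if |om| ≤ κ then max 0 (1 - |(|om| / τ - j)|) else 0

/-- The temporal basis function `ψ_j`. -/
def spectralBasis (τ κ : ℝ) (j : ℕ) : TimeL2 :=
  fromSpectrum fun ξ => (spectralHat τ κ j (2 * Real.pi * ξ) : ℂ)

/-- The temporal space `U`, the span of `ψ_j` and of the Hilbert transforms of `ψ_j`,
`j = 0, …, N`. -/
def spectralSpace (N : ℕ) (τ κ : ℝ) : Submodule ℝ TimeL2 :=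
  Submodule.span ℝ {v | ∃ j : ℕ, j ≤ N ∧ (v = spectralBasis τ κ j ∨
    v = hilbert (spectralBasis τ κ j))}

/-! ### Lipschitz domains and Sobolev spaces -/

variable {d : ℕ}

/-- `(d-1)`-dimensional surface measure. -/
def surface (d : ℕ) : Measure (Space d) := Measure.euclideanHausdorffMeasure (d - 1)

/-- Bounded Lipschitz open sets: near each boundary point the set is, in rotated Cartesian
coordinates, the strict epigraph of a Lipschitz function of the first `d - 1` coordinates. -/
def IsLipschitzDomain (G : Set (Space d)) : Prop :=
  IsOpen G ∧ Bornology.IsBounded G ∧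
    ∀ x ∈ frontier G, ∃ e : Space d, ‖e‖ = 1 ∧ ∃ r : ℝ, 0 < r ∧
      ∃ (L : ℝ≥0) (g : Space d → ℝ), LipschitzWith L g ∧
        ∀ y ∈ Metric.ball x r, (y ∈ G ↔ g (y - inner ℝ e y • e) < inner ℝ e y)

/-- `k`-dimensional Lipschitz manifolds in `ℝᵈ`: locally bi-Lipschitz images of open subsets of
`ℝᵏ`. -/
def IsLipschitzManifold (k : ℕ) (S : Set (Space d)) : Prop :=
  ∀ x ∈ S, ∃ U : Set (Space d), IsOpen U ∧ x ∈ U ∧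
    ∃ (O : Set (Space k)) (Φ : Space k → Space d) (L : ℝ≥0), IsOpen O ∧ Φ '' O = S ∩ U ∧
      LipschitzOnWith L Φ O ∧ ∀ a ∈ O, ∀ b ∈ O, dist a b ≤ L * dist (Φ a) (Φ b)

/-- `v ∈ H¹(G)` with weak gradient `g`. -/
def IsH1 (G : Set (Space d)) (v : Space d → ℝ) (g : Space d → Space d) : Prop :=
  MemLp v 2 (volume.restrict G) ∧ MemLp g 2 (volume.restrict G) ∧
    ∀ θ : Space d → ℝ, ContDiff ℝ ∞ θ → HasCompactSupport θ → tsupport θ ⊆ G →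
      ∀ e : Space d, ∫ x in G, v x * fderiv ℝ θ x e = -∫ x in G, inner ℝ (g x) e * θ x

/-- `w` is the boundary trace of `v ∈ H¹(G)` (with weak gradient `g`): the trace operator is the
`H¹(G) → L²(∂G)` closure of the restriction to `∂G` of the functions in `H¹(G) ∩ C(closure G)`. -/
def HasTrace (G : Set (Space d)) (v : Space d → ℝ) (g : Space d → Space d)
    (w : Space d → ℝ) : Prop :=
  MemLp w 2 ((surface d).restrict (frontier G)) ∧
    ∃ (vn : ℕ → Space d → ℝ) (gn : ℕ → Space d → Space d),
      (∀ n, IsH1 G (vn n) (gn n) ∧ ContinuousOn (vn n) (closure G)) ∧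
      Tendsto (fun n => eLpNorm (vn n - v) 2 (volume.restrict G)) atTop (𝓝 0) ∧
      Tendsto (fun n => eLpNorm (gn n - g) 2 (volume.restrict G)) atTop (𝓝 0) ∧
      Tendsto (fun n => eLpNorm (vn n - w) 2 ((surface d).restrict (frontier G))) atTop (𝓝 0)

/-- `v ∈ H¹(G)`, with weak gradient `g`, has vanishing trace on the boundary part `B ⊆ ∂G`. -/
def IsH1ZeroOn (G B : Set (Space d)) (v : Space d → ℝ) (g : Space d → Space d) : Prop :=
  IsH1 G v g ∧ ∃ w, HasTrace G v g w ∧ ∀ᵐ x ∂((surface d).restrict B), w x = 0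

/-- The Poincaré constant: the least `C` with `‖v‖² ≤ C ‖∇v‖²` (norms of `L²(G)`) for all
`v ∈ H¹(G)` with vanishing trace on `B`. -/
def poincareConst (G B : Set (Space d)) : ℝ≥0∞ :=
  sInf {C | ∀ v g, IsH1ZeroOn G B v g →
    ∫⁻ x in G, ‖v x‖ₑ ^ 2 ≤ C * ∫⁻ x in G, ‖g x‖ₑ ^ 2}

/-! ### The continuous problem -/

/-- Data of the problem: the domain, the two subdomains (`sub 0` is `Ω₁`, `sub 1` is `Ω₂`), the
nonlinearities and the source term `f(x, t)`. -/
structure Problem (d : ℕ) where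
  Ω : Set (Space d)
  sub : Fin 2 → Set (Space d)
  α : Space d → ℝ → Space d → Space d
  β : Space d → ℝ → Space d → ℝ
  f : Space d → ℝ → ℝ

namespace Problem

variable (D : Problem d)

/-- The interface `Γ`. -/
def Γ : Set (Space d) := (frontier (D.sub 0) ∩ frontier (D.sub 1)) \ frontier D.Ω

/-- Assumptions on the domains. A subdomain need not be connected, but each of its connected
components has to reach the part of `∂Ω` that does not belong to the other subdomain; for a
connected `Ωᵢ` this says that `∂Ω \ ∂Ωⱼ` is nonempty, `j ≠ i`. -/
structure DomainAssumption : Prop where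
  lipschitz : IsLipschitzDomain D.Ω
  lipschitz_sub : ∀ i, IsLipschitzDomain (D.sub i)
  closure_eq : closure D.Ω = closure (D.sub 0) ∪ closure (D.sub 1)
  disjoint : D.sub 0 ∩ D.sub 1 = ∅
  interface : IsLipschitzManifold (d - 1) D.Γ
  exterior : ∀ i, IsLipschitzManifold (d - 1) (frontier D.Ω \ frontier (D.sub i))
  reaches_boundary : ∀ i j, i ≠ j → ∀ x ∈ D.sub i,
    (closure (connectedComponentIn (D.sub i) x) ∩
      (frontier D.Ω \ frontier (D.sub j))).Nonempty

/-- The largest Poincaré constant of `Ω` (functions vanishing on `∂Ω`) and of `Ωᵢ` (functions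
vanishing on `∂Ωᵢ \ Γ`). -/
def Cp : ℝ≥0∞ :=
  poincareConst D.Ω (frontier D.Ω) ⊔ ⨆ i, poincareConst (D.sub i) (frontier (D.sub i) \ D.Γ)

/-- Assumptions on the nonlinearities: measurability, Lipschitz continuity, uniform monotonicity,
and the normalization that they vanish at `(x, 0, 0)`. -/
def CoefficientAssumption : Prop :=
  (∀ y z, AEMeasurable (fun x => D.α x y z) (volume.restrict D.Ω)) ∧
  (∀ y z, AEMeasurable (fun x => D.β x y z) (volume.restrict D.Ω)) ∧
  (∀ᵐ x ∂(volume.restrict D.Ω), D.α x 0 0 = 0 ∧ D.β x 0 0 = 0) ∧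
  ∃ h₁ h₂ h₃ : Space d → ℝ,
    (∀ᵐ x ∂(volume.restrict D.Ω), 0 ≤ h₁ x ∧ 0 ≤ h₂ x ∧ 0 ≤ h₃ x) ∧
    MemLp h₁ ⊤ (volume.restrict D.Ω) ∧ MemLp h₂ ⊤ (volume.restrict D.Ω) ∧
    MemLp h₃ ⊤ (volume.restrict D.Ω) ∧
    (∀ᵐ x ∂(volume.restrict D.Ω), ∀ (y y' : ℝ) (z z' : Space d),
      ‖D.α x y z - D.α x y' z'‖ ≤ h₁ x * (‖z - z'‖ + |y - y'|) ∧
      |D.β x y z - D.β x y' z'| ≤ h₁ x * (‖z - z'‖ + |y - y'|) ∧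
      h₂ x * ‖z - z'‖ ^ 2 - h₃ x * |y - y'| ^ 2 ≤
        inner ℝ (D.α x y z - D.α x y' z') (z - z') +
          (D.β x y z - D.β x y' z') * (y - y')) ∧
    D.Cp * ENNReal.ofReal (essSup h₃ (volume.restrict D.Ω)) <
      ENNReal.ofReal (essInf h₂ (volume.restrict D.Ω))

/-- `f ∈ L²(Ω × ℝ)`. -/
def SourceAssumption : Prop :=
  MemLp (fun p : Space d × ℝ => D.f p.1 p.2) 2 ((volume.restrict D.Ω).prod volume)

end Problem

/-- The `j`-th spatial partial derivative of a function of space and time. -/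
def partialDeriv (u : Space d → TimeL2) (j : Fin d) (x : Space d) : TimeL2 :=
  fderiv ℝ u x (EuclideanSpace.single j 1)

/-- The spatial gradient at the point `x` and the time `t`. -/
def gradAt (u : Space d → TimeL2) (x : Space d) (t : ℝ) : Space d :=
  WithLp.toLp 2 fun j => partialDeriv u j x t

/-- `∫_{G × ℝ} ∇u · ∇v`. -/
def gradForm (G : Set (Space d)) (u v : Space d → TimeL2) : ℝ :=
  ∫ x in G, ∑ j, inner ℝ (partialDeriv u j x) (partialDeriv v j x)

namespace Problem

variable (D : Problem d)

/-- The form `∫_{G × ℝ} ∂₊^{1/2}u ∂₋^{1/2}v + α(x, u, ∇u) · ∇v + β(x, u, ∇u) v`; it is `a` for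
`G = Ω` and `aᵢ` for `G = Ωᵢ`. -/
def form (G : Set (Space d)) (u v : Space d → TimeL2) : ℝ :=
  ∫ x in G, (inner ℝ (halfPlus (u x)) (halfMinus (v x)) +
    ∫ t, (inner ℝ (D.α x (u x t) (gradAt u x t)) (gradAt v x t) +
      D.β x (u x t) (gradAt u x t) * v x t))

/-- `(f, v)` in `L²(G × ℝ)`. -/
def source (G : Set (Space d)) (v : Space d → TimeL2) : ℝ :=
  ∫ x in G, ∫ t, D.f x t * v x t

/-- Norm of `Wᵢ`, the intersection of `H^{1/2}(ℝ) ⊗ L²(Ωᵢ)` and `L²(ℝ) ⊗ H¹(Ωᵢ)`. -/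
def normW (i : Fin 2) (u : Space d → TimeL2) : ℝ :=
  Real.sqrt ((∫ x in D.sub i, sobolevSq (1 / 2) (u x)) +
    (gradForm (D.sub i) u u + ∫ x in D.sub i, ‖u x‖ ^ 2))

/-- Norm of `Z`, the intersection of `H^{1/4}(ℝ) ⊗ L²(Γ)` and `L²(ℝ) ⊗ Λ`, where the norm of `Λ`
is the `H^{1/2}(∂Ωᵢ)`-norm of the extension by zero. Elements of `Z` are functions that are zero
off `Γ`. -/
def normZ (i : Fin 2) (η : Space d → TimeL2) : ℝ :=
  Real.sqrt ((∫ x in D.Γ, sobolevSq (1 / 4) (η x) ∂(surface d)) +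
    ((∫ x in frontier (D.sub i), ∫ y in frontier (D.sub i),
        ‖η x - η y‖ ^ 2 / dist x y ^ d ∂(surface d) ∂(surface d)) +
      ∫ x in frontier (D.sub i), ‖η x‖ ^ 2 ∂(surface d)))

/-- The trace on `Γ` of a function that is continuous up to the boundary (extended by zero
off `Γ`). -/
def trace : (Space d → TimeL2) →ₗ[ℝ] (Space d → TimeL2) where
  toFun u := D.Γ.indicator u
  map_add' u v := Set.indicator_add _ u v
  map_smul' c u := Set.indicator_const_smul _ c u

end Problem

/-! ### The discretization -/

/-- Functions on `G` (extended by zero) that are affine on each simplex of `K` contained in `G`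
and vanish on `B`. -/
def plSpace (K : Geometry.SimplicialComplex ℝ (Space d)) (G B : Set (Space d)) :
    Submodule ℝ (Space d → ℝ) where
  carrier := {v | (∀ s ∈ K.faces, convexHull ℝ (s : Set (Space d)) ⊆ G →
      ∃ A : Space d →ᵃ[ℝ] ℝ, EqOn v A (convexHull ℝ (s : Set (Space d)))) ∧
    (∀ x, x ∉ G → v x = 0) ∧ ∀ x ∈ B, v x = 0}
  add_mem' := by
    rintro v w ⟨hv, hv', hv''⟩ ⟨hw, hw', hw''⟩
    refine ⟨fun s hs hG => ?_, fun x hx => ?_, fun x hx => ?_⟩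
    · obtain ⟨A, hA⟩ := hv s hs hG
      obtain ⟨A', hA'⟩ := hw s hs hG
      exact ⟨A + A', fun x hx => by simp [hA hx, hA' hx]⟩
    · simp [hv' x hx, hw' x hx]
    · simp [hv'' x hx, hw'' x hx]
  zero_mem' := ⟨fun _ _ _ => ⟨0, fun _ _ => rfl⟩, fun _ _ => rfl, fun _ _ => rfl⟩
  smul_mem' := by
    rintro c v ⟨hv, hv', hv''⟩
    refine ⟨fun s hs hG => ?_, fun x hx => ?_, fun x hx => ?_⟩
    · obtain ⟨A, hA⟩ := hv s hs hG
      exact ⟨c • A, fun x hx => by simp [hA hx]⟩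
    · simp [hv' x hx]
    · simp [hv'' x hx]

/-- The algebraic tensor product `U ⊗ V`, realized as functions of space with values in
`L²(ℝ)`. -/
def tensor (U : Submodule ℝ TimeL2) (V : Submodule ℝ (Space d → ℝ)) :
    Submodule ℝ (Space d → TimeL2) :=
  Submodule.span ℝ {u | ∃ φ ∈ V, ∃ ψ ∈ U, u = fun x => φ x • ψ}

/-- A continuous problem together with its discretization: a spatial mesh, the spectral parameters
`N`, `τ` and the frequency `κ` beyond which the temporal basis is cut off. -/
structure DiscreteProblem (d : ℕ) extends Problem d where
  K : Geometry.SimplicialComplex ℝ (Space d)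
  N : ℕ
  τ : ℝ
  κ : ℝ

namespace DiscreteProblem

variable (D : DiscreteProblem d)

/-- The mesh is a finite conforming simplicial partition of `Ω` that resolves the subdomains. -/
structure MeshAssumption : Prop where
  finite : D.K.faces.Finite
  space_eq : D.K.space = closure D.Ω
  resolves : ∀ s ∈ D.K.faces, ∃ i, convexHull ℝ (s : Set (Space d)) ⊆ closure (D.sub i)

def U : Submodule ℝ TimeL2 := spectralSpace D.N D.τ D.κ

/-- `Vʰ`. -/
def V : Submodule ℝ (Space d → ℝ) := plSpace D.K (closure D.Ω) (frontier D.Ω)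

/-- `Vᵢʰ`. -/
def Vsub (i : Fin 2) : Submodule ℝ (Space d → ℝ) :=
  plSpace D.K (closure (D.sub i)) (frontier (D.sub i) \ D.Γ)

/-- `Vᵢ^{0,h}`. -/
def Vsub0 (i : Fin 2) : Submodule ℝ (Space d → ℝ) :=
  plSpace D.K (closure (D.sub i)) (frontier (D.sub i))

/-- `Wʰ`. -/
def W : Submodule ℝ (Space d → TimeL2) := tensor D.U D.V

/-- `Wᵢʰ`. -/
def Wsub (i : Fin 2) : Submodule ℝ (Space d → TimeL2) := tensor D.U (D.Vsub i)

/-- `Wᵢ^{0,h}`. -/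
def Wsub0 (i : Fin 2) : Submodule ℝ (Space d → TimeL2) := tensor D.U (D.Vsub0 i)

/-- The discrete trace space `Zʰ = T₁W₁ʰ`. -/
def Z : Submodule ℝ (Space d → TimeL2) := (D.Wsub 0).map D.trace

/-- Matching discrete traces, `T₁W₁ʰ = T₂W₂ʰ`. -/
def MatchingTraces : Prop := (D.Wsub 0).map D.trace = (D.Wsub 1).map D.trace

/-- `u ∈ Wʰ` solves the discrete weak equation. -/
def IsWeakSolution (u : Space d → TimeL2) : Prop :=
  u ∈ D.W ∧ ∀ v ∈ D.W, D.form D.Ω u v = D.source D.Ω v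

/-- `u ∈ Wᵢʰ` solves the discrete equation on `Ωᵢ × ℝ` with the interface value `η`. -/
def IsDirichletSolution (i : Fin 2) (η u : Space d → TimeL2) : Prop :=
  u ∈ D.Wsub i ∧ D.trace u = η ∧
    ∀ v ∈ D.Wsub0 i, D.form (D.sub i) u v = D.source (D.sub i) v

/-- The discrete solution operator `Fᵢʰ`. -/
def F (i : Fin 2) (η : Space d → TimeL2) : Space d → TimeL2 :=
  Classical.epsilon (D.IsDirichletSolution i η)

/-- `R` is a linear right inverse `Zʰ → Wᵢʰ` of the trace operator (the values of `R` off `Zʰ` play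
no role). -/
def IsExtension (i : Fin 2) (R : (Space d → TimeL2) →ₗ[ℝ] (Space d → TimeL2)) : Prop :=
  ∀ η ∈ D.Z, R η ∈ D.Wsub i ∧ D.trace (R η) = η

/-- The discrete Steklov–Poincaré operator `S = S₁ + S₂` as a form `⟨Sη, μ⟩`. -/
def S (R : Fin 2 → (Space d → TimeL2) →ₗ[ℝ] (Space d → TimeL2))
    (η μ : Space d → TimeL2) : ℝ :=
  ∑ i, (D.form (D.sub i) (D.F i η) (R i μ) - D.source (D.sub i) (R i μ))

/-- `w` is the discrete elliptic extension of `η` to `Ω₂ × ℝ`: `∫_{Ω₂} ∇w · ∇v dx = 0` in `L²(ℝ)`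
for all `v ∈ V₂^{0,h}`. -/
def IsEllipticExtension (η w : Space d → TimeL2) : Prop :=
  w ∈ D.Wsub 1 ∧ D.trace w = η ∧
    ∀ v ∈ D.Vsub0 1,
      ∫ x in D.sub 1, ∑ j, fderiv ℝ v x (EuclideanSpace.single j 1) • partialDeriv w j x = 0

/-- The discrete elliptic extension operator `H₂`. -/
def H₂ (η : Space d → TimeL2) : Space d → TimeL2 :=
  Classical.epsilon (D.IsEllipticExtension η)

/-- `⟨P₁η, μ⟩`, built with an extension operator `R₂`. -/
def P₁ (R₂ : (Space d → TimeL2) →ₗ[ℝ] (Space d → TimeL2)) (η μ : Space d → TimeL2) : ℝ :=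
  (∫ x in D.sub 1, inner ℝ (halfPlus (R₂ η x)) (halfPlus (R₂ μ x))) +
    gradForm (D.sub 1) (R₂ η) (R₂ μ)

/-- `⟨P₂η, μ⟩`. -/
def P₂ (η μ : Space d → TimeL2) : ℝ :=
  (∫ x in D.Γ, inner ℝ (quarterDeriv (η x)) (quarterDeriv (μ x)) ∂(surface d)) +
    gradForm (D.sub 1) (D.H₂ η) (D.H₂ μ)

/-- `cos φ I - sin φ 𝓗`, the Hilbert transform `𝓗` acting in time. -/
def rotate (φ : ℝ) (η : Space d → TimeL2) : Space d → TimeL2 :=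
  fun x => Real.cos φ • η x - Real.sin φ • hilbert (η x)

/-- `η` is a sequence of iterates in `Zʰ` of the modified Dirichlet–Neumann method
`η^{n+1} = η^n + s P⁻¹ (𝓗^φ)* (0 - S η^n)` with the initial guess `η₀`. -/
def IsMDNIteration (R : Fin 2 → (Space d → TimeL2) →ₗ[ℝ] (Space d → TimeL2))
    (P : (Space d → TimeL2) → (Space d → TimeL2) → ℝ) (φ s : ℝ) (η₀ : Space d → TimeL2)
    (η : ℕ → Space d → TimeL2) : Prop :=
  η 0 = η₀ ∧ (∀ n, η n ∈ D.Z) ∧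
    ∀ n, ∀ μ ∈ D.Z, P (η (n + 1) - η n) μ = s * (0 - D.S R (η n) (rotate φ μ))

end DiscreteProblem

end MDN

end

open MeasureTheory Set Filter Topology FourierTransform
open scoped ENNReal NNReal ContDiff ComplexConjugate

noncomputable section

namespace MDN

/-! ### Fourier transform of real functions -/

/-! Everything takes place in finite-dimensional spaces: `U` is spanned by finitely many
band-limited functions of time, and piecewise linear functions on a finite mesh are determined by
their vertex values. Band-limitation turns the fractional derivatives into bounded linear maps, and
norms given by positive definite forms are all comparable. The constants may depend on the
discretization.

The engine is strong monotonicity. With the same function in both slots, the term with the two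
half-derivatives is the integral of the real part of an imaginary quantity, so it vanishes
(`inner_halfPlus_halfMinus_self`). For a difference w of two functions there remains the lower bound
ess inf h₂ ‖∇w‖² - ess sup h₃ ‖w‖², whose last term the Poincaré inequality absorbs
(`exists_coercive`). Hence the residuals a_i(u, ·) - (f, ·) are strongly monotone and Lipschitz with
respect to the Dirichlet form (`isStronglyMonotone_formL`). Zarantonello's theorem
(`IsStronglyMonotone.existsUnique`) yields F_i, which is Lipschitz in η; its linear case yields H₂.

F_i η - F_i η' and R_i(η - η') have the same trace, so the difference of Sη and Sη' tested with η -
η' equals the sum of the monotone differences of a_i at F_i η and F_i η'. Therefore S is strongly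
monotone and Lipschitz for every inner product on the trace space (`isStronglyMonotone_steklov`), in
particular for P₁ and P₂. Rotating the test function by a small angle is a small perturbation, and
one step of the iteration contracts the norm of the preconditioner (`contraction_step`,
`IsStronglyMonotone.exists_rotated_rate`). The zero of S corresponds to the weak solution by
restriction and gluing (`exists_glue`, `isWeakSolution_iff`).

The rest is geometry. The Dirichlet form is definite because a piecewise linear function without
gradient is constant on components, each of which reaches the Dirichlet boundary (`pl_eq_zero`).
Piecewise linear functions are Lipschitz across simplices (`exists_weight_bound`, `pl_lipschitz`),
so they compete in the definition of the Poincaré constant (`isH1ZeroOn_pl`). The norm of Z is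
bounded above because |x-y|^(2-d) is integrable over a Lipschitz boundary (`lintegral_singular_le`),
and below because open pieces of Γ have positive surface measure (`surface_pos_of_manifold`). -/

/-- The symmetry that characterizes the spectra of real functions. -/
def IsHermitian (g : ℝ → ℂ) : Prop := ∀ᵐ ξ : ℝ, g (-ξ) = conj (g ξ)

lemma measurePreserving_neg_real :
    MeasurePreserving (fun x : ℝ => -x) (volume : Measure ℝ) volume :=
  Measure.measurePreserving_neg volume

/-- Complex conjugation on `L²`. -/
def conjLp : Lp ℂ 2 (volume : Measure ℝ) →L[ℝ] Lp ℂ 2 (volume : Measure ℝ) :=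
  (Complex.conjCLE : ℂ →L[ℝ] ℂ).compLpL 2 volume

/-- Reflection on `L²`. -/
def reflectLp : Lp ℂ 2 (volume : Measure ℝ) →ₗᵢ[ℝ] Lp ℂ 2 (volume : Measure ℝ) :=
  Lp.compMeasurePreservingₗᵢ ℝ (fun x : ℝ => -x) measurePreserving_neg_real

lemma coeFn_conjLp (v : Lp ℂ 2 (volume : Measure ℝ)) : conjLp v =ᵐ[volume] fun x => conj (v x) := by
  simpa [conjLp] using ContinuousLinearMap.coeFn_compLpL (Complex.conjCLE : ℂ →L[ℝ] ℂ) v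

lemma coeFn_reflectLp (v : Lp ℂ 2 (volume : Measure ℝ)) :
    reflectLp v =ᵐ[volume] fun x => v (-x) :=
  Lp.coeFn_compMeasurePreserving v measurePreserving_neg_real

lemma fourier_conj_apply (f : ℝ → ℂ) (ξ : ℝ) :
    𝓕 (fun x => conj (f x)) ξ = conj (𝓕 f (-ξ)) := by
  rw [Real.fourier_eq, Real.fourier_eq, ← integral_conj]
  congr 1
  ext v
  simp only [Circle.smul_def, smul_eq_mul, map_mul, inner_neg_right, neg_neg]
  congr 1
  rw [← Circle.coe_inv_eq_conj, AddChar.map_neg_eq_inv]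

/-- Both sides are continuous in `v`, and Schwartz functions are dense; for these the identity is
the one for the Fourier integral. -/
lemma fourier_conjLp (v : Lp ℂ 2 (volume : Measure ℝ)) :
    𝓕 (conjLp v) = conjLp (reflectLp (𝓕 v)) := by
  have hc : Continuous (fun v : Lp ℂ 2 (volume : Measure ℝ) => 𝓕 v) :=
    (Lp.fourierTransformₗᵢ ℝ ℂ).continuous
  refine DenseRange.induction_on
    (p := fun v : Lp ℂ 2 (volume : Measure ℝ) => 𝓕 (conjLp v) = conjLp (reflectLp (𝓕 v)))
    (SchwartzMap.denseRange_toLpCLM (E := ℝ) (F := ℂ) (p := 2) (μ := volume) ENNReal.ofNat_ne_top)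
    v ?_ ?_
  · exact isClosed_eq (hc.comp conjLp.continuous)
      (conjLp.continuous.comp (reflectLp.continuous.comp hc))
  · intro f
    have h1 : conjLp (f.toLp 2) =
        (SchwartzMap.postcompCLM (Complex.conjCLE : ℂ →L[ℝ] ℂ) f).toLp 2 := by
      apply Lp.ext
      filter_upwards [coeFn_conjLp (f.toLp 2), f.coeFn_toLp 2 volume,
        (SchwartzMap.postcompCLM (Complex.conjCLE : ℂ →L[ℝ] ℂ) f).coeFn_toLp 2 volume]
        with x h1 h2 h3
      rw [h1, h2, h3]
      rfl
    change 𝓕 (conjLp (f.toLp 2)) = conjLp (reflectLp (𝓕 (f.toLp 2)))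
    rw [h1, SchwartzMap.toLp_fourier_eq, SchwartzMap.toLp_fourier_eq]
    apply Lp.ext
    have h2 := (𝓕 f).coeFn_toLp 2 (volume : Measure ℝ)
    filter_upwards [coeFn_conjLp (reflectLp ((𝓕 f).toLp 2)), coeFn_reflectLp ((𝓕 f).toLp 2),
      measurePreserving_neg_real.quasiMeasurePreserving.ae h2,
      (𝓕 (SchwartzMap.postcompCLM (Complex.conjCLE : ℂ →L[ℝ] ℂ) f)).coeFn_toLp 2 volume]
      with x h3 h4 h5 h6
    rw [h6, h3, h4, h5, SchwartzMap.fourier_coe, SchwartzMap.fourier_coe]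
    exact fourier_conj_apply f x

lemma coeFn_fourier_conjLp (v : Lp ℂ 2 (volume : Measure ℝ)) :
    (𝓕 (conjLp v) : Lp ℂ 2 (volume : Measure ℝ)) =ᵐ[volume]
      fun ξ => conj ((𝓕 v : Lp ℂ 2 (volume : Measure ℝ)) (-ξ)) := by
  rw [fourier_conjLp]
  filter_upwards [coeFn_conjLp (reflectLp (𝓕 v)), coeFn_reflectLp (𝓕 v)] with x h1 h2
  rw [h1, h2]

/-- Real functions as complex functions. -/
def complexify : TimeL2 →L[ℝ] Lp ℂ 2 (volume : Measure ℝ) := Complex.ofRealCLM.compLpL 2 volume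

lemma coeFn_complexify (v : TimeL2) : complexify v =ᵐ[volume] fun t => ((v t : ℝ) : ℂ) :=
  ContinuousLinearMap.coeFn_compLpL Complex.ofRealCLM v

lemma timeFourier_eq (v : TimeL2) : timeFourier v = 𝓕 (complexify v) := rfl

lemma conjLp_complexify (v : TimeL2) : conjLp (complexify v) = complexify v := by
  apply Lp.ext
  filter_upwards [coeFn_conjLp (complexify v), coeFn_complexify v] with t h1 h2
  rw [h1, h2, Complex.conj_ofReal]

lemma isHermitian_timeFourier (v : TimeL2) : IsHermitian (timeFourier v) := by
  have h := coeFn_fourier_conjLp (complexify v)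
  rw [conjLp_complexify] at h
  have h' := measurePreserving_neg_real.quasiMeasurePreserving.ae h
  filter_upwards [h'] with ξ hξ
  rw [timeFourier_eq, hξ, neg_neg]

/-- The Fourier transform on `L²(ℝ)`, as a linear map. -/
def timeFourierL : TimeL2 →L[ℝ] Lp ℂ 2 (volume : Measure ℝ) :=
  ((Lp.fourierTransformₗᵢ ℝ ℂ).toContinuousLinearEquiv.toContinuousLinearMap.restrictScalars ℝ).comp
    complexify

lemma timeFourierL_apply (v : TimeL2) : timeFourierL v = timeFourier v := rfl

lemma timeFourier_add (v w : TimeL2) : timeFourier (v + w) = timeFourier v + timeFourier w :=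
  map_add timeFourierL v w

lemma timeFourier_smul (c : ℝ) (v : TimeL2) : timeFourier (c • v) = c • timeFourier v :=
  map_smul timeFourierL c v

lemma re_complexify (v : TimeL2) : Complex.reCLM.compLp (complexify v) = v := by
  apply Lp.ext
  filter_upwards [ContinuousLinearMap.coeFn_compLp Complex.reCLM (complexify v),
    coeFn_complexify v] with t h1 h2
  rw [h1, h2]
  simp

lemma timeFourier_injective : Function.Injective timeFourier := by
  intro v w h
  rw [timeFourier_eq, timeFourier_eq] at h
  have h1 : complexify v = complexify w := (Lp.fourierTransformₗᵢ ℝ ℂ).injective h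
  rw [← re_complexify v, h1, re_complexify]

lemma timeFourier_ext {v w : TimeL2} (h : timeFourier v =ᵐ[volume] timeFourier w) : v = w :=
  timeFourier_injective (Lp.ext h)

/-- The inverse transform of a Hermitian `g` is fixed by conjugation, hence real, so the real part
taken in `fromSpectrum` loses nothing. -/
lemma timeFourier_fromSpectrum {g : ℝ → ℂ} (hg : MemLp g 2 (volume : Measure ℝ))
    (hh : IsHermitian g) : timeFourier (fromSpectrum g) =ᵐ[volume] g := by
  set G : Lp ℂ 2 (volume : Measure ℝ) := hg.toLp g
  have hG : G =ᵐ[volume] g := hg.coeFn_toLp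
  set p : Lp ℂ 2 (volume : Measure ℝ) := 𝓕⁻ G
  have hp : 𝓕 p = G := (Lp.fourierTransformₗᵢ ℝ ℂ).apply_symm_apply G
  have hreal : conjLp p = p := by
    apply (Lp.fourierTransformₗᵢ ℝ ℂ).injective
    change 𝓕 (conjLp p) = 𝓕 p
    apply Lp.ext
    filter_upwards [coeFn_fourier_conjLp p, hh, hG,
      measurePreserving_neg_real.quasiMeasurePreserving.ae hG] with ξ h1 h2 h3 h4
    rw [h1, hp, h3, h4, h2, Complex.conj_conj]
  have hfs : fromSpectrum g = Complex.reCLM.compLp p := by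
    unfold fromSpectrum
    rw [dif_pos hg]
  have hcp : complexify (fromSpectrum g) = p := by
    rw [hfs]
    apply Lp.ext
    have h0 := coeFn_conjLp p
    rw [hreal] at h0
    filter_upwards [coeFn_complexify (Complex.reCLM.compLp p),
      ContinuousLinearMap.coeFn_compLp Complex.reCLM p, h0] with t h1 h2 h3
    rw [h1, h2]
    exact Complex.conj_eq_iff_re.mp h3.symm
  rw [timeFourier_eq, hcp, hp]
  exact hG

lemma norm_timeFourier (v : TimeL2) : ‖timeFourier v‖ = ‖v‖ := by
  rw [timeFourier_eq, Lp.norm_fourier_eq]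
  apply le_antisymm
  · apply Lp.norm_le_norm_of_ae_le
    filter_upwards [coeFn_complexify v] with t h
    rw [h]; simp
  · apply Lp.norm_le_norm_of_ae_le
    filter_upwards [coeFn_complexify v] with t h
    rw [h]; simp

/-- Plancherel: the complex inner product of two real functions is already real. -/
lemma inner_eq_integral_timeFourier (v w : TimeL2) :
    inner ℝ v w = ∫ ξ, (conj (timeFourier v ξ) * timeFourier w ξ).re := by
  have h1 : (inner ℂ (timeFourier v) (timeFourier w)) = ((inner ℝ v w : ℝ) : ℂ) := by
    rw [timeFourier_eq, timeFourier_eq, Lp.inner_fourier_eq, L2.inner_def, L2.inner_def,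
      ← integral_complex_ofReal]
    apply integral_congr_ae
    filter_upwards [coeFn_complexify v, coeFn_complexify w] with t h1 h2
    rw [h1, h2]
    simp [RCLike.inner_apply]
  have h2 : (inner ℝ v w : ℝ) = (inner ℂ (timeFourier v) (timeFourier w)).re := by
    rw [h1]; simp
  rw [h2, L2.inner_def, ← RCLike.re_eq_complex_re, ← integral_re]
  · apply integral_congr_ae
    filter_upwards with ξ
    simp [RCLike.inner_apply, mul_comm]
  · exact L2.integrable_inner _ _

/-! ### Fourier multipliers on band-limited functions -/

/-- Symbols of real Fourier multipliers that are bounded on bounded sets of frequencies. -/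
structure IsSymbol (m : ℝ → ℂ) : Prop where
  measurable : Measurable m
  neg : ∀ om, m (-om) = conj (m om)
  bounded : ∀ κ : ℝ, ∃ C, ∀ om, |om| ≤ κ → ‖m om‖ ≤ C

/-- Functions whose spectrum lies in `[-κ, κ]`. -/
def bandLimited (κ : ℝ) : Submodule ℝ TimeL2 where
  carrier := {v | ∀ᵐ ξ : ℝ, κ < |2 * Real.pi * ξ| → timeFourier v ξ = 0}
  add_mem' := by
    intro v w hv hw
    change ∀ᵐ ξ : ℝ, _
    rw [timeFourier_add]
    filter_upwards [hv, hw, Lp.coeFn_add (timeFourier v) (timeFourier w)] with ξ h1 h2 h3 h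
    rw [h3, Pi.add_apply, h1 h, h2 h, add_zero]
  zero_mem' := by
    change ∀ᵐ ξ : ℝ, _
    have : timeFourier 0 = 0 := map_zero timeFourierL
    rw [this]
    filter_upwards [Lp.coeFn_zero ℂ 2 (volume : Measure ℝ)] with ξ h1 h
    rw [h1, Pi.zero_apply]
  smul_mem' := by
    intro c v hv
    change ∀ᵐ ξ : ℝ, _
    rw [timeFourier_smul]
    filter_upwards [hv, Lp.coeFn_smul c (timeFourier v)] with ξ h1 h3 h
    rw [h3, Pi.smul_apply, h1 h, smul_zero]

section Multiplier

variable {m : ℝ → ℂ} {κ : ℝ} {v w : TimeL2}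

/-- The symbol is bounded on the spectrum of `v`. Without this the product could leave L², and
`fromSpectrum` would return its default value 0. -/
lemma memLp_mult (hm : IsSymbol m) (hv : v ∈ bandLimited κ) :
    MemLp (fun ξ => m (2 * Real.pi * ξ) * timeFourier v ξ) 2 (volume : Measure ℝ) := by
  obtain ⟨C, hC⟩ := hm.bounded κ
  refine MemLp.of_le_mul (c := C) (Lp.memLp (timeFourier v)) ?_ ?_
  · exact ((hm.measurable.comp (measurable_const.mul measurable_id)).aestronglyMeasurable).mul
      (Lp.aestronglyMeasurable _)
  · filter_upwards [hv] with ξ hξ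
    rw [norm_mul]
    by_cases h : |2 * Real.pi * ξ| ≤ κ
    · exact mul_le_mul_of_nonneg_right (hC _ h) (norm_nonneg _)
    · rw [hξ (not_le.mp h)]; simp

lemma isHermitian_mult (hm : IsSymbol m) :
    IsHermitian (fun ξ => m (2 * Real.pi * ξ) * timeFourier v ξ) := by
  filter_upwards [isHermitian_timeFourier v] with ξ hξ
  rw [hξ, map_mul, ← hm.neg]
  congr 2
  ring

lemma timeFourier_timeMult (hm : IsSymbol m) (hv : v ∈ bandLimited κ) :
    timeFourier (timeMult m v) =ᵐ[volume] fun ξ => m (2 * Real.pi * ξ) * timeFourier v ξ :=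
  timeFourier_fromSpectrum (memLp_mult hm hv) (isHermitian_mult hm)

lemma timeMult_mem (hm : IsSymbol m) (hv : v ∈ bandLimited κ) : timeMult m v ∈ bandLimited κ := by
  change ∀ᵐ ξ : ℝ, _
  filter_upwards [hv, timeFourier_timeMult hm hv] with ξ h1 h2 h
  rw [h2, h1 h, mul_zero]

lemma timeMult_add (hm : IsSymbol m) (hv : v ∈ bandLimited κ) (hw : w ∈ bandLimited κ) :
    timeMult m (v + w) = timeMult m v + timeMult m w := by
  apply timeFourier_ext
  have h4 := Lp.coeFn_add (timeFourier v) (timeFourier w)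
  have h5 := Lp.coeFn_add (timeFourier (timeMult m v)) (timeFourier (timeMult m w))
  rw [← timeFourier_add] at h4 h5
  filter_upwards [timeFourier_timeMult hm hv, timeFourier_timeMult hm hw,
    timeFourier_timeMult hm (add_mem hv hw), h4, h5] with ξ h1 h2 h3 h4 h5
  rw [h3, h4, h5, Pi.add_apply, Pi.add_apply, h1, h2, mul_add]

lemma timeMult_smul (hm : IsSymbol m) (hv : v ∈ bandLimited κ) (c : ℝ) :
    timeMult m (c • v) = c • timeMult m v := by
  apply timeFourier_ext
  have h4 := Lp.coeFn_smul c (timeFourier v)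
  have h5 := Lp.coeFn_smul c (timeFourier (timeMult m v))
  rw [← timeFourier_smul] at h4 h5
  filter_upwards [timeFourier_timeMult hm hv, 
    timeFourier_timeMult hm (Submodule.smul_mem _ c hv), h4, h5] with ξ h1 h3 h4 h5
  rw [h3, h4, h5, Pi.smul_apply, Pi.smul_apply, h1, mul_smul_comm]

end Multiplier

/-! ### Symbols of the fractional derivatives and of the Hilbert transform -/

lemma isSymbol_cpow {a : ℝ} (ha : 0 ≤ a) : IsSymbol fun om => (Complex.I * om) ^ (a : ℂ) where
  measurable := by fun_prop
  neg om := by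
    -- Principal powers commute with conjugation off the negative real axis, which the imaginary
    -- number `I * om` never meets.
    have harg : (Complex.I * om).arg ≠ Real.pi := by
      intro h
      rw [Complex.arg_eq_pi_iff] at h
      simp at h
    have h := Complex.conj_cpow (Complex.I * om) (a : ℂ) harg
    rw [Complex.conj_ofReal] at h
    rw [← h]
    simp
  bounded κ := ⟨κ ^ a, fun om h => by
    have h1 := Complex.norm_cpow_real (Complex.I * om) a
    rw [h1]
    exact Real.rpow_le_rpow (norm_nonneg _) (by simpa using h) ha⟩

lemma IsSymbol.conj {m : ℝ → ℂ} (hm : IsSymbol m) : IsSymbol fun om => conj (m om) where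
  measurable := Complex.continuous_conj.measurable.comp hm.measurable
  neg om := by rw [hm.neg]
  bounded κ := by
    obtain ⟨C, hC⟩ := hm.bounded κ
    exact ⟨C, fun om h => by simpa using hC om h⟩

lemma isSymbol_halfPlus : IsSymbol fun om => (Complex.I * om) ^ (1 / 2 : ℂ) := by
  simpa using isSymbol_cpow (a := 1 / 2) (by norm_num)

lemma isSymbol_quarterDeriv : IsSymbol fun om => (Complex.I * om) ^ (1 / 4 : ℂ) := by
  simpa using isSymbol_cpow (a := 1 / 4) (by norm_num)

lemma isSymbol_hilbert :
    IsSymbol fun om => -Complex.I * (SignType.sign om : ℝ) where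
  measurable := by
    refine measurable_const.mul (Complex.measurable_ofReal.comp ?_)
    have h : (fun om : ℝ => ((SignType.sign om : SignType) : ℝ)) =
        fun om => if 0 < om then 1 else if om < 0 then -1 else 0 := by
      ext om
      rcases lt_trichotomy om 0 with h | h | h
      · simp [h, not_lt.mpr h.le]
      · simp [h]
      · simp [h]
    rw [h]
    exact Measurable.ite measurableSet_Ioi measurable_const
      (Measurable.ite measurableSet_Iio measurable_const measurable_const)
  neg om := by
    rw [Left.sign_neg]
    simp
  bounded κ := ⟨1, fun om _ => by
    rcases lt_trichotomy om 0 with h | h | h <;> simp [h]⟩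

/-- The square of the symbol is -1 except at frequency zero, a null set. -/
lemma hilbert_hilbert {κ : ℝ} {v : TimeL2} (hv : v ∈ bandLimited κ) :
    hilbert (hilbert v) = -v := by
  apply timeFourier_ext
  have h0 : timeFourier (-v) = -timeFourier v := map_neg timeFourierL v
  rw [h0]
  have hne : ∀ᵐ ξ : ℝ, ξ ≠ 0 := by simp [ae_iff]
  filter_upwards [timeFourier_timeMult isSymbol_hilbert hv,
    timeFourier_timeMult isSymbol_hilbert (timeMult_mem isSymbol_hilbert hv),
    Lp.coeFn_neg (timeFourier v), hne] with ξ h1 h2 h3 h4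
  rw [h3, Pi.neg_apply]
  change timeFourier (timeMult _ (timeMult _ v)) ξ = _
  rw [h2, h1]
  have hpi : 2 * Real.pi * ξ ≠ 0 := by positivity
  have hs : ((SignType.sign (2 * Real.pi * ξ) : ℝ) : ℂ) * (SignType.sign (2 * Real.pi * ξ) : ℝ)
      = 1 := by
    rcases lt_or_gt_of_ne hpi with h | h <;> simp [h]
  linear_combination (Complex.I * Complex.I * timeFourier v ξ) * hs +
    timeFourier v ξ * Complex.I_mul_I

/-- The integrand in frequency is the real part of conj(√(iω))² |v̂|² = -iω |v̂|², which is
imaginary. So the time derivative contributes nothing to monotonicity. -/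
lemma inner_halfPlus_halfMinus_self {κ : ℝ} {v : TimeL2} (hv : v ∈ bandLimited κ) :
    inner ℝ (halfPlus v) (halfMinus v) = 0 := by
  rw [inner_eq_integral_timeFourier]
  apply integral_eq_zero_of_ae
  filter_upwards [timeFourier_timeMult isSymbol_halfPlus hv,
    timeFourier_timeMult isSymbol_halfPlus.conj hv] with ξ h1 h2
  change (conj (timeFourier (timeMult _ v) ξ) * timeFourier (timeMult _ v) ξ).re = 0
  rw [h1, h2]
  have hsq : ((Complex.I * ((2 * Real.pi * ξ : ℝ) : ℂ)) ^ (1 / 2 : ℂ)) ^ 2 =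
      Complex.I * ((2 * Real.pi * ξ : ℝ) : ℂ) := by
    simp
  have : conj ((Complex.I * ((2 * Real.pi * ξ : ℝ) : ℂ)) ^ (1 / 2 : ℂ) * timeFourier v ξ) *
      (conj ((Complex.I * ((2 * Real.pi * ξ : ℝ) : ℂ)) ^ (1 / 2 : ℂ)) * timeFourier v ξ) =
      conj (Complex.I * ((2 * Real.pi * ξ : ℝ) : ℂ)) *
        (Complex.normSq (timeFourier v ξ) : ℂ) := by
    conv_rhs => rw [← hsq]
    rw [Complex.normSq_eq_conj_mul_self, map_mul, map_pow]
    ring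
  rw [this]
  simp

/-! ### Sobolev norms of band-limited functions -/

lemma sobolevSq_nonneg (s : ℝ) (v : TimeL2) : 0 ≤ sobolevSq s v :=
  integral_nonneg fun ξ => by positivity

lemma sobolevSq_le {κ s : ℝ} (hs : 0 ≤ s) {v : TimeL2} (hv : v ∈ bandLimited κ) :
    sobolevSq s v ≤ (1 + κ ^ 2) ^ s * ‖v‖ ^ 2 := by
  have hint : Integrable (fun ξ => ‖timeFourier v ξ‖ ^ 2) :=
    (Lp.memLp (timeFourier v)).integrable_norm_pow (by norm_num)
  have hn : ∫ ξ, ‖timeFourier v ξ‖ ^ 2 = ‖v‖ ^ 2 := by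
    rw [← norm_timeFourier, norm_sq_eq_re_inner (𝕜 := ℂ), L2.inner_def,
      ← integral_re (L2.integrable_inner _ _)]
    apply integral_congr_ae
    filter_upwards with ξ
    simp [← Complex.ofReal_pow]
  rw [← hn, ← integral_const_mul]
  refine integral_mono_of_nonneg (.of_forall fun ξ => by positivity) (hint.const_mul _) ?_
  filter_upwards [hv] with ξ hξ
  by_cases h : κ < |2 * Real.pi * ξ|
  · rw [hξ h]; simp
  · have h1 : (2 * Real.pi * ξ) ^ 2 ≤ κ ^ 2 := sq_le_sq' (abs_le.mp (not_lt.mp h)).1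
      (abs_le.mp (not_lt.mp h)).2
    gcongr

/-! ### The temporal space -/

lemma measurable_spectralHat (τ κ : ℝ) (j : ℕ) : Measurable (spectralHat τ κ j) := by
  unfold spectralHat
  refine Measurable.ite (measurableSet_le continuous_abs.measurable measurable_const) ?_
    measurable_const
  fun_prop

/-- The hats are bounded with bounded support, hence in L², and real and even, hence Hermitian. -/
lemma timeFourier_spectralBasis (τ κ : ℝ) (j : ℕ) :
    timeFourier (spectralBasis τ κ j) =ᵐ[volume]
      fun ξ => (spectralHat τ κ j (2 * Real.pi * ξ) : ℂ) := by
  apply timeFourier_fromSpectrum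
  · have hmeas : Measurable fun ξ : ℝ => (spectralHat τ κ j (2 * Real.pi * ξ) : ℂ) :=
      Complex.measurable_ofReal.comp ((measurable_spectralHat τ κ j).comp (by fun_prop))
    have hind : (fun ξ : ℝ => (spectralHat τ κ j (2 * Real.pi * ξ) : ℂ)) =
        (Icc (-κ / (2 * Real.pi)) (κ / (2 * Real.pi))).indicator
          fun ξ : ℝ => (spectralHat τ κ j (2 * Real.pi * ξ) : ℂ) := by
      ext ξ
      rw [Set.indicator_apply]
      split_ifs with h
      · rfl
      · rw [mem_Icc, div_le_iff₀ (by positivity), le_div_iff₀ (by positivity)] at h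
        rw [spectralHat, if_neg, Complex.ofReal_zero]
        rw [abs_le]
        contrapose! h
        constructor <;> nlinarith [h.1, h.2]
    rw [hind, memLp_indicator_iff_restrict measurableSet_Icc]
    refine MemLp.of_bound hmeas.aestronglyMeasurable 1 (.of_forall fun ξ => ?_)
    rw [Complex.norm_real, spectralHat]
    split_ifs
    · rw [Real.norm_of_nonneg (le_max_left _ _)]
      exact max_le zero_le_one (by linarith [abs_nonneg (|2 * Real.pi * ξ| / τ - j)])
    · simp
  · filter_upwards with ξ
    rw [Complex.conj_ofReal, mul_neg]
    simp [spectralHat]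

lemma spectralBasis_mem_bandLimited (τ κ : ℝ) (j : ℕ) : spectralBasis τ κ j ∈ bandLimited κ := by
  change ∀ᵐ ξ : ℝ, _
  filter_upwards [timeFourier_spectralBasis τ κ j] with ξ h h'
  rw [h, spectralHat, if_neg (not_le.mpr h'), Complex.ofReal_zero]

lemma spectralSpace_le_bandLimited (N : ℕ) (τ κ : ℝ) : spectralSpace N τ κ ≤ bandLimited κ := by
  refine Submodule.span_le.mpr ?_
  rintro v ⟨j, -, rfl | rfl⟩
  · exact spectralBasis_mem_bandLimited τ κ j
  · exact timeMult_mem isSymbol_hilbert (spectralBasis_mem_bandLimited τ κ j)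

/-- On generators this is 𝓗² = -1: the transform swaps the two kinds of basis functions up to sign.
-/
lemma hilbert_mem_spectralSpace {N : ℕ} {τ κ : ℝ} {v : TimeL2} (hv : v ∈ spectralSpace N τ κ) :
    hilbert v ∈ spectralSpace N τ κ := by
  have hle := spectralSpace_le_bandLimited N τ κ
  induction hv using Submodule.span_induction with
  | mem v h =>
    obtain ⟨j, hj, rfl | rfl⟩ := h
    · exact Submodule.subset_span ⟨j, hj, Or.inr rfl⟩
    · rw [hilbert_hilbert (spectralBasis_mem_bandLimited τ κ j)]
      exact neg_mem (Submodule.subset_span ⟨j, hj, Or.inl rfl⟩)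
  | zero =>
    -- `hilbert` is not a linear map by definition; its value at 0 comes from homogeneity with the
    -- factor 0.
    have h : hilbert ((0 : ℝ) • (0 : TimeL2)) = (0 : ℝ) • hilbert 0 :=
      timeMult_smul (κ := κ) isSymbol_hilbert (zero_mem _) 0
    rw [zero_smul, zero_smul] at h
    rw [h]
    exact zero_mem _
  | add v w hv hw h1 h2 =>
    have h : hilbert (v + w) = hilbert v + hilbert w :=
      timeMult_add isSymbol_hilbert (hle hv) (hle hw)
    rw [h]
    exact add_mem h1 h2
  | smul c v hv h1 =>
    have h : hilbert (c • v) = c • hilbert v := timeMult_smul isSymbol_hilbert (hle hv) c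
    rw [h]
    exact Submodule.smul_mem _ c h1

instance finiteDimensional_spectralSpace (N : ℕ) (τ κ : ℝ) :
    FiniteDimensional ℝ (spectralSpace N τ κ) := by
  apply FiniteDimensional.span_of_finite
  refine Set.Finite.subset (((Set.finite_Iic N).image (spectralBasis τ κ)).union
    ((Set.finite_Iic N).image fun j => hilbert (spectralBasis τ κ j))) ?_
  rintro v ⟨j, hj, rfl | rfl⟩
  · exact Or.inl ⟨j, hj, rfl⟩
  · exact Or.inr ⟨j, hj, rfl⟩

/-- A Fourier multiplier on a space of band-limited functions, as a linear map. -/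
def multL {m : ℝ → ℂ} (hm : IsSymbol m) {κ : ℝ} {U : Submodule ℝ TimeL2}
    (hU : U ≤ bandLimited κ) : U →ₗ[ℝ] TimeL2 where
  toFun v := timeMult m v
  map_add' v w := timeMult_add hm (hU v.2) (hU w.2)
  map_smul' c v := timeMult_smul hm (hU v.2) c

/-! ### Strongly monotone problems on finite-dimensional spaces -/

section Abstract

variable {E : Type*} [AddCommGroup E] [Module ℝ E]

/-- Symmetric positive definite bilinear forms. -/
structure IsInner (B : LinearMap.BilinForm ℝ E) : Prop where
  symm : ∀ x y, B x y = B y x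
  pos : ∀ x, x ≠ 0 → 0 < B x x

namespace IsInner

variable {B : LinearMap.BilinForm ℝ E} (hB : IsInner B)
include hB

lemma nonneg (x : E) : 0 ≤ B x x := by
  by_cases h : x = 0
  · simp [h]
  · exact (hB.pos x h).le

/-- The inner product space structure given by a positive definite form. -/
@[reducible] def core : InnerProductSpace.Core ℝ E where
  inner x y := B x y
  conj_inner_symm x y := by simpa using hB.symm y x
  re_inner_nonneg x := by simpa using hB.nonneg x
  add_left x y z := by simp
  smul_left x y r := by simp
  definite x h := by
    by_contra hx
    exact (hB.pos x hx).ne' h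

/-- Uniform boundedness in finite dimensions: bounds on the vectors of an orthonormal basis suffice.
The families used later are evaluations, derivatives and difference quotients at all points of a
set. -/
lemma exists_uniform_bound [FiniteDimensional ℝ E] {ι F : Type*} [NormedAddCommGroup F]
    [NormedSpace ℝ F] (T : ι → E →ₗ[ℝ] F) (hT : ∀ e, ∃ M, ∀ i, ‖T i e‖ ≤ M) :
    ∃ C > 0, ∀ i e, ‖T i e‖ ≤ C * √(B e e) := by
  let _ : NormedAddCommGroup E := hB.core.toNormedAddCommGroup
  let _ : InnerProductSpace ℝ E := InnerProductSpace.ofCore hB.core.toCore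
  have hn : ∀ e : E, ‖e‖ = √(B e e) := fun e => by
    rw [norm_eq_sqrt_re_inner (𝕜 := ℝ)]; rfl
  let b := stdOrthonormalBasis ℝ E
  choose M hM using fun k => hT (b k)
  -- The summand 1 makes the constant positive even if all `M k` vanish.
  refine ⟨∑ k, |M k| + 1, by positivity, fun i e => ?_⟩
  rw [← hn]
  conv_lhs => rw [← b.sum_repr e, map_sum]
  refine (norm_sum_le _ _).trans ?_
  rw [add_mul, Finset.sum_mul]
  refine le_trans (Finset.sum_le_sum fun k _ => ?_) (le_add_of_nonneg_right (by positivity))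
  rw [map_smul, norm_smul, mul_comm]
  refine mul_le_mul ((hM k i).trans (le_abs_self _)) ?_ (norm_nonneg _) (abs_nonneg _)
  calc ‖b.repr e k‖ ≤ ‖b.repr e‖ := PiLp.norm_apply_le _ _
    _ = ‖e‖ := b.repr.norm_map e

/-- With the identity for `T` this is the equivalence of norms in finite dimensions. -/
lemma exists_bound_map [FiniteDimensional ℝ E] {F : Type*} [AddCommGroup F] [Module ℝ F]
    {B' : LinearMap.BilinForm ℝ F} (hB' : IsInner B') (T : E →ₗ[ℝ] F) :
    ∃ C > 0, ∀ e, √(B' (T e) (T e)) ≤ C * √(B e e) := by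
  let _ : NormedAddCommGroup F := hB'.core.toNormedAddCommGroup
  let _ : InnerProductSpace ℝ F := InnerProductSpace.ofCore hB'.core.toCore
  have hn : ∀ e : F, ‖e‖ = √(B' e e) := fun e => by
    rw [norm_eq_sqrt_re_inner (𝕜 := ℝ)]; rfl
  obtain ⟨C, hC, h⟩ := hB.exists_uniform_bound (fun _ : Unit => T) (fun e => ⟨_, fun _ => le_rfl⟩)
  exact ⟨C, hC, fun e => (hn _).symm.le.trans (h () e)⟩

lemma cauchy_schwarz (x y : E) : |B x y| ≤ √(B x x) * √(B y y) := by
  let _ : NormedAddCommGroup E := hB.core.toNormedAddCommGroup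
  let _ : InnerProductSpace ℝ E := InnerProductSpace.ofCore hB.core.toCore
  have hn : ∀ e : E, ‖e‖ = √(B e e) := fun e => by
    rw [norm_eq_sqrt_re_inner (𝕜 := ℝ)]; rfl
  rw [← hn, ← hn]
  exact abs_real_inner_le_norm x y

lemma existsUnique_riesz [FiniteDimensional ℝ E] (f : E →ₗ[ℝ] ℝ) : ∃! x, ∀ y, B x y = f y := by
  let _ : NormedAddCommGroup E := hB.core.toNormedAddCommGroup
  let _ : InnerProductSpace ℝ E := InnerProductSpace.ofCore hB.core.toCore
  have : CompleteSpace E := FiniteDimensional.complete ℝ E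
  refine ⟨(InnerProductSpace.toDual ℝ E).symm (LinearMap.toContinuousLinearMap f),
    fun y => ?_, fun x hx => ?_⟩
  · exact InnerProductSpace.toDual_symm_apply (𝕜 := ℝ) (E := E)
  · refine ext_inner_right ℝ fun y => ?_
    rw [InnerProductSpace.toDual_symm_apply]
    exact hx y

end IsInner

/-- Strong monotonicity and Lipschitz continuity of a nonlinear form with respect to `B`. -/
def IsStronglyMonotone (B : LinearMap.BilinForm ℝ E) (A : E → E →ₗ[ℝ] ℝ) : Prop :=
  ∃ c > 0, ∃ M > 0, (∀ x y, c * B (x - y) (x - y) ≤ A x (x - y) - A y (x - y)) ∧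
    ∀ x y v, |A x v - A y v| ≤ M * (√(B (x - y) (x - y)) * √(B v v))

/-- One step of the preconditioned iteration contracts the norm of the preconditioner. -/
lemma contraction_step {B : LinearMap.BilinForm ℝ E} (hB : IsInner B) {A : E → E →ₗ[ℝ] ℝ}
    {c M s : ℝ} (hs : 0 < s)
    (h1 : ∀ x y, c * B (x - y) (x - y) ≤ A x (x - y) - A y (x - y))
    (h2 : ∀ x y v, |A x v - A y v| ≤ M * (√(B (x - y) (x - y)) * √(B v v)))
    {x y x' y' : E} (hx : ∀ v, B (x' - x) v = -s * A x v) (hy : ∀ v, B (y' - y) v = -s * A y v) :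
    B (x' - y') (x' - y') ≤ (1 - 2 * s * c + s ^ 2 * M ^ 2) * B (x - y) (x - y) := by
  -- `p` is the difference of the two increments, so x' - y' = (x - y) + p and the square expands
  -- into three terms. Monotonicity bounds the mixed term 2 B(p, x - y) by -2sc B(x - y, x - y), and
  -- testing with `p` itself bounds B(p, p) by the Lipschitz term.
  set p := (x' - x) - (y' - y) with hp
  have hpv : ∀ v, B p v = -s * (A x v - A y v) := fun v => by
    rw [hp, map_sub, LinearMap.sub_apply, hx, hy]; ring
  have hd : x' - y' = (x - y) + p := by rw [hp]; abel
  have hpp : B p p ≤ s ^ 2 * M ^ 2 * B (x - y) (x - y) := by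
    have h3 : B p p ≤ s * (M * (√(B (x - y) (x - y)) * √(B p p))) := by
      have h4 := neg_le_of_abs_le (h2 x y p)
      have h5 := hpv p
      nlinarith
    set q := √(B p p) with hq
    have hq2 : q ^ 2 = B p p := Real.sq_sqrt (hB.nonneg _)
    set r := √(B (x - y) (x - y)) with hr
    have hr2 : r ^ 2 = B (x - y) (x - y) := Real.sq_sqrt (hB.nonneg _)
    rw [← hq2] at h3 ⊢
    rw [← hr2]
    have hq0 : 0 ≤ q := Real.sqrt_nonneg _
    rcases hq0.eq_or_lt with h0 | h0
    · rw [← h0, zero_pow two_ne_zero]; positivity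
    · have h4 : q ≤ s * M * r := by
        by_contra h5
        push Not at h5
        nlinarith
      calc q ^ 2 ≤ (s * M * r) ^ 2 := pow_le_pow_left₀ hq0 h4 2
        _ = _ := by ring
  rw [hd]
  simp only [map_add, LinearMap.add_apply]
  have h5 := hpv (x - y)
  have h6 := hB.symm (x - y) p
  have h7 := h1 x y
  rw [h6, h5]
  nlinarith [mul_le_mul_of_nonneg_left h7 hs.le]

/-- For s < c / M² the factor is below 1 - sc. -/
lemma exists_rate {c M s : ℝ} (hc : 0 < c) (hM : 0 < M) (hs : 0 < s) (hs' : s < c / M ^ 2) :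
    ∃ L ∈ Ioo (0 : ℝ) 1, 1 - 2 * s * c + s ^ 2 * M ^ 2 ≤ L ^ 2 := by
  have h1 : 1 - 2 * s * c + s ^ 2 * M ^ 2 < 1 := by
    rw [lt_div_iff₀ (by positivity)] at hs'
    nlinarith [mul_pos hs hc]
  -- The factor itself may be nonpositive, as c ≤ M is not assumed; the maximum keeps the square
  -- root positive.
  set θ := max (1 / 2) (1 - 2 * s * c + s ^ 2 * M ^ 2) with hθ
  have hθ1 : θ < 1 := max_lt (by norm_num) h1
  have hθ0 : 0 < θ := lt_of_lt_of_le (by norm_num) (le_max_left _ _)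
  refine ⟨√θ, ⟨Real.sqrt_pos.mpr hθ0, ?_⟩, ?_⟩
  · rw [Real.sqrt_lt' one_pos]; simpa using hθ1
  · rw [Real.sq_sqrt hθ0.le]; exact le_max_right _ _

/-- Zarantonello's theorem on a finite-dimensional space. -/
theorem IsStronglyMonotone.existsUnique [FiniteDimensional ℝ E] {B : LinearMap.BilinForm ℝ E}
    (hB : IsInner B) {A : E → E →ₗ[ℝ] ℝ} (hA : IsStronglyMonotone B A) :
    ∃! x, ∀ v, A x v = 0 := by
  obtain ⟨c, hc, M, hM, h1, h2⟩ := hA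
  set s := c / M ^ 2 / 2 with hs
  have hs0 : 0 < s := by positivity
  obtain ⟨L, ⟨hL0, hL1⟩, hL⟩ := exists_rate hc hM hs0 (half_lt_self (by positivity))
  -- Richardson step x ↦ x - s B⁻¹(A x): its fixed points are the zeros of `A`.
  choose Φ hΦ _ using fun x => hB.existsUnique_riesz (B x - s • A x)
  let _ : NormedAddCommGroup E := hB.core.toNormedAddCommGroup
  let _ : InnerProductSpace ℝ E := InnerProductSpace.ofCore hB.core.toCore
  have : CompleteSpace E := FiniteDimensional.complete ℝ E
  have hn : ∀ e : E, ‖e‖ = √(B e e) := fun e => by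
    rw [norm_eq_sqrt_re_inner (𝕜 := ℝ)]; rfl
  have hΦ' : ∀ x v, B (Φ x - x) v = -s * A x v := fun x v => by
    have := hΦ x v
    rw [map_sub, LinearMap.sub_apply, this]
    simp
  have hcontr : ContractingWith ⟨L, hL0.le⟩ Φ := by
    refine ⟨by exact_mod_cast hL1, LipschitzWith.of_dist_le_mul fun x y => ?_⟩
    rw [dist_eq_norm, dist_eq_norm, hn, hn]
    have h := contraction_step hB hs0 h1 h2 (hΦ' x) (hΦ' y)
    calc √(B (Φ x - Φ y) (Φ x - Φ y)) ≤ √(L ^ 2 * B (x - y) (x - y)) :=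
          Real.sqrt_le_sqrt (h.trans (mul_le_mul_of_nonneg_right hL (hB.nonneg _)))
      _ = L * √(B (x - y) (x - y)) := by
          rw [Real.sqrt_mul (by positivity), Real.sqrt_sq hL0.le]
  obtain ⟨x, hx, -⟩ := hcontr.exists_fixedPoint 0 (edist_ne_top _ _)
  refine ⟨x, fun v => ?_, fun y hy => ?_⟩
  · have h := hΦ' x v
    rw [hx.eq, sub_self, map_zero, LinearMap.zero_apply] at h
    have h' : s * A x v = 0 := by linarith
    exact (mul_eq_zero.mp h').resolve_left hs0.ne'
  · by_contra hne
    have hxv : ∀ v, A x v = 0 := fun v => by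
      have h := hΦ' x v
      rw [hx.eq, sub_self, map_zero, LinearMap.zero_apply] at h
      have h' : s * A x v = 0 := by linarith
      exact (mul_eq_zero.mp h').resolve_left hs0.ne'
    have h3 := h1 y x
    rw [hy, hxv] at h3
    nlinarith [hB.pos _ (sub_ne_zero.mpr hne)]

/-- Linear convergence of the preconditioned iteration with a slightly rotated test function. -/
theorem IsStronglyMonotone.exists_rotated_rate [FiniteDimensional ℝ E]
    {B : LinearMap.BilinForm ℝ E} (hB : IsInner B) {A : E → E →ₗ[ℝ] ℝ}
    (hA : IsStronglyMonotone B A) (J : E →ₗ[ℝ] E) :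
    ∃ φ₀ > 0, ∃ s₀ > 0, ∀ φ ∈ Ioo (0 : ℝ) φ₀, ∀ s ∈ Ioo (0 : ℝ) s₀, ∃ L ∈ Ioo (0 : ℝ) 1,
      ∀ x y x' y' : E,
        (∀ v, B (x' - x) v = -s * A x (Real.cos φ • v - Real.sin φ • J v)) →
        (∀ v, B (y' - y) v = -s * A y (Real.cos φ • v - Real.sin φ • J v)) →
        √(B (x' - y') (x' - y')) ≤ L * √(B (x - y) (x - y)) := by
  obtain ⟨c, hc, M, hM, h1, h2⟩ := hA
  obtain ⟨K, hK, hJ⟩ := hB.exists_bound_map hB J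
  -- The perturbed monotonicity constant equals `c` at φ = 0, so it exceeds c / 2 for small angles.
  have hcont : ContinuousAt (fun φ => Real.cos φ * c - |Real.sin φ| * (M * K)) 0 := by fun_prop
  have hev : ∀ᶠ φ in 𝓝 (0 : ℝ), c / 2 < Real.cos φ * c - |Real.sin φ| * (M * K) :=
    hcont.eventually_const_lt (by simp; linarith)
  obtain ⟨φ₀, hφ₀, hφ⟩ := Metric.eventually_nhds_iff.mp hev
  set M' := M * (1 + K)
  have hM' : 0 < M' := by positivity
  -- π/2 keeps the cosine nonnegative, so that the monotonicity bound may be multiplied by it. The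
  -- bound for `s` belongs to the constants c / 2 and M', which are valid for all these angles at
  -- once.
  refine ⟨min φ₀ (Real.pi / 2), lt_min hφ₀ (by positivity), c / 2 / M' ^ 2, by positivity,
    fun φ hφ' s hs => ?_⟩
  have hcos : 0 ≤ Real.cos φ := Real.cos_nonneg_of_neg_pi_div_two_le_of_le
    (by linarith [hφ'.1, Real.pi_pos]) (hφ'.2.le.trans (min_le_right _ _))
  have hφc := hφ (y := φ) (by
    rw [Real.dist_eq, sub_zero, abs_of_pos hφ'.1]
    exact hφ'.2.trans_le (min_le_left _ _))
  obtain ⟨L, hL, hL2⟩ := exists_rate (half_pos hc) hM' hs.1 hs.2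
  refine ⟨L, hL, fun x y x' y' hx hy => ?_⟩
  -- The rotation is moved from the test function to the operator, so that `contraction_step`
  -- applies to the composition of `A x` with `Rφ`.
  let Rφ : E →ₗ[ℝ] E := Real.cos φ • LinearMap.id - Real.sin φ • J
  have hRapp : ∀ v, Rφ v = Real.cos φ • v - Real.sin φ • J v := fun v => rfl
  have hm : ∀ x y, c / 2 * B (x - y) (x - y) ≤
      ((A x).comp Rφ) (x - y) - ((A y).comp Rφ) (x - y) := fun x y => by
    simp only [LinearMap.comp_apply, hRapp, map_sub, map_smul, smul_eq_mul]
    have h3 := h1 x y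
    have h4 := h2 x y (J (x - y))
    simp only [map_sub] at h3 h4
    have h5 : |Real.sin φ * (A x (J x) - A x (J y) - (A y (J x) - A y (J y)))| ≤
        |Real.sin φ| * (M * K) * B (x - y) (x - y) := by
      rw [abs_mul, mul_assoc]
      refine mul_le_mul_of_nonneg_left (h4.trans ?_) (abs_nonneg _)
      have h6 := hJ (x - y)
      simp only [map_sub] at h6
      have h7 := Real.mul_self_sqrt (hB.nonneg (x - y))
      simp only [map_sub] at h7 ⊢
      rw [mul_assoc]
      refine mul_le_mul_of_nonneg_left ?_ hM.le
      calc _ ≤ _ := mul_le_mul_of_nonneg_left h6 (Real.sqrt_nonneg _)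
        _ = _ := by rw [mul_left_comm, h7]
    have h8 := le_of_abs_le h5
    have h9 := mul_le_mul_of_nonneg_left h3 hcos
    have h10 := hB.nonneg (x - y)
    simp only [map_sub] at h8 h9 h10 ⊢
    nlinarith
  have hl : ∀ x y v, |((A x).comp Rφ) v - ((A y).comp Rφ) v| ≤
      M' * (√(B (x - y) (x - y)) * √(B v v)) := fun x y v => by
    simp only [LinearMap.comp_apply]
    simp only [hRapp, map_sub (A x), map_sub (A y), map_smul, smul_eq_mul]
    have h3 := h2 x y v
    have h4 := h2 x y (J v)
    have h5 : |A x (J v) - A y (J v)| ≤ M * K * (√(B (x - y) (x - y)) * √(B v v)) := by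
      refine h4.trans ?_
      rw [mul_assoc, mul_left_comm K]
      exact mul_le_mul_of_nonneg_left (mul_le_mul_of_nonneg_left (hJ v) (Real.sqrt_nonneg _)) hM.le
    have e : Real.cos φ * A x v - Real.sin φ * A x (J v) -
        (Real.cos φ * A y v - Real.sin φ * A y (J v)) =
        Real.cos φ * (A x v - A y v) - Real.sin φ * (A x (J v) - A y (J v)) := by ring
    rw [e]
    calc _ ≤ |Real.cos φ * (A x v - A y v)| + |Real.sin φ * (A x (J v) - A y (J v))| := abs_sub _ _
      _ ≤ 1 * |A x v - A y v| + 1 * |A x (J v) - A y (J v)| := by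
        rw [abs_mul, abs_mul]
        gcongr
        exacts [Real.abs_cos_le_one φ, Real.abs_sin_le_one φ]
      _ ≤ _ := by
        rw [one_mul, one_mul]
        refine (add_le_add h3 h5).trans (le_of_eq ?_)
        simp only [M']
        ring
  have h := contraction_step hB hs.1 hm hl (x := x) (y := y) (x' := x') (y' := y') hx hy
  calc √(B (x' - y') (x' - y')) ≤ √(L ^ 2 * B (x - y) (x - y)) :=
        Real.sqrt_le_sqrt (h.trans (mul_le_mul_of_nonneg_right hL2 (hB.nonneg _)))
    _ = L * √(B (x - y) (x - y)) := by
        rw [Real.sqrt_mul (by positivity), Real.sqrt_sq hL.1.le]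

end Abstract

/-! ### The Steklov–Poincaré operator of an abstract decomposition -/

section Steklov

variable {Z W : Type*} [AddCommGroup Z] [Module ℝ Z] [AddCommGroup W] [Module ℝ W]

/-- Put u = r + k with k in the kernel of `T`. The shifted operator is strongly monotone on the
kernel with the same constants, and Zarantonello's theorem gives k. -/
lemma existsUnique_dirichlet [FiniteDimensional ℝ W] {g : LinearMap.BilinForm ℝ W} (hg : IsInner g)
    {a : W → W →ₗ[ℝ] ℝ} (ha : IsStronglyMonotone g a) (T : W →ₗ[ℝ] Z) {r : W} :
    ∃! u, T u = T r ∧ ∀ v, T v = 0 → a u v = 0 := by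
  let K := LinearMap.ker T
  let gK : LinearMap.BilinForm ℝ K := (g.domRestrict₁₂ K K)
  have hgK : IsInner gK := ⟨fun x y => hg.symm x y, fun x hx => hg.pos x (by simpa using hx)⟩
  have haK : IsStronglyMonotone gK (fun k : K => (a (r + k)).comp K.subtype) := by
    obtain ⟨c, hc, M, hM, h1, h2⟩ := ha
    refine ⟨c, hc, M, hM, fun x y => ?_, fun x y v => ?_⟩
    · have h := h1 (r + x) (r + y)
      rw [add_sub_add_left_eq_sub] at h
      exact h
    · have h := h2 (r + x) (r + y) v
      rw [add_sub_add_left_eq_sub] at h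
      exact h
  obtain ⟨k, hk, hku⟩ := haK.existsUnique hgK
  refine ⟨r + k, ⟨?_, fun v hv => hk ⟨v, hv⟩⟩, ?_⟩
  · rw [map_add, LinearMap.mem_ker.mp k.2, add_zero]
  · rintro u ⟨hu, hu'⟩
    have hmem : u - r ∈ K := by rw [LinearMap.mem_ker, map_sub, hu, sub_self]
    have h := hku ⟨u - r, hmem⟩ (fun v => by
      have := hu' v v.2
      simpa using this)
    rw [← h]
    simp

/-- Solution operators of Dirichlet problems are Lipschitz continuous. -/
lemma exists_lipschitz_dirichlet [FiniteDimensional ℝ Z] {g : LinearMap.BilinForm ℝ W} (hg : IsInner g)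
    {P : LinearMap.BilinForm ℝ Z} (hP : IsInner P)
    {a : W → W →ₗ[ℝ] ℝ} (ha : IsStronglyMonotone g a) (T : W →ₗ[ℝ] Z) (R : Z →ₗ[ℝ] W)
    (hR : ∀ z, T (R z) = z) {F : Z → W}
    (hF : ∀ z, T (F z) = z ∧ ∀ v, T v = 0 → a (F z) v = 0) :
    ∃ C > 0, ∀ z z', √(g (F z - F z') (F z - F z')) ≤ C * √(P (z - z') (z - z')) := by
  obtain ⟨c, hc, M, hM, h1, h2⟩ := ha
  obtain ⟨K, hK, hRb⟩ := hP.exists_bound_map hg R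
  refine ⟨M / c * K, by positivity, fun z z' => ?_⟩
  set w := F z - F z' with hw
  -- `w` and the extension of z - z' differ by an admissible test function, so in both equations one
  -- may be replaced by the other.
  have hker : T (w - R (z - z')) = 0 := by
    rw [map_sub, hw, map_sub, (hF z).1, (hF z').1, hR, sub_self]
  have e1 : a (F z) w = a (F z) (R (z - z')) := by
    have := (hF z).2 _ hker
    rw [map_sub] at this; linarith
  have e2 : a (F z') w = a (F z') (R (z - z')) := by
    have := (hF z').2 _ hker
    rw [map_sub] at this; linarith
  have h3 := h1 (F z) (F z')
  rw [← hw, e1, e2] at h3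
  have h4 := (h3.trans (le_abs_self _)).trans (h2 (F z) (F z') (R (z - z')))
  rw [← hw] at h4
  set q := √(g w w) with hq
  have hq2 : q ^ 2 = g w w := Real.sq_sqrt (hg.nonneg _)
  rw [← hq2] at h4
  have hq0 : 0 ≤ q := Real.sqrt_nonneg _
  rcases hq0.eq_or_lt with h0 | h0
  · rw [← h0]; positivity
  · have h5 : c * q ≤ M * √(g (R (z - z')) (R (z - z'))) := by
      by_contra h6
      push Not at h6
      nlinarith
    have h6 := h5.trans (mul_le_mul_of_nonneg_left (hRb (z - z')) hM.le)
    rw [div_mul_eq_mul_div, div_mul_eq_mul_div, le_div_iff₀ hc]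
    linarith

/-- Testing with R(z - z') or with F z - F z' is the same, since they differ by an element of the
kernel of `T`; thus the monotonicity of the two local forms adds up. The Lipschitz bound combines
the Lipschitz continuity of `F`, `F'` with the boundedness of `R`, `R'`. -/
lemma isStronglyMonotone_steklov [FiniteDimensional ℝ Z] [FiniteDimensional ℝ W]
    {V : Type*} [AddCommGroup V] [Module ℝ V]
    {g : LinearMap.BilinForm ℝ W} (hg : IsInner g) {g' : LinearMap.BilinForm ℝ V}
    (hg' : IsInner g') {P : LinearMap.BilinForm ℝ Z} (hP : IsInner P)
    {a : W → W →ₗ[ℝ] ℝ} (ha : IsStronglyMonotone g a)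
    {a' : V → V →ₗ[ℝ] ℝ} (ha' : IsStronglyMonotone g' a')
    (T : W →ₗ[ℝ] Z) (R : Z →ₗ[ℝ] W) (hR : ∀ z, T (R z) = z)
    (T' : V →ₗ[ℝ] Z) (R' : Z →ₗ[ℝ] V) (hR' : ∀ z, T' (R' z) = z) {F : Z → W} {F' : Z → V}
    (hF : ∀ z, T (F z) = z ∧ ∀ v, T v = 0 → a (F z) v = 0)
    (hF' : ∀ z, T' (F' z) = z ∧ ∀ v, T' v = 0 → a' (F' z) v = 0) :
    IsStronglyMonotone P (fun z => (a (F z)).comp R + (a' (F' z)).comp R') := by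
  obtain ⟨C, hC, hFl⟩ := exists_lipschitz_dirichlet hg hP ha T R hR hF
  obtain ⟨C', hC', hFl'⟩ := exists_lipschitz_dirichlet hg' hP ha' T' R' hR' hF'
  obtain ⟨c, hc, M, hM, h1, h2⟩ := ha
  obtain ⟨c', hc', M', hM', h1', h2'⟩ := ha'
  obtain ⟨K, hK, hTb⟩ := hg.exists_bound_map hP T
  obtain ⟨Q, hQ, hRb⟩ := hP.exists_bound_map hg R
  obtain ⟨Q', hQ', hRb'⟩ := hP.exists_bound_map hg' R'
  have key : ∀ z z', a (F z) (F z - F z') - a (F z') (F z - F z') =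
      a (F z) (R (z - z')) - a (F z') (R (z - z')) := fun z z' => by
    have hker : T ((F z - F z') - R (z - z')) = 0 := by
      rw [map_sub, map_sub, (hF z).1, (hF z').1, hR, sub_self]
    have e1 := (hF z).2 _ hker
    have e2 := (hF z').2 _ hker
    rw [map_sub (a _)] at e1 e2
    linarith
  have key' : ∀ z z', a' (F' z) (F' z - F' z') - a' (F' z') (F' z - F' z') =
      a' (F' z) (R' (z - z')) - a' (F' z') (R' (z - z')) := fun z z' => by
    have hker : T' ((F' z - F' z') - R' (z - z')) = 0 := by
      rw [map_sub, map_sub, (hF' z).1, (hF' z').1, hR', sub_self]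
    have e1 := (hF' z).2 _ hker
    have e2 := (hF' z').2 _ hker
    rw [map_sub (a' _)] at e1 e2
    linarith
  -- The lower bound uses one subdomain only: z - z' is the trace of F z - F z', and `K` bounds the
  -- trace. The other contribution is nonnegative.
  refine ⟨c / K ^ 2, by positivity, M * C * Q + M' * C' * Q', by positivity, fun z z' => ?_,
    fun z z' v => ?_⟩
  · simp only [LinearMap.add_apply, LinearMap.comp_apply]
    have h3 := (h1 (F z) (F z')).trans_eq (key z z')
    have h4 := (h1' (F' z) (F' z')).trans_eq (key' z z')
    have h5 := pow_le_pow_left₀ (Real.sqrt_nonneg _) (hTb (F z - F z')) 2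
    rw [mul_pow, Real.sq_sqrt (hP.nonneg _), Real.sq_sqrt (hg.nonneg _), map_sub, (hF z).1,
      (hF z').1] at h5
    have h6 : c / K ^ 2 * P (z - z') (z - z') ≤ c * g (F z - F z') (F z - F z') := by
      rw [div_mul_eq_mul_div, div_le_iff₀ (by positivity)]
      nlinarith
    nlinarith [hg'.nonneg (F' z - F' z')]
  · simp only [LinearMap.add_apply, LinearMap.comp_apply]
    rw [add_sub_add_comm]
    refine (abs_add_le _ _).trans ?_
    rw [add_mul]
    refine add_le_add ((h2 _ _ _).trans ?_) ((h2' _ _ _).trans ?_)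
    · calc _ ≤ M * ((C * √(P (z - z') (z - z'))) * (Q * √(P v v))) := by
            gcongr
            exacts [hFl z z', hRb v]
        _ = _ := by ring
    · calc _ ≤ M' * ((C' * √(P (z - z') (z - z'))) * (Q' * √(P v v))) := by
            gcongr
            exacts [hFl' z z', hRb' v]
        _ = _ := by ring

end Steklov

/-! ### Barycentric coordinates in simplicial complexes -/

section Barycentric

lemma sum_smul_extend {E : Type*} [DecidableEq E] {s u : Finset E} (hsu : s ⊆ u) {M : Type*} [AddCommGroup M]
    [Module ℝ M] (w : E → ℝ) (f : E → M) :
    ∑ p ∈ u, (if p ∈ s then w p else 0) • f p = ∑ p ∈ s, w p • f p := by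
  rw [← Finset.sum_subset hsu]
  · exact Finset.sum_congr rfl fun p hp => by rw [if_pos hp]
  · intro p _ hp
    rw [if_neg hp, zero_smul]

variable {E : Type*} [NormedAddCommGroup E] [NormedSpace ℝ E]

lemma weights_unique {s : Finset E} (hs : AffineIndependent ℝ ((↑) : s → E)) {w w' : E → ℝ}
    (h1 : ∑ p ∈ s, w p = ∑ p ∈ s, w' p) (h2 : ∑ p ∈ s, w p • p = ∑ p ∈ s, w' p • p) :
    ∀ p ∈ s, w p = w' p := by
  intro p hp
  have h := (affineIndependent_iff.mp hs) Finset.univ (fun q => w q - w' q) ?_ ?_ ⟨p, hp⟩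
    (Finset.mem_univ _)
  · exact sub_eq_zero.mp h
  · rw [Finset.sum_coe_sort s (fun q => w q - w' q), Finset.sum_sub_distrib, h1, sub_self]
  · rw [Finset.sum_coe_sort s (fun q => (w q - w' q) • q)]
    simp_rw [sub_smul]
    rw [Finset.sum_sub_distrib, h2, sub_self]

lemma affineMap_sum (A : E →ᵃ[ℝ] ℝ) (s : Finset E) {w : E → ℝ} (hw : ∑ p ∈ s, w p = 1) :
    A (∑ p ∈ s, w p • p) = ∑ p ∈ s, w p * A p := by
  have hA : ∀ x, A x = A.linear x + A 0 := fun x => congrFun A.decomp x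
  rw [hA, map_sum]
  simp_rw [map_smul, smul_eq_mul]
  have : ∀ p ∈ s, w p * A p = w p * A.linear p + w p * A 0 := fun p _ => by
    rw [hA p, hA 0]; simp; ring
  rw [Finset.sum_congr rfl this, Finset.sum_add_distrib, ← Finset.sum_mul, hw, one_mul]

variable [DecidableEq E] {K : Geometry.SimplicialComplex ℝ E} {s t : Finset E}

/-- Differences of barycentric coordinates of points of two simplices vanish if the points agree. -/
lemma weight_difference_eq_zero (hs : s ∈ K.faces) (ht : t ∈ K.faces) {z : E → ℝ}
    (h1 : ∀ p ∈ s ∪ t, p ∉ t → 0 ≤ z p) (h2 : ∀ p ∈ s ∪ t, p ∉ s → z p ≤ 0)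
    (h3 : ∑ p ∈ s ∪ t, z p = 0) (h4 : ∑ p ∈ s ∪ t, z p • p = 0) : ∀ p ∈ s ∪ t, z p = 0 := by
  -- The positive part `a` lives on `s` and the negative part `b` on `t`; by `h3` and `h4` they have
  -- equal mass and equal moment.
  set a : E → ℝ := fun p => max (z p) 0
  set b : E → ℝ := fun p => max (-z p) 0
  have hab : ∀ p, z p = a p - b p := fun p => by
    simp only [a, b]; rcases le_total (z p) 0 with h | h <;> simp [h]
  have has : ∀ p ∈ s ∪ t, p ∉ s → a p = 0 := fun p hp hps => max_eq_right (h2 p hp hps)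
  have hbt : ∀ p ∈ s ∪ t, p ∉ t → b p = 0 := fun p hp hpt =>
    max_eq_right (neg_nonpos.mpr (h1 p hp hpt))
  have ha0 : ∀ p, 0 ≤ a p := fun p => le_max_right _ _
  have hb0 : ∀ p, 0 ≤ b p := fun p => le_max_right _ _
  have ea : ∑ p ∈ s ∪ t, a p • p = ∑ p ∈ s, a p • p :=
    (Finset.sum_subset Finset.subset_union_left fun p hp hps => by
      rw [has p hp hps, zero_smul]).symm
  have eb : ∑ p ∈ s ∪ t, b p • p = ∑ p ∈ t, b p • p :=
    (Finset.sum_subset Finset.subset_union_right fun p hp hps => by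
      rw [hbt p hp hps, zero_smul]).symm
  have hmass : ∑ p ∈ s, a p = ∑ p ∈ t, b p := by
    rw [Finset.sum_subset (Finset.subset_union_left (s₂ := t)) fun p hp hps => has p hp hps,
      Finset.sum_subset (Finset.subset_union_right (s₁ := s)) fun p hp hps => hbt p hp hps, ← sub_eq_zero, ← Finset.sum_sub_distrib, ← h3]
    exact Finset.sum_congr rfl fun p _ => (hab p).symm
  have hpt : ∑ p ∈ s, a p • p = ∑ p ∈ t, b p • p := by
    rw [← ea, ← eb, ← sub_eq_zero, ← Finset.sum_sub_distrib, ← h4]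
    exact Finset.sum_congr rfl fun p _ => by rw [← sub_smul, hab p]
  set m := ∑ p ∈ s, a p with hm
  rcases (Finset.sum_nonneg fun p (_ : p ∈ s) => ha0 p).eq_or_lt with h0 | h0
  · have ea0 := (Finset.sum_eq_zero_iff_of_nonneg fun p (_ : p ∈ s) => ha0 p).mp h0.symm
    have eb0 := (Finset.sum_eq_zero_iff_of_nonneg fun p (_ : p ∈ t) => hb0 p).mp
      (hmass.symm.trans (hm.trans h0.symm))
    intro p hp
    rw [hab p]
    have e1 : a p = 0 := by
      by_cases h : p ∈ s
      exacts [ea0 p h, has p hp h]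
    have e2 : b p = 0 := by
      by_cases h : p ∈ t
      exacts [eb0 p h, hbt p hp h]
    rw [e1, e2, sub_zero]
  -- The common centre of mass lies in both simplices, hence in the hull of their common vertices.
  -- Uniqueness of barycentric coordinates in `s` and in `t` then identifies both `a` and `b` with
  -- the same weights on s ∩ t.
  · set x := m⁻¹ • ∑ p ∈ s, a p • p with hx
    have hxs : x ∈ convexHull ℝ (s : Set E) := by
      rw [Finset.mem_convexHull']
      refine ⟨fun p => m⁻¹ * a p, fun p _ => mul_nonneg (inv_nonneg.mpr h0.le) (ha0 p), ?_, ?_⟩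
      · rw [← Finset.mul_sum, inv_mul_cancel₀ h0.ne']
      · simp_rw [mul_smul]; rw [← Finset.smul_sum]
    have hxt : x ∈ convexHull ℝ (t : Set E) := by
      rw [Finset.mem_convexHull']
      refine ⟨fun p => m⁻¹ * b p, fun p _ => mul_nonneg (inv_nonneg.mpr h0.le) (hb0 p), ?_, ?_⟩
      · rw [← Finset.mul_sum, ← hmass, inv_mul_cancel₀ h0.ne']
      · simp_rw [mul_smul]; rw [← Finset.smul_sum, ← hpt]
    have hxi := K.inter_subset_convexHull hs ht ⟨hxs, hxt⟩
    rw [← Finset.coe_inter, Finset.mem_convexHull'] at hxi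
    obtain ⟨w, -, hw1, hw2⟩ := hxi
    set w' : E → ℝ := fun p => m * (if p ∈ s ∩ t then w p else 0)
    have hw1' : ∀ u : Finset E, s ∩ t ⊆ u → ∑ p ∈ u, w' p = m := fun u hu => by
      have := sum_smul_extend hu w (fun _ => (1 : ℝ))
      simp only [smul_eq_mul, mul_one] at this
      rw [← Finset.mul_sum, this, hw1, mul_one]
    have hw2' : ∀ u : Finset E, s ∩ t ⊆ u → ∑ p ∈ u, w' p • p = ∑ p ∈ s, a p • p := fun u hu => by
      simp_rw [w', mul_smul]
      rw [← Finset.smul_sum, sum_smul_extend hu w (fun p => p), hw2, hx, smul_smul,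
        mul_inv_cancel₀ h0.ne', one_smul]
    have eas := weights_unique (K.indep hs) (w := a) (w' := w')
      (hw1' s Finset.inter_subset_left).symm (hw2' s Finset.inter_subset_left).symm
    have ebt := weights_unique (K.indep ht) (w := b) (w' := w')
      ((hw1' t Finset.inter_subset_right).trans hmass).symm
      ((hw2' t Finset.inter_subset_right).trans hpt).symm
    intro p hp
    rw [hab p]
    have hw0 : p ∉ s ∩ t → w' p = 0 := fun h => by simp only [w', if_neg h, mul_zero]
    have e1 : a p = w' p := by
      by_cases h : p ∈ s
      · exact eas p h
      · rw [has p hp h, hw0 (fun h' => h (Finset.mem_inter.mp h').1)]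
    have e2 : b p = w' p := by
      by_cases h : p ∈ t
      · exact ebt p h
      · rw [hbt p hp h, hw0 (fun h' => h (Finset.mem_inter.mp h').2)]
    rw [e1, e2, sub_self]

/-- Barycentric coordinates are Lipschitz continuous across two simplices of a complex. -/
lemma exists_weight_bound (hs : s ∈ K.faces) (ht : t ∈ K.faces) :
    ∃ C : ℝ, 0 ≤ C ∧ ∀ z : E → ℝ, (∀ p ∈ s ∪ t, p ∉ t → 0 ≤ z p) → (∀ p ∈ s ∪ t, p ∉ s → z p ≤ 0) →
      ∑ p ∈ s ∪ t, z p = 0 → ∀ p ∈ s ∪ t, |z p| ≤ C * ‖∑ p ∈ s ∪ t, z p • p‖ := by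
  let I := {p // p ∈ s ∪ t}
  -- `P` is a closed cone on which the linear map `T` has no nontrivial zero, by
  -- `weight_difference_eq_zero`; compactness of its unit sphere makes this quantitative.
  let P : Set (I → ℝ) := {z | (∀ p : I, (p : E) ∉ t → 0 ≤ z p) ∧ (∀ p : I, (p : E) ∉ s → z p ≤ 0) ∧
    ∑ p, z p = 0}
  let T : (I → ℝ) → E := fun z => ∑ p : I, z p • (p : E)
  have hT : Continuous T :=
    continuous_finsetSum _ fun p _ => (continuous_apply p).smul continuous_const
  have hP : IsClosed P := by
    have e : P = (⋂ p : I, ⋂ _ : (p : E) ∉ t, {z | 0 ≤ z p}) ∩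
        ((⋂ p : I, ⋂ _ : (p : E) ∉ s, {z | z p ≤ 0}) ∩ {z | ∑ p, z p = 0}) := by
      ext z; simp [P]
    rw [e]
    refine IsClosed.inter ?_ (IsClosed.inter ?_ ?_)
    · exact isClosed_iInter fun p => isClosed_iInter fun _ =>
        isClosed_le continuous_const (continuous_apply p)
    · exact isClosed_iInter fun p => isClosed_iInter fun _ =>
        isClosed_le (continuous_apply p) continuous_const
    · exact isClosed_eq (by fun_prop) continuous_const
  have hinj : ∀ z ∈ P, T z = 0 → z = 0 := by
    rintro z ⟨h1, h2, h3⟩ h4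
    let z' : E → ℝ := fun p => if h : p ∈ s ∪ t then z ⟨p, h⟩ else 0
    have hz' : ∀ p : I, z' p = z p := fun p => dif_pos p.2
    have h := weight_difference_eq_zero hs ht (z := z')
      (fun p hp hpt => by simpa only [z', dif_pos hp] using h1 ⟨p, hp⟩ hpt)
      (fun p hp hps => by simpa only [z', dif_pos hp] using h2 ⟨p, hp⟩ hps)
      (by rw [← h3, ← Finset.sum_coe_sort (s ∪ t) z']; exact Finset.sum_congr rfl fun p _ => hz' p)
      (by rw [← h4, ← Finset.sum_coe_sort (s ∪ t) (fun p => z' p • p)]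
          exact Finset.sum_congr rfl fun p _ => by rw [hz' p])
    ext p
    rw [← hz' p, h p p.2, Pi.zero_apply]
  obtain ⟨c, hc, hbound⟩ : ∃ c > 0, ∀ z ∈ P, c * ‖z‖ ≤ ‖T z‖ := by
    -- If the cone is trivial there is nothing to minimize over, and any constant works.
    rcases (P ∩ Metric.sphere 0 1).eq_empty_or_nonempty with he | hne
    · refine ⟨1, one_pos, fun z hz => ?_⟩
      by_cases hz0 : z = 0
      · simp [hz0]
      · exfalso
        have hn : 0 < ‖z‖ := norm_pos_iff.mpr hz0
        have : ‖z‖⁻¹ • z ∈ P ∩ Metric.sphere 0 1 := by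
          refine ⟨⟨fun p hp => ?_, fun p hp => ?_, ?_⟩, ?_⟩
          · exact mul_nonneg (inv_nonneg.mpr hn.le) (hz.1 p hp)
          · exact mul_nonpos_of_nonneg_of_nonpos (inv_nonneg.mpr hn.le) (hz.2.1 p hp)
          · simp only [Pi.smul_apply, smul_eq_mul]
            rw [← Finset.mul_sum, hz.2.2, mul_zero]
          · simp [norm_smul, hn.ne']
        rw [he] at this
        exact this
    · have hcomp : IsCompact (P ∩ Metric.sphere 0 1) := (isCompact_sphere 0 1).inter_left hP
      obtain ⟨z₀, hz₀, hmin⟩ := hcomp.exists_isMinOn hne (hT.norm.continuousOn)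
      have hz₀0 : z₀ ≠ 0 := by
        rintro rfl
        simpa using hz₀.2
      refine ⟨‖T z₀‖, norm_pos_iff.mpr fun h => hz₀0 (hinj z₀ hz₀.1 h), fun z hz => ?_⟩
      by_cases hz0 : z = 0
      · simp [hz0]
      · have hn : 0 < ‖z‖ := norm_pos_iff.mpr hz0
        have hmem : ‖z‖⁻¹ • z ∈ P ∩ Metric.sphere 0 1 := by
          refine ⟨⟨fun p hp => ?_, fun p hp => ?_, ?_⟩, ?_⟩
          · exact mul_nonneg (inv_nonneg.mpr hn.le) (hz.1 p hp)
          · exact mul_nonpos_of_nonneg_of_nonpos (inv_nonneg.mpr hn.le) (hz.2.1 p hp)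
          · simp only [Pi.smul_apply, smul_eq_mul]
            rw [← Finset.mul_sum, hz.2.2, mul_zero]
          · simp [norm_smul, hn.ne']
        have h := hmin hmem
        have hTs : T (‖z‖⁻¹ • z) = ‖z‖⁻¹ • T z := by
          simp only [T, Pi.smul_apply, smul_eq_mul, mul_smul, Finset.smul_sum]
        simp only [mem_ofPred_eq] at h
        rw [hTs, norm_smul, norm_inv, norm_norm, inv_mul_eq_div, le_div_iff₀ hn] at h
        exact h
  refine ⟨c⁻¹, (inv_pos.mpr hc).le, fun z h1 h2 h3 p hp => ?_⟩
  have h := hbound (fun q : I => z q) ⟨fun q => h1 q q.2, fun q => h2 q q.2, by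
    rw [← h3]; exact Finset.sum_coe_sort (s ∪ t) z⟩
  have e : T (fun q : I => z q) = ∑ p ∈ s ∪ t, z p • p :=
    Finset.sum_coe_sort (s ∪ t) (fun q => z q • q)
  rw [e] at h
  rw [inv_mul_eq_div, le_div_iff₀ hc, mul_comm]
  refine le_trans (mul_le_mul_of_nonneg_left ?_ hc.le) h
  exact norm_le_pi_norm (fun q : I => z q) ⟨p, hp⟩

end Barycentric

/-! ### Piecewise linear functions -/

section PiecewiseLinear

variable {d : ℕ} {K : Geometry.SimplicialComplex ℝ (Space d)} {C B : Set (Space d)}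

/-- The set `C` is a union of simplices of the complex `K`. -/
def IsResolved (K : Geometry.SimplicialComplex ℝ (Space d)) (C : Set (Space d)) : Prop :=
  ∀ x ∈ C, ∃ s ∈ K.faces, convexHull ℝ (s : Set (Space d)) ⊆ C ∧
    x ∈ convexHull ℝ (s : Set (Space d))

/-- Interior points of the simplices that lie in `C`. -/
def regularSet (K : Geometry.SimplicialComplex ℝ (Space d)) (C : Set (Space d)) : Set (Space d) :=
  {x | ∃ s ∈ K.faces, convexHull ℝ (s : Set (Space d)) ⊆ C ∧
    x ∈ interior (convexHull ℝ (s : Set (Space d)))}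

lemma pl_eq_sum {v : Space d → ℝ} (hv : v ∈ plSpace K C B) {s : Finset (Space d)}
    (hs : s ∈ K.faces) (hsC : convexHull ℝ (s : Set (Space d)) ⊆ C) {w : Space d → ℝ}
    (hw0 : ∀ p ∈ s, 0 ≤ w p) (hw : ∑ p ∈ s, w p = 1) :
    v (∑ p ∈ s, w p • p) = ∑ p ∈ s, w p * v p := by
  obtain ⟨A, hA⟩ := hv.1 s hs hsC
  have hmem : ∑ p ∈ s, w p • p ∈ convexHull ℝ (s : Set (Space d)) :=
    Finset.mem_convexHull'.mpr ⟨w, hw0, hw, rfl⟩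
  rw [hA hmem, affineMap_sum A s hw]
  exact Finset.sum_congr rfl fun p hp => by
    rw [hA (subset_convexHull ℝ _ (Finset.mem_coe.mpr hp))]

/-- Being affine on each simplex is not enough, as `C` need not be convex and the segment between
two points may leave it. Instead, v x - v y is a combination of vertex values whose weights are
differences of barycentric coordinates, and `exists_weight_bound` controls these by |x - y|. -/
lemma pl_lipschitz (hfin : K.faces.Finite) (hC : IsResolved K C) {v : Space d → ℝ}
    (hv : v ∈ plSpace K C B) : ∃ L : ℝ≥0, LipschitzOnWith L v C := by
  classical
  have hpair : ∀ s ∈ K.faces, ∀ t ∈ K.faces, ∀ᶠ L : ℝ in atTop,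
      convexHull ℝ (s : Set (Space d)) ⊆ C → convexHull ℝ (t : Set (Space d)) ⊆ C →
      ∀ x ∈ convexHull ℝ (s : Set (Space d)), ∀ y ∈ convexHull ℝ (t : Set (Space d)),
        |v x - v y| ≤ L * ‖x - y‖ := by
    intro s hs t ht
    obtain ⟨c, hc, hcb⟩ := exists_weight_bound hs ht
    filter_upwards [eventually_ge_atTop (∑ p ∈ s ∪ t, c * |v p|)] with L hL hsC htC x hx y hy
    obtain ⟨w, hw0, hw1, rfl⟩ := Finset.mem_convexHull'.mp hx
    obtain ⟨w', hw0', hw1', rfl⟩ := Finset.mem_convexHull'.mp hy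
    rw [pl_eq_sum hv hs hsC hw0 hw1, pl_eq_sum hv ht htC hw0' hw1']
    -- Vertices of only one of the simplices give weights of the sign that `exists_weight_bound`
    -- requires.
    let z : Space d → ℝ := fun p => (if p ∈ s then w p else 0) - (if p ∈ t then w' p else 0)
    have hsum : ∀ {M : Type _} [AddCommGroup M] [Module ℝ M] (f : Space d → M),
        ∑ p ∈ s ∪ t, z p • f p = ∑ p ∈ s, w p • f p - ∑ p ∈ t, w' p • f p := fun f => by
      simp_rw [z, sub_smul]
      rw [Finset.sum_sub_distrib, sum_smul_extend Finset.subset_union_left,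
        sum_smul_extend Finset.subset_union_right]
    have hz := hcb z
      (fun p hp hpt => by
        have hps : p ∈ s := (Finset.mem_union.mp hp).resolve_right hpt
        simp only [z, if_pos hps, if_neg hpt, sub_zero]
        exact hw0 p hps)
      (fun p hp hps => by
        have hpt : p ∈ t := (Finset.mem_union.mp hp).resolve_left hps
        simp only [z, if_pos hpt, if_neg hps, zero_sub, neg_nonpos]
        exact hw0' p hpt)
      (by
        have := hsum (fun _ => (1 : ℝ))
        simp only [smul_eq_mul, mul_one] at this
        rw [this, hw1, hw1', sub_self])
    rw [hsum (fun p => p)] at hz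
    have hvs := hsum v
    simp only [smul_eq_mul] at hvs
    rw [← hvs]
    refine (Finset.abs_sum_le_sum_abs _ _).trans ?_
    refine le_trans ?_ (mul_le_mul_of_nonneg_right hL (norm_nonneg _))
    rw [Finset.sum_mul]
    refine Finset.sum_le_sum fun p hp => ?_
    rw [abs_mul]
    calc |z p| * |v p| ≤ (c * _) * |v p| := mul_le_mul_of_nonneg_right (hz p hp) (abs_nonneg _)
      _ = _ := by ring
  have hall : ∀ᶠ L : ℝ in atTop, ∀ s ∈ K.faces, ∀ t ∈ K.faces,
      convexHull ℝ (s : Set (Space d)) ⊆ C → convexHull ℝ (t : Set (Space d)) ⊆ C →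
      ∀ x ∈ convexHull ℝ (s : Set (Space d)), ∀ y ∈ convexHull ℝ (t : Set (Space d)),
        |v x - v y| ≤ L * ‖x - y‖ := by
    rw [Filter.eventually_all_finite hfin]
    intro s hs
    rw [Filter.eventually_all_finite hfin]
    exact fun t ht => hpair s hs t ht
  obtain ⟨L, hL, hL0⟩ := (hall.and (eventually_ge_atTop 0)).exists
  refine ⟨⟨L, hL0⟩, LipschitzOnWith.of_dist_le_mul fun x hx y hy => ?_⟩
  obtain ⟨s, hs, hsC, hxs⟩ := hC x hx
  obtain ⟨t, ht, htC, hyt⟩ := hC y hy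
  rw [dist_eq_norm, dist_eq_norm, Real.norm_eq_abs]
  exact hL s hs t ht hsC htC x hxs y hyt

/-- Evaluation at the finitely many vertices is injective. -/
lemma finiteDimensional_plSpace (hfin : K.faces.Finite) (hC : IsResolved K C) :
    FiniteDimensional ℝ (plSpace K C B) := by
  classical
  let T : Finset (Space d) := hfin.toFinset.biUnion id
  let e : plSpace K C B →ₗ[ℝ] (T → ℝ) :=
    { toFun := fun v p => (v : Space d → ℝ) p
      map_add' := fun _ _ => rfl
      map_smul' := fun _ _ => rfl }
  apply FiniteDimensional.of_injective e
  rw [← LinearMap.ker_eq_bot, LinearMap.ker_eq_bot']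
  rintro ⟨v, hv⟩ h
  ext x
  change v x = 0
  by_cases hx : x ∈ C
  · obtain ⟨s, hs, hsC, hxs⟩ := hC x hx
    obtain ⟨w, hw0, hw1, rfl⟩ := Finset.mem_convexHull'.mp hxs
    rw [pl_eq_sum hv hs hsC hw0 hw1]
    refine Finset.sum_eq_zero fun p hp => ?_
    have hpT : p ∈ T := Finset.mem_biUnion.mpr ⟨s, hfin.mem_toFinset.mpr hs, hp⟩
    have : v p = 0 := congrFun h ⟨p, hpT⟩
    rw [this, mul_zero]
  · exact hv.2.1 x hx

/-- Boundaries of convex sets are null. This also covers the simplices of lower dimension, which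
consist of boundary points only. -/
lemma ae_mem_regularSet (hfin : K.faces.Finite) (hC : IsResolved K C) :
    ∀ᵐ x : Space d, x ∈ C → x ∈ regularSet K C := by
  have h : ∀ᵐ x : Space d, ∀ s ∈ K.faces, x ∉ frontier (convexHull ℝ (s : Set (Space d))) := by
    rw [ae_ball_iff hfin.countable]
    intro s _
    have := (convex_convexHull ℝ (s : Set (Space d))).addHaar_frontier volume
    exact measure_eq_zero_iff_ae_notMem.mp this
  filter_upwards [h] with x hx hxC
  obtain ⟨s, hs, hsC, hxs⟩ := hC x hxC
  refine ⟨s, hs, hsC, ?_⟩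
  by_contra hni
  exact hx s hs ⟨subset_closure hxs, hni⟩

lemma pl_hasFDerivAt {v : Space d → ℝ} (hv : v ∈ plSpace K C B) {s : Finset (Space d)}
    (hs : s ∈ K.faces) (hsC : convexHull ℝ (s : Set (Space d)) ⊆ C) :
    ∃ A : Space d →ᵃ[ℝ] ℝ, EqOn v A (convexHull ℝ (s : Set (Space d))) ∧
      ∀ x ∈ interior (convexHull ℝ (s : Set (Space d))),
        HasFDerivAt v (LinearMap.toContinuousLinearMap A.linear) x := by
  obtain ⟨A, hA⟩ := hv.1 s hs hsC
  refine ⟨A, hA, fun x hx => ?_⟩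
  have h1 : HasFDerivAt (fun y => LinearMap.toContinuousLinearMap A.linear y + A 0)
      (LinearMap.toContinuousLinearMap A.linear) x :=
    (LinearMap.toContinuousLinearMap A.linear).hasFDerivAt.add_const _
  refine h1.congr_of_eventuallyEq ?_
  filter_upwards [mem_interior_iff_mem_nhds.mp hx] with y hy
  rw [hA hy]
  exact congrFun A.decomp y

lemma pl_differentiableAt {v : Space d → ℝ} (hv : v ∈ plSpace K C B) {x : Space d}
    (hx : x ∈ regularSet K C) : DifferentiableAt ℝ v x := by
  obtain ⟨s, hs, hsC, hxs⟩ := hx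
  obtain ⟨A, -, hA⟩ := pl_hasFDerivAt hv hs hsC
  exact (hA x hxs).differentiableAt

lemma pl_fderiv_bound (hfin : K.faces.Finite) {v : Space d → ℝ} (hv : v ∈ plSpace K C B) :
    ∃ M, ∀ x ∈ regularSet K C, ‖fderiv ℝ v x‖ ≤ M := by
  have h : ∀ s ∈ K.faces, ∀ᶠ M : ℝ in atTop, convexHull ℝ (s : Set (Space d)) ⊆ C →
      ∀ x ∈ interior (convexHull ℝ (s : Set (Space d))), ‖fderiv ℝ v x‖ ≤ M := by
    intro s hs
    by_cases hsC : convexHull ℝ (s : Set (Space d)) ⊆ C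
    · obtain ⟨A, -, hA⟩ := pl_hasFDerivAt hv hs hsC
      filter_upwards [eventually_ge_atTop ‖LinearMap.toContinuousLinearMap A.linear‖] with M hM _ x hx
      rw [(hA x hx).fderiv]
      exact hM
    · exact Eventually.of_forall fun _ h => absurd h hsC
  obtain ⟨M, hM⟩ := ((Filter.eventually_all_finite hfin).mpr h).exists
  exact ⟨M, fun x ⟨s, hs, hsC, hxs⟩ => hM s hs hsC x hxs⟩

lemma pl_bounded (hfin : K.faces.Finite) (hC : IsResolved K C) {v : Space d → ℝ}
    (hv : v ∈ plSpace K C B) : ∃ M, ∀ x, ‖v x‖ ≤ M := by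
  have h : ∀ s ∈ K.faces, ∀ᶠ M : ℝ in atTop, convexHull ℝ (s : Set (Space d)) ⊆ C →
      ∀ x ∈ convexHull ℝ (s : Set (Space d)), ‖v x‖ ≤ M := by
    intro s hs
    filter_upwards [eventually_ge_atTop (∑ p ∈ s, ‖v p‖)] with M hM hsC x hx
    obtain ⟨w, hw0, hw1, rfl⟩ := Finset.mem_convexHull'.mp hx
    rw [pl_eq_sum hv hs hsC hw0 hw1]
    refine (norm_sum_le _ _).trans (le_trans (Finset.sum_le_sum fun p hp => ?_) hM)
    rw [norm_mul, Real.norm_of_nonneg (hw0 p hp)]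
    refine mul_le_of_le_one_left (norm_nonneg _) ?_
    rw [← hw1]
    exact Finset.single_le_sum hw0 hp
  obtain ⟨M, hM, hM0⟩ :=
    (((Filter.eventually_all_finite hfin).mpr h).and (eventually_ge_atTop 0)).exists
  refine ⟨M, fun x => ?_⟩
  by_cases hx : x ∈ C
  · obtain ⟨s, hs, hsC, hxs⟩ := hC x hx
    exact hM s hs hsC x hxs
  · rw [hv.2.1 x hx, norm_zero]; exact hM0

/-- On a full-dimensional simplex the function is affine with zero slope, hence constant, and there
are finitely many simplices. Almost every point lies inside such a simplex, and by continuity no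
further values occur, a finite set being closed. -/
lemma pl_finite_values {G : Set (Space d)} (hG : IsOpen G) (hfin : K.faces.Finite)
    (hC : IsResolved K (closure G)) {v : Space d → ℝ} (hv : v ∈ plSpace K (closure G) B)
    (h0 : ∀ᵐ x ∂(volume.restrict G), fderiv ℝ v x = 0) :
    ∃ F : Set ℝ, F.Finite ∧ ∀ x ∈ G, v x ∈ F := by
  rw [ae_restrict_iff' hG.measurableSet] at h0
  have hpos : ∀ O : Set (Space d), IsOpen O → O.Nonempty → ∀ {p : Space d → Prop},
      (∀ᵐ x, p x) → ∃ x ∈ O, p x := by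
    intro O hO hne p hp
    by_contra hcon
    push Not at hcon
    have : volume O = 0 := measure_mono_null (fun x hx => hcon x hx) hp
    exact (hO.measure_pos volume hne).ne' this
  have hconst : ∀ s ∈ K.faces, convexHull ℝ (s : Set (Space d)) ⊆ closure G →
      (interior (convexHull ℝ (s : Set (Space d)))).Nonempty →
      ∃ c, ∀ x ∈ convexHull ℝ (s : Set (Space d)), v x = c := by
    intro s hs hsC ⟨y, hy⟩
    obtain ⟨A, hA, hA'⟩ := pl_hasFDerivAt hv hs hsC
    -- The gradient is known on `G` only, while the simplex lies in its closure; its interior still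
    -- meets `G` in an open set.
    have hO : (interior (convexHull ℝ (s : Set (Space d))) ∩ G).Nonempty :=
      mem_closure_iff.mp (hsC (interior_subset hy)) _ isOpen_interior hy
    obtain ⟨x, ⟨hxs, hxG⟩, hx⟩ := hpos _ (isOpen_interior.inter hG) hO h0
    have hlin : A.linear = 0 := by
      have := hx hxG
      rw [(hA' x hxs).fderiv] at this
      ext p
      exact DFunLike.congr_fun this p
    refine ⟨A 0, fun z hz => ?_⟩
    rw [hA hz, congrFun A.decomp z]
    simp [hlin]
  let F : Set ℝ := ⋃ s ∈ K.faces, {c | convexHull ℝ (s : Set (Space d)) ⊆ closure G ∧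
    (interior (convexHull ℝ (s : Set (Space d)))).Nonempty ∧
    ∃ x ∈ convexHull ℝ (s : Set (Space d)), v x = c}
  have hF : F.Finite := by
    refine hfin.biUnion fun s hs => ?_
    by_cases h : convexHull ℝ (s : Set (Space d)) ⊆ closure G ∧
        (interior (convexHull ℝ (s : Set (Space d)))).Nonempty
    · obtain ⟨c, hc⟩ := hconst s hs h.1 h.2
      refine (Set.finite_singleton c).subset ?_
      rintro _ ⟨-, -, x, hx, rfl⟩
      exact hc x hx
    · refine Set.finite_empty.subset ?_
      rintro _ ⟨h1, h2, -⟩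
      exact h ⟨h1, h2⟩
  refine ⟨F, hF, fun x hx => ?_⟩
  rw [← hF.isClosed.closure_eq]
  obtain ⟨L, hL⟩ := pl_lipschitz hfin hC hv
  have hcont : ContinuousAt v x :=
    hL.continuousOn.continuousAt (mem_of_superset (hG.mem_nhds hx) subset_closure)
  rw [mem_closure_iff]
  intro O hO hxO
  obtain ⟨N, hN, hNo, hxN⟩ := mem_nhds_iff.mp
    (inter_mem (hcont.preimage_mem_nhds (hO.mem_nhds hxO)) (hG.mem_nhds hx))
  obtain ⟨y, hy, hreg⟩ := hpos N hNo ⟨x, hxN⟩ (ae_mem_regularSet hfin hC)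
  obtain ⟨s, hs, hsC, hys⟩ := hreg (subset_closure (hN hy).2)
  exact ⟨v y, (hN hy).1, mem_biUnion hs ⟨hsC, ⟨y, hys⟩, y, interior_subset hys, rfl⟩⟩

/-- Piecewise linear functions with vanishing gradient vanish if every component of the domain
reaches the part of the boundary where they are zero. -/
lemma pl_eq_zero {G : Set (Space d)} (hG : IsOpen G) (hfin : K.faces.Finite)
    (hC : IsResolved K (closure G))
    (hB : ∀ x ∈ G, (closure (connectedComponentIn G x) ∩ B).Nonempty)
    {v : Space d → ℝ} (hv : v ∈ plSpace K (closure G) B)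
    (h0 : ∀ᵐ x ∂(volume.restrict G), fderiv ℝ v x = 0) : v = 0 := by
  obtain ⟨F, hF, hvF⟩ := pl_finite_values hG hfin hC hv h0
  obtain ⟨L, hL⟩ := pl_lipschitz hfin hC hv
  have hzero : ∀ x ∈ G, v x = 0 := by
    intro x hx
    set S := connectedComponentIn G x
    have hSG : S ⊆ G := connectedComponentIn_subset G x
    have hxS : x ∈ S := mem_connectedComponentIn hx
    -- The image of a component is connected and finite, hence a single value; at a boundary point
    -- in the closure of the component this value is zero.
    have hpre : IsPreconnected (v '' S) := isPreconnected_connectedComponentIn.image v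
      (hL.continuousOn.mono (hSG.trans subset_closure))
    have hfinS : (v '' S).Finite := hF.subset (by rintro _ ⟨y, hy, rfl⟩; exact hvF y (hSG hy))
    have hsub : (v '' S).Subsingleton := by
      intro a ha b hb
      by_contra hab
      rcases lt_or_gt_of_ne hab with h | h
      · exact (Set.Icc_infinite h) (hfinS.subset (hpre.Icc_subset ha hb))
      · exact (Set.Icc_infinite h) (hfinS.subset (hpre.Icc_subset hb ha))
    obtain ⟨p, hpS, hpB⟩ := hB x hx
    have hp0 : v p = 0 := hv.2.2 p hpB
    have hcl : v p ∈ closure (v '' S) := by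
      have hc : ContinuousWithinAt v S p :=
        (hL.continuousOn p (closure_mono hSG hpS)).mono (hSG.trans subset_closure)
      exact hc.mem_closure_image hpS
    rw [hfinS.isClosed.closure_eq, hp0] at hcl
    exact hsub ⟨x, hxS, rfl⟩ hcl
  ext x
  by_cases hx : x ∈ closure G
  · have h1 : EqOn v 0 (closure G) :=
      EqOn.of_subset_closure (s := G) (t := closure G) (fun x hx => hzero x hx) hL.continuousOn
        continuousOn_const subset_closure subset_rfl
    exact h1 hx
  · exact hv.2.1 x hx

end PiecewiseLinear

/-! ### Surface measure of Lipschitz boundaries -/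

section Surface

lemma euclideanHausdorffMeasure_image_le {X Y : Type*} [EMetricSpace X] [EMetricSpace Y]
    [MeasurableSpace X] [BorelSpace X] [MeasurableSpace Y] [BorelSpace Y] {f : X → Y} {s : Set X}
    {K : ℝ≥0} (hf : LipschitzOnWith K f s) (n : ℕ) :
    Measure.euclideanHausdorffMeasure n (f '' s) ≤
      (K : ℝ≥0∞) ^ n * Measure.euclideanHausdorffMeasure n s := by
  rw [Measure.euclideanHausdorffMeasure_def, Measure.euclideanHausdorffMeasure_def,
    Measure.smul_apply, Measure.smul_apply, ENNReal.smul_def, ENNReal.smul_def, smul_eq_mul,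
    smul_eq_mul, mul_left_comm]
  have h := hf.hausdorffMeasure_image_le (d := n) (by positivity)
  rw [ENNReal.rpow_natCast] at h
  gcongr

variable {d : ℕ} {G : Set (Space d)}

/-- Near `x` the set `G` is the epigraph of the Lipschitz function `g` in the direction `e`. -/
def IsChart (G : Set (Space d)) (x e : Space d) (r : ℝ) (g : Space d → ℝ) : Prop :=
  ∀ y ∈ Metric.ball x r, (y ∈ G ↔ g (y - inner ℝ e y • e) < inner ℝ e y)

/-- A point strictly below the graph has a neighbourhood outside `G`, and one strictly above lies in
the open set `G`; neither is on the boundary. -/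
lemma frontier_chart (hG : IsOpen G) {x e : Space d} {r : ℝ} {g : Space d → ℝ} {L : ℝ≥0}
    (hg : LipschitzWith L g) (hc : IsChart G x e r g) {y : Space d} (hy : y ∈ frontier G)
    (hyr : y ∈ Metric.ball x r) : g (y - inner ℝ e y • e) = inner ℝ e y := by
  rw [hG.frontier_eq] at hy
  have hc1 : Continuous fun y : Space d => g (y - inner ℝ e y • e) :=
    hg.continuous.comp (by fun_prop)
  have hc2 : Continuous fun y : Space d => (inner ℝ e y : ℝ) := by fun_prop
  apply le_antisymm
  · by_contra h
    push Not at h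
    have ho : IsOpen {z : Space d | inner ℝ e z < g (z - inner ℝ e z • e)} := isOpen_lt hc2 hc1
    obtain ⟨z, ⟨hz1, hz2⟩, hzG⟩ := mem_closure_iff.mp hy.1 _ (ho.inter Metric.isOpen_ball) ⟨h, hyr⟩
    exact lt_asymm ((hc z hz2).mp hzG) hz1
  · by_contra h
    push Not at h
    exact hy.2 ((hc y hyr).mpr h)

/-- A Lipschitz domain has no slits: arbitrarily close to a boundary point, below the graph, there
are points outside the closure. -/
lemma interior_closure_subset (hG : IsLipschitzDomain G) : interior (closure G) ⊆ G := by
  intro x hx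
  by_contra hxG
  have hxf : x ∈ frontier G := by
    rw [hG.1.frontier_eq]; exact ⟨interior_subset hx, hxG⟩
  obtain ⟨e, he, r, hr, L, g, hg, hc⟩ := hG.2.2 x hxf
  have hgx := frontier_chart hG.1 hg hc hxf (Metric.mem_ball_self hr)
  have hlt : ∀ ε > 0, ∃ y, dist y x < ε ∧ inner ℝ e y < g (y - inner ℝ e y • e) := by
    intro ε hε
    have hee : inner ℝ e e = (1 : ℝ) := by rw [real_inner_self_eq_norm_sq, he, one_pow]
    -- Moving along `-e` lowers the height and leaves the projection, hence the value of `g`,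
    -- unchanged.
    refine ⟨x - (ε / 2) • e, ?_, ?_⟩
    · rw [dist_eq_norm, sub_sub_cancel_left, norm_neg, norm_smul, he, mul_one,
        Real.norm_of_nonneg (by positivity)]
      exact half_lt_self hε
    · have h1 : inner ℝ e (x - (ε / 2) • e) = inner ℝ e x - ε / 2 := by
        rw [inner_sub_right, inner_smul_right, hee, mul_one]
      have h2 : x - (ε / 2) • e - inner ℝ e (x - (ε / 2) • e) • e = x - inner ℝ e x • e := by
        rw [h1, sub_smul]; abel
      rw [h2, h1, hgx]
      linarith
  have ho : IsOpen {z : Space d | inner ℝ e z < g (z - inner ℝ e z • e)} :=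
    isOpen_lt (by fun_prop) (hg.continuous.comp (by fun_prop))
  have hN : Metric.ball x r ∩ interior (closure G) ∈ 𝓝 x :=
    inter_mem (Metric.ball_mem_nhds x hr) (isOpen_interior.mem_nhds hx)
  obtain ⟨ε, hε, hball⟩ := Metric.mem_nhds_iff.mp hN
  obtain ⟨y, hyx, hy⟩ := hlt ε hε
  have hyb := hball (Metric.mem_ball.mpr hyx)
  obtain ⟨z, ⟨hz1, hz2⟩, hzG⟩ := mem_closure_iff.mp (interior_subset hyb.2) _
    (ho.inter Metric.isOpen_ball) ⟨hy, hyb.1⟩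
  exact lt_asymm ((hc z hz2).mp hzG) hz1

/-- In a chart the boundary is part of the graph of `g` over the hyperplane orthogonal to `e`. The
graph map is (1 + L)-Lipschitz, the projection does not increase distances, and the Hausdorff
measure of the hyperplane is a Haar measure, so balls scale with the power d - 1. -/
lemma surface_chart_le (hG : IsOpen G) (hd : 1 ≤ d) {x e : Space d} (he : ‖e‖ = 1) {r : ℝ}
    {g : Space d → ℝ} {L : ℝ≥0} (hg : LipschitzWith L g) (hc : IsChart G x e r g) :
    ∃ C : ℝ≥0∞, C ≠ ⊤ ∧ ∀ (y : Space d) (ρ : ℝ), 0 ≤ ρ →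
      surface d (frontier G ∩ Metric.ball x r ∩ Metric.closedBall y ρ) ≤
        C * ENNReal.ofReal (ρ ^ (d - 1)) := by
  obtain ⟨n, rfl⟩ : ∃ n, d = n + 1 := ⟨d - 1, by omega⟩
  have : Fact (Module.finrank ℝ (Space (n + 1)) = n + 1) := ⟨by simp⟩
  have he0 : e ≠ 0 := by rintro rfl; simp at he
  let H := (ℝ ∙ e)ᗮ
  have hH : Module.finrank ℝ H = n := Submodule.finrank_orthogonal_span_singleton he0
  let Ψ : H → Space (n + 1) := fun h => (h : Space (n + 1)) + g h • e
  have hΨ : LipschitzWith (1 + L) Ψ := by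
    refine LipschitzWith.add ?_ ?_
    · exact LipschitzWith.subtype_val _
    · refine LipschitzWith.of_dist_le_mul fun a b => ?_
      rw [dist_eq_norm, ← sub_smul, norm_smul, he, mul_one, ← dist_eq_norm]
      exact hg.dist_le_mul a b
  let pr : Space (n + 1) → H := fun y => ⟨y - inner ℝ e y • e, by
    rw [Submodule.mem_orthogonal_singleton_iff_inner_right, inner_sub_right, inner_smul_right,
      real_inner_self_eq_norm_sq, he]
    ring⟩
  have hpr : ∀ y z, dist (pr y) (pr z) ≤ dist y z := by
    intro y z
    rw [Subtype.dist_eq, dist_eq_norm, dist_eq_norm]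
    have e1 : (pr y : Space (n + 1)) - pr z = (y - z) - inner ℝ e (y - z) • e := by
      simp only [pr, inner_sub_right, sub_smul]; abel
    rw [e1]
    refine le_of_sq_le_sq ?_ (norm_nonneg _)
    rw [norm_sub_sq_real, inner_smul_right, norm_smul, he, real_inner_comm e, mul_one,
      Real.norm_eq_abs, sq_abs]
    nlinarith [sq_nonneg (inner ℝ e (y - z) : ℝ)]
  let μ : Measure H := Measure.euclideanHausdorffMeasure n
  have hμ : μ.IsAddHaarMeasure := by
    have := isAddHaarMeasure_euclideanHausdorffMeasure (E := H)
    rw [hH] at this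
    exact this
  refine ⟨((1 + L : ℝ≥0) : ℝ≥0∞) ^ n * μ (Metric.ball 0 1),
    ENNReal.mul_ne_top (ENNReal.pow_ne_top ENNReal.coe_ne_top) measure_ball_lt_top.ne,
    fun y ρ hρ => ?_⟩
  have hsub : frontier G ∩ Metric.ball x r ∩ Metric.closedBall y ρ ⊆
      Ψ '' Metric.closedBall (pr y) ρ := by
    rintro z ⟨⟨hz, hzr⟩, hzρ⟩
    refine ⟨pr z, Metric.mem_closedBall.mpr ((hpr z y).trans hzρ), ?_⟩
    have := frontier_chart hG hg hc hz hzr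
    simp only [Ψ, pr]
    rw [this]
    abel
  change Measure.euclideanHausdorffMeasure n _ ≤ _
  refine (measure_mono hsub).trans ?_
  refine (euclideanHausdorffMeasure_image_le hΨ.lipschitzOnWith n).trans ?_
  rw [mul_assoc]
  gcongr
  change μ _ ≤ _
  rw [Measure.addHaar_closedBall μ _ hρ, hH, mul_comm]
  rfl

/-- Upper Ahlfors regularity of the boundary of a Lipschitz domain. -/
lemma surface_frontier_le (hG : IsLipschitzDomain G) (hd : 1 ≤ d) :
    ∃ C : ℝ≥0∞, C ≠ ⊤ ∧ ∀ (y : Space d) (ρ : ℝ), 0 ≤ ρ →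
      surface d (frontier G ∩ Metric.closedBall y ρ) ≤ C * ENNReal.ofReal (ρ ^ (d - 1)) := by
  have hcomp : IsCompact (frontier G) :=
    Metric.isCompact_of_isClosed_isBounded isClosed_frontier
      (hG.2.1.closure.subset frontier_subset_closure)
  choose! e he r hr L g hg hc using hG.2.2
  obtain ⟨t, ht, hcov⟩ := hcomp.elim_nhds_subcover (fun x => Metric.ball x (r x))
    (fun x hx => Metric.ball_mem_nhds x (hr x hx))
  have hex : ∀ x ∈ frontier G, ∃ C : ℝ≥0∞, C ≠ ⊤ ∧ ∀ (y : Space d) (ρ : ℝ), 0 ≤ ρ →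
      surface d (frontier G ∩ Metric.ball x (r x) ∩ Metric.closedBall y ρ) ≤
        C * ENNReal.ofReal (ρ ^ (d - 1)) := fun x hx =>
    surface_chart_le hG.1 hd (he x hx) (hg x hx) (hc x hx)
  choose! C hC hCb using hex
  refine ⟨∑ x ∈ t, C x, ENNReal.sum_ne_top.mpr fun x hx => hC x (ht x hx), fun y ρ hρ => ?_⟩
  have hsub : frontier G ∩ Metric.closedBall y ρ ⊆
      ⋃ x ∈ t, frontier G ∩ Metric.ball x (r x) ∩ Metric.closedBall y ρ := by
    rintro z ⟨hz, hzρ⟩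
    obtain ⟨x, hx, hzx⟩ := mem_iUnion₂.mp (hcov hz)
    exact mem_iUnion₂.mpr ⟨x, hx, ⟨hz, hzx⟩, hzρ⟩
  refine (measure_mono hsub).trans ((measure_biUnion_finset_le _ _).trans ?_)
  rw [Finset.sum_mul]
  exact Finset.sum_le_sum fun x hx => hCb x (ht x hx) y ρ hρ

lemma surface_frontier_lt_top (hG : IsLipschitzDomain G) (hd : 1 ≤ d) :
    surface d (frontier G) < ⊤ := by
  obtain ⟨C, hC, h⟩ := surface_frontier_le hG hd
  obtain ⟨ρ, hρ⟩ := (hG.2.1.closure.subset frontier_subset_closure).subset_closedBall 0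
  have h1 := h 0 (max ρ 0) (le_max_right _ _)
  rw [inter_eq_left.mpr (hρ.trans (Metric.closedBall_subset_closedBall (le_max_left _ _)))] at h1
  exact h1.trans_lt (ENNReal.mul_lt_top hC.lt_top ENNReal.ofReal_lt_top)

/-- Weakly singular integrals over the boundary of a Lipschitz domain are bounded. -/
lemma lintegral_singular_le (hG : IsLipschitzDomain G) (hd : 2 ≤ d) :
    ∃ C : ℝ≥0∞, C ≠ ⊤ ∧ ∀ x ∈ frontier G,
      ∫⁻ y in frontier G, ENNReal.ofReal (dist x y ^ 2 / dist x y ^ d) ∂(surface d) ≤ C := by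
  obtain ⟨n, rfl⟩ : ∃ n, d = n + 2 := ⟨d - 2, by omega⟩
  obtain ⟨C, hC, h⟩ := surface_frontier_le hG (by omega)
  obtain ⟨D, hD0, hD⟩ : ∃ D : ℝ, 0 < D ∧ ∀ x ∈ frontier G, ∀ y ∈ frontier G, dist x y ≤ D := by
    have hb : Bornology.IsBounded (frontier G) := hG.2.1.closure.subset frontier_subset_closure
    refine ⟨Metric.diam (frontier G) + 1, by have := Metric.diam_nonneg (s := frontier G); linarith,
      fun x hx y hy => (Metric.dist_le_diam_of_mem hb hx hy).trans (by linarith)⟩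
  set q : ℝ := 1 / 2 with hq
  -- Dyadic shells: for D q^(k+1) < |x - y| ≤ D q^k the integrand |x - y|^(-n) is at most `a k`. The
  -- ball of radius D q^k has surface at most C (D q^k)^(n+1), so the k-th term is at most C D 2^n
  -- q^k, a geometric series.
  let a : ℕ → ℝ := fun k => ((D * q ^ (k + 1)) ^ n)⁻¹
  have ha : ∀ k, 0 ≤ a k := fun k => by positivity
  refine ⟨C * ENNReal.ofReal (D * 2 ^ n * 2), ENNReal.mul_ne_top hC ENNReal.ofReal_ne_top,
    fun x hx => ?_⟩
  have hpt : ∀ y ∈ frontier G, ENNReal.ofReal (dist x y ^ 2 / dist x y ^ (n + 2)) ≤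
      ∑' k, (Metric.closedBall x (D * q ^ k)).indicator (fun _ => ENNReal.ofReal (a k)) y := by
    intro y hy
    -- On the diagonal the integrand is 0 / 0 = 0.
    by_cases hxy : dist x y = 0
    · rw [hxy]; simp
    have hpos : 0 < dist x y := lt_of_le_of_ne dist_nonneg (Ne.symm hxy)
    obtain ⟨k, hk1, hk2⟩ := exists_nat_pow_near_of_lt_one (x := dist x y / D) (y := q)
      (by positivity) ((div_le_one hD0).mpr (hD x hx y hy)) (by norm_num [hq]) (by norm_num [hq])
    rw [lt_div_iff₀ hD0] at hk1
    rw [div_le_iff₀ hD0] at hk2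
    refine le_trans ?_ (ENNReal.le_tsum k)
    rw [indicator_of_mem (by rw [Metric.mem_closedBall, dist_comm]; linarith)]
    apply ENNReal.ofReal_le_ofReal
    have e1 : dist x y ^ 2 / dist x y ^ (n + 2) = (dist x y ^ n)⁻¹ := by
      rw [pow_add]; field_simp
    rw [e1]
    have hq0 : 0 < D * q ^ (k + 1) := by positivity
    apply inv_anti₀ (by positivity)
    gcongr
    linarith
  calc ∫⁻ y in frontier G, ENNReal.ofReal (dist x y ^ 2 / dist x y ^ (n + 2)) ∂(surface (n + 2))
      ≤ ∫⁻ y in frontier G, ∑' k, (Metric.closedBall x (D * q ^ k)).indicator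
          (fun _ => ENNReal.ofReal (a k)) y ∂(surface (n + 2)) :=
        setLIntegral_mono' isClosed_frontier.measurableSet hpt
    _ = ∑' k, ∫⁻ y in frontier G, (Metric.closedBall x (D * q ^ k)).indicator
          (fun _ => ENNReal.ofReal (a k)) y ∂(surface (n + 2)) :=
        lintegral_tsum fun k =>
          (measurable_const.indicator Metric.isClosed_closedBall.measurableSet).aemeasurable
    _ ≤ ∑' k, C * ENNReal.ofReal (D * 2 ^ n * q ^ k) := by
        refine ENNReal.tsum_le_tsum fun k => ?_
        rw [lintegral_indicator_const Metric.isClosed_closedBall.measurableSet,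
          Measure.restrict_apply Metric.isClosed_closedBall.measurableSet, inter_comm]
        refine (mul_le_mul_right (h x (D * q ^ k) (by positivity)) _).trans (le_of_eq ?_)
        rw [mul_left_comm, ← ENNReal.ofReal_mul (ha k)]
        congr 2
        simp only [a]
        have : n + 2 - 1 = n + 1 := rfl
        rw [this, pow_succ q k, mul_pow, mul_pow, mul_pow, pow_succ D, pow_succ (q ^ k)]
        have hqn : (2 : ℝ) ^ n * q ^ n = 1 := by rw [← mul_pow, hq]; norm_num
        have hqn0 : q ^ n ≠ 0 := by positivity
        have : (2 : ℝ) ^ n = (q ^ n)⁻¹ := eq_inv_of_mul_eq_one_left hqn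
        rw [this]
        field_simp
    _ = C * ENNReal.ofReal (D * 2 ^ n * 2) := by
        rw [ENNReal.tsum_mul_left, ← ENNReal.ofReal_tsum_of_nonneg (fun k => by positivity)
          ((summable_geometric_of_lt_one (by norm_num [hq]) (by norm_num [hq])).mul_left _),
          tsum_mul_left, hq, tsum_geometric_two]

/-- The surface measure of a nonempty open part of a Lipschitz manifold is positive. -/
lemma surface_pos_of_manifold {S : Set (Space d)} (hS : IsLipschitzManifold (d - 1) S)
    {x : Space d} (hx : x ∈ S) {V : Set (Space d)} (hV : IsOpen V) (hxV : x ∈ V) :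
    0 < surface d (S ∩ V) := by
  obtain ⟨U, hU, hxU, O, Φ, L, hO, hΦ, hlip, hanti⟩ := hS x hx
  obtain ⟨a, haO, hax⟩ : x ∈ Φ '' O := by rw [hΦ]; exact ⟨hx, hxU⟩
  set O' := O ∩ Φ ⁻¹' V
  have hO' : IsOpen O' := hlip.continuousOn.isOpen_inter_preimage hO hV
  have haO' : a ∈ O' := ⟨haO, by rw [mem_preimage, hax]; exact hxV⟩
  have hinj : InjOn Φ O := fun p hp q hq hpq => by
    have := hanti p hp q hq
    rw [hpq, dist_self, mul_zero] at this
    exact dist_le_zero.mp this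
  have hpos : 0 < (Measure.euclideanHausdorffMeasure (d - 1) : Measure (Space (d - 1))) O' := by
    rw [EuclideanSpace.euclideanHausdorffMeasure_eq_volume]
    exact hO'.measure_pos volume ⟨a, haO'⟩
  have hne : Nonempty (Space (d - 1)) := ⟨a⟩
  have himg : Function.invFunOn Φ O '' (Φ '' O') = O' :=
    (hinj.leftInvOn_invFunOn.mono inter_subset_left).image_image
  have hli : LipschitzOnWith L (Function.invFunOn Φ O) (Φ '' O') := by
    refine LipschitzOnWith.of_dist_le_mul ?_
    rintro _ ⟨p, hp, rfl⟩ _ ⟨q, hq, rfl⟩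
    rw [hinj.leftInvOn_invFunOn hp.1, hinj.leftInvOn_invFunOn hq.1]
    exact hanti p hp.1 q hq.1
  -- The inverse chart is Lipschitz and maps the piece of the manifold onto the open set `O'`; a
  -- null piece would force `O'` to be null.
  have hle := euclideanHausdorffMeasure_image_le hli (d - 1)
  rw [himg] at hle
  have hsub : Φ '' O' ⊆ S ∩ V := by
    rintro _ ⟨p, hp, rfl⟩
    have : Φ p ∈ S ∩ U := by rw [← hΦ]; exact ⟨p, hp.1, rfl⟩
    exact ⟨this.1, hp.2⟩
  by_contra h0
  have h0' : surface d (Φ '' O') = 0 :=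
    measure_mono_null hsub ((not_lt.mp h0).antisymm zero_le)
  change Measure.euclideanHausdorffMeasure (d - 1) _ = 0 at h0'
  rw [h0', mul_zero] at hle
  exact hpos.not_ge hle

end Surface

/-! ### Tensor products and their components -/

section Tensor

variable {d : ℕ} (U : Submodule ℝ TimeL2) [FiniteDimensional ℝ U]

/-- The `k`-th function of an orthonormal basis of `U`. -/
def timeBasis (k : Fin (Module.finrank ℝ U)) : TimeL2 := (stdOrthonormalBasis ℝ U k : U)

lemma timeBasis_mem (k : Fin (Module.finrank ℝ U)) : timeBasis U k ∈ U :=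
  (stdOrthonormalBasis ℝ U k).2

lemma inner_timeBasis (k l : Fin (Module.finrank ℝ U)) :
    inner ℝ (timeBasis U k) (timeBasis U l) = if k = l then (1 : ℝ) else 0 := by
  have := (orthonormal_iff_ite.mp (stdOrthonormalBasis ℝ U).orthonormal) k l
  exact this

lemma sum_timeBasis {v : TimeL2} (hv : v ∈ U) :
    ∑ k, (inner ℝ (timeBasis U k) v : ℝ) • timeBasis U k = v := by
  have h := (stdOrthonormalBasis ℝ U).sum_repr' ⟨v, hv⟩
  have h' := congrArg (Subtype.val) h
  simpa [timeBasis] using h'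

/-- The components of a function with respect to the orthonormal basis of `U`. -/
def component (u : Space d → TimeL2) (k : Fin (Module.finrank ℝ U)) : Space d → ℝ :=
  fun x => inner ℝ (timeBasis U k) (u x)

variable {U} {V : Submodule ℝ (Space d → ℝ)} {u v : Space d → TimeL2}

/-- Membership is tested on coefficients in an orthonormal basis of `U`, which reduces questions on
`TimeL2`-valued functions to scalar ones. -/
lemma mem_tensor : u ∈ tensor U V ↔ (∀ x, u x ∈ U) ∧ ∀ k, component U u k ∈ V := by
  constructor
  · intro hu
    induction hu using Submodule.span_induction with
    | mem u h =>
      obtain ⟨φ, hφ, ψ, hψ, rfl⟩ := h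
      refine ⟨fun x => U.smul_mem _ hψ, fun k => ?_⟩
      have : component U (fun x => φ x • ψ) k = (inner ℝ (timeBasis U k) ψ : ℝ) • φ := by
        ext x
        simp [component, inner_smul_right, mul_comm]
      rw [this]
      exact V.smul_mem _ hφ
    | zero =>
      refine ⟨fun x => U.zero_mem, fun k => ?_⟩
      have : component U (0 : Space d → TimeL2) k = 0 := by ext x; simp [component]
      rw [this]
      exact V.zero_mem
    | add u v _ _ h1 h2 =>
      refine ⟨fun x => U.add_mem (h1.1 x) (h2.1 x), fun k => ?_⟩
      have : component U (u + v) k = component U u k + component U v k := by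
        ext x; simp [component, inner_add_right]
      rw [this]
      exact V.add_mem (h1.2 k) (h2.2 k)
    | smul c u _ h1 =>
      refine ⟨fun x => U.smul_mem _ (h1.1 x), fun k => ?_⟩
      have : component U (c • u) k = c • component U u k := by
        ext x; simp [component, inner_smul_right]
      rw [this]
      exact V.smul_mem _ (h1.2 k)
  · rintro ⟨h1, h2⟩
    have : u = ∑ k, fun x => component U u k x • timeBasis U k := by
      ext1 x
      rw [Finset.sum_apply]
      exact (sum_timeBasis U (h1 x)).symm
    rw [this]
    exact Submodule.sum_mem _ fun k _ =>
      Submodule.subset_span ⟨_, h2 k, _, timeBasis_mem U k, rfl⟩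

lemma tensor_apply (hu : u ∈ tensor U V) (x : Space d) :
    u x = ∑ k, component U u k x • timeBasis U k :=
  (sum_timeBasis U ((mem_tensor.mp hu).1 x)).symm

lemma tensor_eq_zero_iff (hu : u ∈ tensor U V) {x : Space d} :
    u x = 0 ↔ ∀ k, component U u k x = 0 := by
  constructor
  · intro h k; simp [component, h]
  · intro h
    rw [tensor_apply hu x]
    simp [h]

lemma finiteDimensional_tensor [FiniteDimensional ℝ V] : FiniteDimensional ℝ (tensor U V) := by
  let e : tensor U V →ₗ[ℝ] (Fin (Module.finrank ℝ U) → V) :=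
    { toFun := fun u k => ⟨component U u k, (mem_tensor.mp u.2).2 k⟩
      map_add' := fun u v => by
        ext k x
        simp [component, inner_add_right]
      map_smul' := fun c u => by
        ext k x
        simp [component, inner_smul_right] }
  apply FiniteDimensional.of_injective e
  rw [← LinearMap.ker_eq_bot, LinearMap.ker_eq_bot']
  intro u hu
  ext1
  ext1 x
  refine (tensor_eq_zero_iff u.2).mpr fun k => ?_
  have := congrArg Subtype.val (congrFun hu k)
  exact congrFun this x

end Tensor

/-! ### Meshed domains -/

/-- A bounded open set whose closure is triangulated by a subset of the finite complex `K`. -/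
structure IsMeshed {d : ℕ} (K : Geometry.SimplicialComplex ℝ (Space d)) (G : Set (Space d)) :
    Prop where
  isOpen : IsOpen G
  isBounded : Bornology.IsBounded G
  finite : K.faces.Finite
  resolved : IsResolved K (closure G)

section Meshed

variable {d : ℕ} {K : Geometry.SimplicialComplex ℝ (Space d)} {G B : Set (Space d)}
  {U : Submodule ℝ TimeL2} [FiniteDimensional ℝ U] {u v w : Space d → TimeL2}

lemma IsMeshed.ae_regular (hM : IsMeshed K G) :
    ∀ᵐ x ∂(volume.restrict G), x ∈ regularSet K (closure G) := by
  rw [ae_restrict_iff' hM.isOpen.measurableSet]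
  filter_upwards [ae_mem_regularSet hM.finite hM.resolved] with x hx hxG
  exact hx (subset_closure hxG)

lemma IsMeshed.isFiniteMeasure (hM : IsMeshed K G) : IsFiniteMeasure (volume.restrict G) :=
  ⟨by rw [Measure.restrict_apply_univ]; exact hM.isBounded.measure_lt_top⟩

lemma tensor_hasFDerivAt (hu : u ∈ tensor U (plSpace K (closure G) B)) {x : Space d}
    (hx : x ∈ regularSet K (closure G)) :
    HasFDerivAt u (∑ k, (fderiv ℝ (component U u k) x).smulRight (timeBasis U k)) x := by
  have h : u = fun y => ∑ k, component U u k y • timeBasis U k := funext (tensor_apply hu)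
  have h1 : HasFDerivAt (fun y => ∑ k, component U u k y • timeBasis U k)
      (∑ k, (fderiv ℝ (component U u k) x).smulRight (timeBasis U k)) x :=
    HasFDerivAt.fun_sum fun k _ =>
      ((pl_differentiableAt ((mem_tensor.mp hu).2 k) hx).hasFDerivAt).smul_const _
  rwa [← h] at h1

/-- The `j`-th partial derivative of the `k`-th component. -/
def gradComp (U : Submodule ℝ TimeL2) [FiniteDimensional ℝ U] (u : Space d → TimeL2) (j : Fin d)
    (k : Fin (Module.finrank ℝ U)) (x : Space d) : ℝ :=
  fderiv ℝ (component U u k) x (EuclideanSpace.single j 1)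

lemma measurable_gradComp (u : Space d → TimeL2) (j : Fin d) (k : Fin (Module.finrank ℝ U)) :
    Measurable (gradComp U u j k) := measurable_fderiv_apply_const ℝ _ _

lemma partialDeriv_eq (hu : u ∈ tensor U (plSpace K (closure G) B)) {x : Space d}
    (hx : x ∈ regularSet K (closure G)) (j : Fin d) :
    partialDeriv u j x = ∑ k, gradComp U u j k x • timeBasis U k := by
  rw [partialDeriv, (tensor_hasFDerivAt hu hx).fderiv]
  simp [gradComp]

lemma partialDeriv_mem (hu : u ∈ tensor U (plSpace K (closure G) B)) {x : Space d}
    (hx : x ∈ regularSet K (closure G)) (j : Fin d) : partialDeriv u j x ∈ U := by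
  rw [partialDeriv_eq hu hx]
  exact Submodule.sum_mem _ fun k _ => U.smul_mem _ (timeBasis_mem U k)

lemma partialDeriv_add (hu : u ∈ tensor U (plSpace K (closure G) B))
    (hv : v ∈ tensor U (plSpace K (closure G) B)) {x : Space d}
    (hx : x ∈ regularSet K (closure G)) (j : Fin d) :
    partialDeriv (u + v) j x = partialDeriv u j x + partialDeriv v j x := by
  have h := (tensor_hasFDerivAt hu hx).add (tensor_hasFDerivAt hv hx)
  rw [partialDeriv, partialDeriv, partialDeriv, h.fderiv, (tensor_hasFDerivAt hu hx).fderiv,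
    (tensor_hasFDerivAt hv hx).fderiv]
  rfl

lemma partialDeriv_sub (hu : u ∈ tensor U (plSpace K (closure G) B))
    (hv : v ∈ tensor U (plSpace K (closure G) B)) {x : Space d}
    (hx : x ∈ regularSet K (closure G)) (j : Fin d) :
    partialDeriv (u - v) j x = partialDeriv u j x - partialDeriv v j x := by
  have h := (tensor_hasFDerivAt hu hx).sub (tensor_hasFDerivAt hv hx)
  rw [partialDeriv, partialDeriv, partialDeriv, h.fderiv, (tensor_hasFDerivAt hu hx).fderiv,
    (tensor_hasFDerivAt hv hx).fderiv]
  rfl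

lemma partialDeriv_smul (hu : u ∈ tensor U (plSpace K (closure G) B)) {x : Space d}
    (hx : x ∈ regularSet K (closure G)) (j : Fin d) (c : ℝ) :
    partialDeriv (c • u) j x = c • partialDeriv u j x := by
  have h := (tensor_hasFDerivAt hu hx).const_smul c
  rw [partialDeriv, partialDeriv, h.fderiv, (tensor_hasFDerivAt hu hx).fderiv]
  rfl

lemma exists_partialDeriv_bound (hM : IsMeshed K G)
    (hu : u ∈ tensor U (plSpace K (closure G) B)) :
    ∃ M, ∀ x ∈ regularSet K (closure G), ∀ j, ‖partialDeriv u j x‖ ≤ M := by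
  choose M hb using fun k => pl_fderiv_bound hM.finite ((mem_tensor.mp hu).2 k)
  refine ⟨∑ k, M k * ‖timeBasis U k‖, fun x hx j => ?_⟩
  rw [partialDeriv_eq hu hx]
  refine (norm_sum_le _ _).trans (Finset.sum_le_sum fun k _ => ?_)
  rw [norm_smul]
  refine mul_le_mul_of_nonneg_right ?_ (norm_nonneg _)
  refine ((fderiv ℝ (component U u k) x).le_opNorm _).trans ?_
  simpa using hb k x hx

lemma exists_norm_bound (hM : IsMeshed K G) (hu : u ∈ tensor U (plSpace K (closure G) B)) :
    ∃ M, ∀ x, ‖u x‖ ≤ M := by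
  choose M hb using fun k => pl_bounded hM.finite hM.resolved ((mem_tensor.mp hu).2 k)
  refine ⟨∑ k, M k * ‖timeBasis U k‖, fun x => ?_⟩
  rw [tensor_apply hu]
  refine (norm_sum_le _ _).trans (Finset.sum_le_sum fun k _ => ?_)
  rw [norm_smul]
  exact mul_le_mul_of_nonneg_right (hb k x) (norm_nonneg _)

lemma measurable_pl (hM : IsMeshed K G) {φ : Space d → ℝ} (hφ : φ ∈ plSpace K (closure G) B) :
    Measurable φ := by
  classical
  obtain ⟨L, hL⟩ := pl_lipschitz hM.finite hM.resolved hφ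
  have h : φ = (closure G).piecewise φ (fun _ => 0) := by
    ext x
    by_cases hx : x ∈ closure G
    · simp [hx]
    · simp [hx, hφ.2.1 x hx]
  rw [h]
  exact hL.continuousOn.measurable_piecewise continuousOn_const isClosed_closure.measurableSet

lemma tensor_lipschitz (hM : IsMeshed K G) (hu : u ∈ tensor U (plSpace K (closure G) B)) :
    ∃ L : ℝ≥0, LipschitzOnWith L u (closure G) := by
  choose L hL using fun k => pl_lipschitz hM.finite hM.resolved ((mem_tensor.mp hu).2 k)
  refine ⟨∑ k, L k * ‖timeBasis U k‖₊, LipschitzOnWith.of_dist_le_mul fun x hx y hy => ?_⟩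
  rw [dist_eq_norm, tensor_apply hu x, tensor_apply hu y, ← Finset.sum_sub_distrib]
  refine (norm_sum_le _ _).trans ?_
  push_cast
  rw [Finset.sum_mul]
  refine Finset.sum_le_sum fun k _ => ?_
  rw [← sub_smul, norm_smul, mul_right_comm]
  refine mul_le_mul_of_nonneg_right ?_ (norm_nonneg _)
  rw [← dist_eq_norm]
  exact (hL k).dist_le_mul x hx y hy

/-- Orthonormality of the basis in time removes the mixed products. The right-hand side is
measurable in `x` without exception. -/
lemma sum_inner_partialDeriv (hu : u ∈ tensor U (plSpace K (closure G) B))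
    (hv : v ∈ tensor U (plSpace K (closure G) B)) {x : Space d}
    (hx : x ∈ regularSet K (closure G)) :
    ∑ j, inner ℝ (partialDeriv u j x) (partialDeriv v j x) =
      ∑ j, ∑ k, gradComp U u j k x * gradComp U v j k x := by
  refine Finset.sum_congr rfl fun j _ => ?_
  rw [partialDeriv_eq hu hx, partialDeriv_eq hv hx, sum_inner]
  refine Finset.sum_congr rfl fun k _ => ?_
  rw [inner_sum]
  simp [inner_smul_left, inner_smul_right, inner_timeBasis, mul_comm]

lemma integrable_sum_inner_partialDeriv (hM : IsMeshed K G)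
    (hu : u ∈ tensor U (plSpace K (closure G) B)) (hv : v ∈ tensor U (plSpace K (closure G) B)) :
    IntegrableOn (fun x => ∑ j, (inner ℝ (partialDeriv u j x) (partialDeriv v j x) : ℝ)) G := by
  have := hM.isFiniteMeasure
  obtain ⟨M, hb⟩ := exists_partialDeriv_bound hM hu
  obtain ⟨M', hb'⟩ := exists_partialDeriv_bound hM hv
  refine Integrable.of_bound (C := ∑ _ : Fin d, M * M') ?_ ?_
  · have hmeas : Measurable fun x => ∑ j, ∑ k, gradComp U u j k x * gradComp U v j k x :=
      Finset.measurable_sum _ fun j _ => Finset.measurable_sum _ fun k _ =>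
        (measurable_gradComp u j k).mul (measurable_gradComp v j k)
    refine hmeas.aestronglyMeasurable.congr ?_
    filter_upwards [hM.ae_regular] with x hx
    exact (sum_inner_partialDeriv hu hv hx).symm
  · filter_upwards [hM.ae_regular] with x hx
    refine (norm_sum_le _ _).trans (Finset.sum_le_sum fun j _ => ?_)
    refine (norm_inner_le_norm _ _).trans ?_
    exact mul_le_mul (hb x hx j) (hb' x hx j) (norm_nonneg _)
      ((norm_nonneg _).trans (hb x hx j))

/-- The Dirichlet form as a bilinear form on the discrete space. -/
def gradBilin (hM : IsMeshed K G) (U : Submodule ℝ TimeL2) [FiniteDimensional ℝ U]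
    (B : Set (Space d)) : LinearMap.BilinForm ℝ (tensor U (plSpace K (closure G) B)) :=
  LinearMap.mk₂ ℝ (fun u v => gradForm G u v)
    (fun u u' v => by
      rw [gradForm, gradForm, gradForm, ← integral_add
        (integrable_sum_inner_partialDeriv hM u.2 v.2)
        (integrable_sum_inner_partialDeriv hM u'.2 v.2)]
      apply integral_congr_ae
      filter_upwards [hM.ae_regular] with x hx
      rw [← Finset.sum_add_distrib]
      refine Finset.sum_congr rfl fun j _ => ?_
      rw [Submodule.coe_add, partialDeriv_add u.2 u'.2 hx, inner_add_left])
    (fun c u v => by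
      rw [gradForm, gradForm, smul_eq_mul, ← integral_const_mul]
      apply integral_congr_ae
      filter_upwards [hM.ae_regular] with x hx
      rw [Finset.mul_sum]
      refine Finset.sum_congr rfl fun j _ => ?_
      rw [Submodule.coe_smul, partialDeriv_smul u.2 hx, real_inner_smul_left])
    (fun u v v' => by
      rw [gradForm, gradForm, gradForm, ← integral_add
        (integrable_sum_inner_partialDeriv hM u.2 v.2)
        (integrable_sum_inner_partialDeriv hM u.2 v'.2)]
      apply integral_congr_ae
      filter_upwards [hM.ae_regular] with x hx
      rw [← Finset.sum_add_distrib]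
      refine Finset.sum_congr rfl fun j _ => ?_
      rw [Submodule.coe_add, partialDeriv_add v.2 v'.2 hx, inner_add_right])
    (fun c u v => by
      rw [gradForm, gradForm, smul_eq_mul, ← integral_const_mul]
      apply integral_congr_ae
      filter_upwards [hM.ae_regular] with x hx
      rw [Finset.mul_sum]
      refine Finset.sum_congr rfl fun j _ => ?_
      rw [Submodule.coe_smul, partialDeriv_smul v.2 hx, real_inner_smul_right])

lemma gradBilin_apply (hM : IsMeshed K G) (u v : tensor U (plSpace K (closure G) B)) :
    gradBilin hM U B u v = gradForm G u v := rfl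

lemma clm_eq_zero_of_single {A : Space d →L[ℝ] ℝ}
    (h : ∀ j, A (EuclideanSpace.single j 1) = 0) : A = 0 := by
  apply ContinuousLinearMap.coe_injective
  refine (EuclideanSpace.basisFun (Fin d) ℝ).toBasis.ext fun j => ?_
  simpa using h j

/-- The discrete Poincaré inequality: the Dirichlet form is positive definite if every component
of the domain reaches the part of the boundary where the functions vanish. -/
lemma isInner_gradBilin (hM : IsMeshed K G)
    (hB : ∀ x ∈ G, (closure (connectedComponentIn G x) ∩ B).Nonempty) :
    IsInner (gradBilin hM U B) where
  symm u v := by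
    rw [gradBilin_apply, gradBilin_apply, gradForm, gradForm]
    simp_rw [real_inner_comm]
  pos u hu := by
    rw [gradBilin_apply]
    have hnn : 0 ≤ gradForm G u u := integral_nonneg fun x =>
      Finset.sum_nonneg fun j _ => real_inner_self_nonneg
    -- A vanishing Dirichlet integral makes the gradient of every component zero almost everywhere,
    -- and `pl_eq_zero` applies to each.
    refine lt_of_le_of_ne hnn fun h0 => hu ?_
    have h1 := (setIntegral_eq_zero_iff_of_nonneg_ae (.of_forall fun x =>
      Finset.sum_nonneg fun j _ => real_inner_self_nonneg)
      (integrable_sum_inner_partialDeriv hM u.2 u.2)).mp h0.symm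
    have hcomp : ∀ k, component U (u : Space d → TimeL2) k = 0 := by
      intro k
      refine pl_eq_zero hM.isOpen hM.finite hM.resolved hB ((mem_tensor.mp u.2).2 k) ?_
      filter_upwards [h1, hM.ae_regular] with x hx hxr
      rw [Pi.zero_apply, sum_inner_partialDeriv u.2 u.2 hxr] at hx
      apply clm_eq_zero_of_single
      intro j
      have h2 := (Finset.sum_eq_zero_iff_of_nonneg fun j _ =>
        Finset.sum_nonneg fun k _ => mul_self_nonneg _).mp hx j (Finset.mem_univ _)
      have h3 := (Finset.sum_eq_zero_iff_of_nonneg fun k _ => mul_self_nonneg _).mp h2 k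
        (Finset.mem_univ _)
      exact mul_self_eq_zero.mp h3
    ext1
    ext1 x
    exact (tensor_eq_zero_iff u.2).mpr fun k => congrFun (hcomp k) x

end Meshed

/-! ### Superposition operators in time -/

section Superposition

variable {d : ℕ}

/-- The vector-valued function of time with the components `z j`. -/
def timeVec (z : Fin d → TimeL2) (t : ℝ) : Space d := WithLp.toLp 2 fun j => z j t

lemma norm_timeVec_le (z : Fin d → TimeL2) (t : ℝ) : ‖timeVec z t‖ ≤ ∑ j, |z j t| := by
  rw [EuclideanSpace.norm_eq]
  refine Real.sqrt_le_iff.mpr ⟨Finset.sum_nonneg fun j _ => abs_nonneg _, ?_⟩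
  exact Finset.sum_sq_le_sq_sum_of_nonneg fun j _ => abs_nonneg _

lemma timeVec_sub (z z' : Fin d → TimeL2) :
    ∀ᵐ t : ℝ, timeVec (z - z') t = timeVec z t - timeVec z' t := by
  have h : ∀ᵐ t : ℝ, ∀ j, (z j - z' j : TimeL2) t = z j t - z' j t := by
    rw [ae_all_iff]
    intro j
    filter_upwards [Lp.coeFn_sub (z j) (z' j)] with t ht
    rw [ht, Pi.sub_apply]
  filter_upwards [h] with t ht
  ext j
  exact ht j

lemma aemeasurable_timeVec (z : Fin d → TimeL2) : AEMeasurable (timeVec z) := by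
  refine (WithLp.measurable_toLp 2 (Fin d → ℝ)).comp_aemeasurable ?_
  exact aemeasurable_pi_lambda _ fun j => (Lp.aestronglyMeasurable (z j)).aemeasurable

/-- Lipschitz continuous functions of the value and the gradient that vanish at the origin. -/
structure IsLip {F : Type*} [NormedAddCommGroup F] (f : ℝ → Space d → F) (h : ℝ) : Prop where
  nonneg : 0 ≤ h
  zero : f 0 0 = 0
  lip : ∀ y y' z z', ‖f y z - f y' z'‖ ≤ h * (‖z - z'‖ + |y - y'|)

lemma IsLip.continuous {F : Type*} [NormedAddCommGroup F] {f : ℝ → Space d → F} {h : ℝ}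
    (hf : IsLip f h) : Continuous fun p : ℝ × Space d => f p.1 p.2 := by
  have : LipschitzWith (h.toNNReal * 2) fun p : ℝ × Space d => f p.1 p.2 := by
    refine LipschitzWith.of_dist_le_mul fun p q => ?_
    rw [dist_eq_norm]
    refine (hf.lip _ _ _ _).trans ?_
    have h1 : ‖p.2 - q.2‖ ≤ dist p q := by rw [← dist_eq_norm]; exact le_max_right _ _
    have h2 : |p.1 - q.1| ≤ dist p q := by rw [← Real.dist_eq]; exact le_max_left _ _
    push_cast
    rw [Real.coe_toNNReal h hf.nonneg, mul_assoc]
    exact mul_le_mul_of_nonneg_left (by linarith) hf.nonneg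
  exact this.continuous

lemma IsLip.apply {f : ℝ → Space d → Space d} {h : ℝ} (hf : IsLip f h) (j : Fin d) :
    IsLip (fun y z => f y z j) h where
  nonneg := hf.nonneg
  zero := by simp [hf.zero]
  lip y y' z z' := by
    refine le_trans ?_ (hf.lip y y' z z')
    exact PiLp.norm_apply_le (f y z - f y' z') j

/-- The `L²` function `|y| + ∑ |z j|`. -/
def absSum (y : TimeL2) (z : Fin d → TimeL2) : TimeL2 := |y| + ∑ j, |z j|

lemma coeFn_absSum (y : TimeL2) (z : Fin d → TimeL2) :
    ∀ᵐ t : ℝ, absSum y z t = |y t| + ∑ j, |z j t| := by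
  have h : ∀ᵐ t : ℝ, ∀ j, (|z j| : TimeL2) t = |z j t| :=
    ae_all_iff.mpr fun j => Lp.coeFn_abs (z j)
  filter_upwards [h, Lp.coeFn_abs y, Lp.coeFn_add |y| (∑ j, |z j|),
    Lp.coeFn_finsetSum Finset.univ (fun j => |z j|)] with t h1 h2 h3 h4
  rw [absSum, h3, Pi.add_apply, h2, h4]
  simp [h1]

lemma norm_absSum_le (y : TimeL2) (z : Fin d → TimeL2) : ‖absSum y z‖ ≤ ‖y‖ + ∑ j, ‖z j‖ := by
  refine (norm_add_le _ _).trans ?_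
  rw [norm_abs_eq_norm]
  gcongr
  refine (norm_sum_le _ _).trans (le_of_eq ?_)
  simp [norm_abs_eq_norm]

lemma IsLip.memLp {f : ℝ → Space d → ℝ} {h : ℝ} (hf : IsLip f h) (y : TimeL2)
    (z : Fin d → TimeL2) : MemLp (fun t => f (y t) (timeVec z t)) 2 (volume : Measure ℝ) := by
  refine MemLp.of_le_mul (c := h) (Lp.memLp (absSum y z)) ?_ ?_
  · exact (hf.continuous.measurable.comp_aemeasurable
      ((Lp.aestronglyMeasurable y).aemeasurable.prodMk
        (aemeasurable_timeVec z))).aestronglyMeasurable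
  · filter_upwards [coeFn_absSum y z] with t ht
    rw [ht]
    have h1 := hf.lip (y t) 0 (timeVec z t) 0
    rw [hf.zero, sub_zero, sub_zero, sub_zero] at h1
    refine h1.trans (mul_le_mul_of_nonneg_left (le_trans ?_ (le_abs_self _)) hf.nonneg)
    linarith [norm_timeVec_le z t]

/-- The superposition operator of `f`. -/
def superpos (f : ℝ → Space d → ℝ) (y : TimeL2) (z : Fin d → TimeL2) : TimeL2 := by
  classical
  exact if h : MemLp (fun t => f (y t) (timeVec z t)) 2 (volume : Measure ℝ) then h.toLp _ else 0

lemma IsLip.coeFn_superpos {f : ℝ → Space d → ℝ} {h : ℝ} (hf : IsLip f h) (y : TimeL2)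
    (z : Fin d → TimeL2) : superpos f y z =ᵐ[volume] fun t => f (y t) (timeVec z t) := by
  rw [superpos, dif_pos (hf.memLp y z)]
  exact MemLp.coeFn_toLp _

lemma IsLip.norm_superpos_sub_le {f : ℝ → Space d → ℝ} {h : ℝ} (hf : IsLip f h) (y y' : TimeL2)
    (z z' : Fin d → TimeL2) :
    ‖superpos f y z - superpos f y' z'‖ ≤ h * (‖y - y'‖ + ∑ j, ‖(z - z') j‖) := by
  have h1 : ‖superpos f y z - superpos f y' z'‖ ≤ ‖h • absSum (y - y') (z - z')‖ := by
    apply Lp.norm_le_norm_of_ae_le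
    filter_upwards [Lp.coeFn_sub (superpos f y z) (superpos f y' z'), hf.coeFn_superpos y z,
      hf.coeFn_superpos y' z', Lp.coeFn_smul h (absSum (y - y') (z - z')),
      coeFn_absSum (y - y') (z - z'), Lp.coeFn_sub y y', timeVec_sub z z'] with t h1 h2 h3 h4 h5 h6 h7
    rw [h1, Pi.sub_apply, h2, h3, h4, Pi.smul_apply, h5, smul_eq_mul, norm_mul,
      Real.norm_of_nonneg hf.nonneg]
    refine (hf.lip _ _ _ _).trans (mul_le_mul_of_nonneg_left ?_ hf.nonneg)
    rw [Real.norm_of_nonneg (by positivity), h6, ← h7]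
    have := norm_timeVec_le (z - z') t
    simp only [Pi.sub_apply] at this ⊢
    linarith
  refine h1.trans ?_
  rw [norm_smul, Real.norm_of_nonneg hf.nonneg]
  exact mul_le_mul_of_nonneg_left (norm_absSum_le _ _) hf.nonneg

/-- The pairing `∫ a(y, z) · z' + b(y, z) y' dt`. -/
def pairing (a : ℝ → Space d → Space d) (b : ℝ → Space d → ℝ) (y : TimeL2) (z : Fin d → TimeL2)
    (y' : TimeL2) (z' : Fin d → TimeL2) : ℝ :=
  ∑ j, inner ℝ (superpos (fun r s => a r s j) y z) (z' j) + inner ℝ (superpos b y z) y'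

variable {a : ℝ → Space d → Space d} {b : ℝ → Space d → ℝ} {h : ℝ}

/-- Passage from time integrals of pointwise products to inner products of `TimeL2`, including
integrability. -/
lemma integral_inner_timeVec {w z : Fin d → TimeL2} {p : ℝ → Space d}
    (hp : ∀ j, w j =ᵐ[volume] fun t => p t j) {y y' : TimeL2} {q : ℝ → ℝ} (hq : y =ᵐ[volume] q) :
    Integrable (fun t => inner ℝ (p t) (timeVec z t) + q t * y' t) ∧
    ∫ t, (inner ℝ (p t) (timeVec z t) + q t * y' t) =
      ∑ j, inner ℝ (w j) (z j) + inner ℝ y y' := by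
  have hae : (fun t => ∑ j, (inner ℝ (w j t) (z j t) : ℝ) + inner ℝ (y t) (y' t)) =ᵐ[volume]
      fun t => inner ℝ (p t) (timeVec z t) + q t * y' t := by
    filter_upwards [ae_all_iff.mpr hp, hq] with t h1 h2
    simp only [PiLp.inner_apply, timeVec, h1, h2, RCLike.inner_apply, conj_trivial]
    ring_nf
  have hint : ∀ j, Integrable (fun t => (inner ℝ (w j t) (z j t) : ℝ)) := fun j =>
    L2.integrable_inner (𝕜 := ℝ) (w j) (z j)
  have hint' : Integrable (fun t => (inner ℝ (y t) (y' t) : ℝ)) := L2.integrable_inner (𝕜 := ℝ) y y'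
  have hsum := integrable_finsetSum Finset.univ fun j _ => hint j
  refine ⟨(hsum.add hint').congr hae, ?_⟩
  rw [← integral_congr_ae hae, integral_add hsum hint', integral_finsetSum _ fun j _ => hint j]
  simp_rw [L2.inner_def]

lemma pairing_eq_integral (ha : IsLip a h) (hb : IsLip b h) (y : TimeL2) (z : Fin d → TimeL2)
    (y' : TimeL2) (z' : Fin d → TimeL2) :
    ∫ t, (inner ℝ (a (y t) (timeVec z t)) (timeVec z' t) + b (y t) (timeVec z t) * y' t) =
      pairing a b y z y' z' :=
  (integral_inner_timeVec (fun j => (ha.apply j).coeFn_superpos y z) (hb.coeFn_superpos y z)).2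

lemma pairing_add (y : TimeL2) (z : Fin d → TimeL2) (y₁ y₂ : TimeL2) (z₁ z₂ : Fin d → TimeL2) :
    pairing a b y z (y₁ + y₂) (z₁ + z₂) = pairing a b y z y₁ z₁ + pairing a b y z y₂ z₂ := by
  simp only [pairing, Pi.add_apply, inner_add_right, Finset.sum_add_distrib]
  ring

lemma pairing_smul (y : TimeL2) (z : Fin d → TimeL2) (c : ℝ) (y' : TimeL2) (z' : Fin d → TimeL2) :
    pairing a b y z (c • y') (c • z') = c * pairing a b y z y' z' := by
  simp only [pairing, Pi.smul_apply, inner_smul_right, mul_add, Finset.mul_sum]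

lemma abs_pairing_sub_le (ha : IsLip a h) (hb : IsLip b h) (y y' : TimeL2) (z z' : Fin d → TimeL2)
    (r : TimeL2) (s : Fin d → TimeL2) :
    |pairing a b y z r s - pairing a b y' z' r s| ≤
      h * (‖y - y'‖ + ∑ j, ‖(z - z') j‖) * (‖r‖ + ∑ j, ‖s j‖) := by
  have e : pairing a b y z r s - pairing a b y' z' r s =
      ∑ j, inner ℝ (superpos (fun r s => a r s j) y z - superpos (fun r s => a r s j) y' z') (s j) +
        inner ℝ (superpos b y z - superpos b y' z') r := by
    simp only [pairing, inner_sub_left, Finset.sum_sub_distrib]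
    ring
  rw [e, mul_add, Finset.mul_sum, add_comm]
  refine (abs_add_le _ _).trans (add_le_add ?_ ((Finset.abs_sum_le_sum_abs _ _).trans
    (Finset.sum_le_sum fun j _ => ?_)))
  · exact (abs_real_inner_le_norm _ _).trans
      (mul_le_mul_of_nonneg_right (hb.norm_superpos_sub_le y y' z z') (norm_nonneg _))
  · exact (abs_real_inner_le_norm _ _).trans
      (mul_le_mul_of_nonneg_right ((ha.apply j).norm_superpos_sub_le y y' z z') (norm_nonneg _))

lemma pairing_zero (ha : IsLip a h) (hb : IsLip b h) (r : TimeL2) (s : Fin d → TimeL2) :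
    pairing a b 0 0 r s = 0 := by
  have hz : ∀ᵐ t : ℝ, timeVec (0 : Fin d → TimeL2) t = 0 := by
    filter_upwards [timeVec_sub (0 : Fin d → TimeL2) 0] with t ht
    rwa [sub_self, sub_self] at ht
  have h0 : ∀ {f : ℝ → Space d → ℝ}, IsLip f h → superpos f 0 0 = 0 := by
    intro f hf
    apply Lp.ext
    filter_upwards [hf.coeFn_superpos 0 0, hz, Lp.coeFn_zero ℝ 2 (volume : Measure ℝ)]
      with t h1 h2 h3
    rw [h1, h2, h3, Pi.zero_apply, hf.zero]
  simp [pairing, h0 hb, h0 (ha.apply _)]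

/-- The pointwise bound, integrated in time: both sides are written as integrals by
`integral_inner_timeVec` and compared under the integral sign. -/
lemma le_pairing_sub {m₂ m₃ : ℝ} (ha : IsLip a h) (hb : IsLip b h)
    (hm : ∀ (y y' : ℝ) (z z' : Space d), m₂ * ‖z - z'‖ ^ 2 - m₃ * |y - y'| ^ 2 ≤
      inner ℝ (a y z - a y' z') (z - z') + (b y z - b y' z') * (y - y'))
    (y y' : TimeL2) (z z' : Fin d → TimeL2) :
    m₂ * ∑ j, ‖(z - z') j‖ ^ 2 - m₃ * ‖y - y'‖ ^ 2 ≤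
      pairing a b y z (y - y') (z - z') - pairing a b y' z' (y - y') (z - z') := by
  have e : pairing a b y z (y - y') (z - z') - pairing a b y' z' (y - y') (z - z') =
      ∑ j, inner ℝ (superpos (fun r s => a r s j) y z - superpos (fun r s => a r s j) y' z')
        ((z - z') j) + inner ℝ (superpos b y z - superpos b y' z') (y - y') := by
    simp only [pairing, inner_sub_left, Finset.sum_sub_distrib]
    ring
  obtain ⟨hi1, he1⟩ := integral_inner_timeVec (z := z - z') (y' := y - y')
    (w := fun j => superpos (fun r s => a r s j) y z - superpos (fun r s => a r s j) y' z')
    (p := fun t => a (y t) (timeVec z t) - a (y' t) (timeVec z' t))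
    (y := superpos b y z - superpos b y' z')
    (q := fun t => b (y t) (timeVec z t) - b (y' t) (timeVec z' t))
    (fun j => by
      filter_upwards [Lp.coeFn_sub (superpos (fun r s => a r s j) y z)
        (superpos (fun r s => a r s j) y' z'), (ha.apply j).coeFn_superpos y z,
        (ha.apply j).coeFn_superpos y' z'] with t h1 h2 h3
      rw [h1, Pi.sub_apply, h2, h3, PiLp.sub_apply])
    (by
      filter_upwards [Lp.coeFn_sub (superpos b y z) (superpos b y' z'), hb.coeFn_superpos y z,
        hb.coeFn_superpos y' z'] with t h1 h2 h3
      rw [h1, Pi.sub_apply, h2, h3])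
  obtain ⟨hi2, he2⟩ := integral_inner_timeVec (z := z - z') (y' := y - y')
    (w := fun j => m₂ • (z - z') j) (p := fun t => m₂ • timeVec (z - z') t)
    (y := (-m₃) • (y - y')) (q := fun t => -m₃ * (y - y') t)
    (fun j => by
      filter_upwards [Lp.coeFn_smul m₂ ((z - z') j)] with t h1
      rw [h1]
      rfl)
    (by
      filter_upwards [Lp.coeFn_smul (-m₃) (y - y')] with t h1
      rw [h1]
      rfl)
  rw [e, ← he1]
  have e2 : m₂ * ∑ j, ‖(z - z') j‖ ^ 2 - m₃ * ‖y - y'‖ ^ 2 =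
      ∑ j, inner ℝ (m₂ • (z - z') j) ((z - z') j) + inner ℝ ((-m₃) • (y - y')) (y - y') := by
    simp only [inner_smul_left, real_inner_self_eq_norm_sq, Finset.mul_sum, conj_trivial]
    ring
  rw [e2, ← he2]
  refine integral_mono_ae hi2 hi1 ?_
  filter_upwards [Lp.coeFn_sub y y', timeVec_sub z z'] with t h1 h2
  have := hm (y t) (y' t) (timeVec z t) (timeVec z' t)
  rw [h1, h2, Pi.sub_apply, inner_smul_left, real_inner_self_eq_norm_sq]
  rw [sq_abs] at this
  simp only [conj_trivial]
  linarith

end Superposition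

/-! ### Carathéodory functions -/

/-- A function that is continuous in one variable and measurable in the other is jointly measurable.
The hypotheses hold only up to null sets, so the function is first set to zero on a null set of `x`.
-/
lemma exists_stronglyMeasurable_caratheodory {X Y F : Type*} [MeasurableSpace X]
    [TopologicalSpace Y] [TopologicalSpace.MetrizableSpace Y] [SecondCountableTopology Y]
    [MeasurableSpace Y] [OpensMeasurableSpace Y] [Nonempty Y] [NormedAddCommGroup F]
    [MeasurableSpace F] [BorelSpace F] [SecondCountableTopology F] {μ : Measure X} {f : X → Y → F}
    (hmeas : ∀ p, AEMeasurable (fun x => f x p) μ) (hcont : ∀ᵐ x ∂μ, Continuous (f x)) :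
    ∃ g : X → Y → F, StronglyMeasurable (fun p : Y × X => g p.2 p.1) ∧ ∀ᵐ x ∂μ, g x = f x := by
  classical
  let q := TopologicalSpace.denseSeq Y
  have hgood : ∀ᵐ x ∂μ, Continuous (f x) ∧ ∀ n, f x (q n) = (hmeas (q n)).mk _ x := by
    filter_upwards [hcont, ae_all_iff.mpr fun n => (hmeas (q n)).ae_eq_mk] with x h1 h2
    exact ⟨h1, h2⟩
  -- Only countably many points of `Y` are used, so the exceptional sets add up to a null set; the
  -- other sections are limits along the dense sequence.
  set N := toMeasurable μ {x | ¬(Continuous (f x) ∧ ∀ n, f x (q n) = (hmeas (q n)).mk _ x)}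
  have hN : MeasurableSet N := measurableSet_toMeasurable _ _
  have hN0 : μ N = 0 := by rw [measure_toMeasurable]; exact hgood
  have hNc : ∀ x ∉ N, Continuous (f x) ∧ ∀ n, f x (q n) = (hmeas (q n)).mk _ x := by
    intro x hx
    by_contra h
    exact hx (subset_toMeasurable _ _ h)
  let g : X → Y → F := fun x p => if x ∈ N then 0 else f x p
  refine ⟨g, ?_, ?_⟩
  · have hgc : ∀ x, Continuous (g x) := by
      intro x
      by_cases hx : x ∈ N
      · simp only [g, if_pos hx]; exact continuous_const
      · simp only [g, if_neg hx]; exact (hNc x hx).1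
    have hgq : ∀ n, Measurable fun x => g x (q n) := by
      intro n
      have : (fun x => g x (q n)) = fun x => if x ∈ N then 0 else (hmeas (q n)).mk _ x := by
        ext x
        by_cases hx : x ∈ N
        · simp [g, hx]
        · simp only [g, if_neg hx]; exact (hNc x hx).2 n
      rw [this]
      exact Measurable.ite hN measurable_const (hmeas (q n)).measurable_mk
    have hgm : ∀ p, StronglyMeasurable fun x => g x p := by
      intro p
      obtain ⟨w, hw, hwp⟩ := mem_closure_iff_seq_limit.mp (TopologicalSpace.denseRange_denseSeq Y p)
      choose k hk using hw
      refine (measurable_of_tendsto_metrizable (f := fun n x => g x (w n)) (fun n => ?_) ?_).stronglyMeasurable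
      · rw [← hk n]; exact hgq (k n)
      · rw [tendsto_pi_nhds]
        exact fun x => ((hgc x).tendsto p).comp hwp
    exact stronglyMeasurable_uncurry_of_continuous_of_stronglyMeasurable (u := fun p x => g x p)
      hgc hgm
  · have : ∀ᵐ x ∂μ, x ∉ N := measure_eq_zero_iff_ae_notMem.mp hN0
    filter_upwards [this] with x hx
    ext p
    simp [g, hx]

/-! ### The nonlinear forms on the discrete spaces -/

/-- Assumptions on the nonlinearities on `G` with constant bounds. -/
structure IsCoefficientOn {d : ℕ} (D : Problem d) (G : Set (Space d)) (M m₂ m₃ : ℝ) : Prop where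
  meas_α : ∀ y z, AEMeasurable (fun x => D.α x y z) (volume.restrict G)
  meas_β : ∀ y z, AEMeasurable (fun x => D.β x y z) (volume.restrict G)
  lip : ∀ᵐ x ∂(volume.restrict G), IsLip (D.α x) M ∧ IsLip (D.β x) M
  mono : ∀ᵐ x ∂(volume.restrict G), ∀ (y y' : ℝ) (z z' : Space d),
    m₂ * ‖z - z'‖ ^ 2 - m₃ * |y - y'| ^ 2 ≤
      inner ℝ (D.α x y z - D.α x y' z') (z - z') + (D.β x y z - D.β x y' z') * (y - y')

section Forms

variable {d : ℕ} {K : Geometry.SimplicialComplex ℝ (Space d)} {G B : Set (Space d)}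
  {U : Submodule ℝ TimeL2} [FiniteDimensional ℝ U] {u v w : Space d → TimeL2}
  {D : Problem d} {M m₂ m₃ κ : ℝ}

lemma coeFn_sum_timeBasis (c : Fin (Module.finrank ℝ U) → ℝ) :
    ∀ᵐ t : ℝ, (∑ k, c k • timeBasis U k : TimeL2) t = ∑ k, c k * timeBasis U k t := by
  have h : ∀ᵐ t : ℝ, ∀ k, (c k • timeBasis U k : TimeL2) t = c k * timeBasis U k t :=
    ae_all_iff.mpr fun k => by
      filter_upwards [Lp.coeFn_smul (c k) (timeBasis U k)] with t ht
      rw [ht, Pi.smul_apply, smul_eq_mul]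
  filter_upwards [h, Lp.coeFn_finsetSum Finset.univ fun k => c k • timeBasis U k] with t h1 h2
  rw [h2]
  simp [h1]

/-- A measurable version of `u`, as a function of space and time. -/
def jointValue (U : Submodule ℝ TimeL2) [FiniteDimensional ℝ U] (u : Space d → TimeL2)
    (p : Space d × ℝ) : ℝ := ∑ k, component U u k p.1 * timeBasis U k p.2

/-- A measurable version of the gradient of `u`, as a function of space and time. -/
def jointGrad (U : Submodule ℝ TimeL2) [FiniteDimensional ℝ U] (u : Space d → TimeL2)
    (p : Space d × ℝ) : Space d :=
  WithLp.toLp 2 fun j => ∑ k, gradComp U u j k p.1 * timeBasis U k p.2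

lemma measurable_component (hM : IsMeshed K G) (hu : u ∈ tensor U (plSpace K (closure G) B))
    (k : Fin (Module.finrank ℝ U)) : Measurable (component U u k) :=
  measurable_pl hM ((mem_tensor.mp hu).2 k)

lemma measurable_timeBasis (k : Fin (Module.finrank ℝ U)) :
    Measurable fun t => timeBasis U k t := (Lp.stronglyMeasurable _).measurable

lemma measurable_jointValue (hM : IsMeshed K G) (hu : u ∈ tensor U (plSpace K (closure G) B)) :
    Measurable (jointValue U u) :=
  Finset.measurable_sum _ fun k _ =>
    ((measurable_component hM hu k).comp measurable_fst).mul
      ((measurable_timeBasis k).comp measurable_snd)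

lemma measurable_jointGrad (u : Space d → TimeL2) : Measurable (jointGrad U u) := by
  refine (WithLp.measurable_toLp 2 (Fin d → ℝ)).comp ?_
  exact measurable_pi_lambda _ fun j => Finset.measurable_sum _ fun k _ =>
    ((measurable_gradComp u j k).comp measurable_fst).mul
      ((measurable_timeBasis k).comp measurable_snd)

lemma ae_eq_jointValue (hu : u ∈ tensor U (plSpace K (closure G) B)) (x : Space d) :
    ∀ᵐ t : ℝ, u x t = jointValue U u (x, t) := by
  rw [tensor_apply hu x]
  exact coeFn_sum_timeBasis _

lemma ae_eq_jointGrad (hu : u ∈ tensor U (plSpace K (closure G) B)) {x : Space d}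
    (hx : x ∈ regularSet K (closure G)) : ∀ᵐ t : ℝ, gradAt u x t = jointGrad U u (x, t) := by
  have h : ∀ᵐ t : ℝ, ∀ j, partialDeriv u j x t = ∑ k, gradComp U u j k x * timeBasis U k t :=
    ae_all_iff.mpr fun j => by
      rw [partialDeriv_eq hu hx]
      exact coeFn_sum_timeBasis _
  filter_upwards [h] with t ht
  ext j
  exact ht j

/-- The spatial part of the form at the point `x`. -/
def spacePart (D : Problem d) (u v : Space d → TimeL2) (x : Space d) : ℝ :=
  ∫ t, (inner ℝ (D.α x (u x t) (gradAt u x t)) (gradAt v x t) +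
    D.β x (u x t) (gradAt u x t) * v x t)

lemma spacePart_eq (hD : IsCoefficientOn D G M m₂ m₃) (u v : Space d → TimeL2) :
    ∀ᵐ x ∂(volume.restrict G), spacePart D u v x =
      pairing (D.α x) (D.β x) (u x) (fun j => partialDeriv u j x) (v x)
        (fun j => partialDeriv v j x) := by
  filter_upwards [hD.lip] with x hx
  exact pairing_eq_integral hx.1 hx.2 _ _ _ _

/-- For each `x` the class `u x` has its own representative in `t`, so joint measurability of these
representatives is not at hand. They are replaced by the finite sums `jointValue` and `jointGrad`,
which agree with them for almost every `t`, and by the Carathéodory versions of the coefficients. -/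
lemma aestronglyMeasurable_spacePart (hM : IsMeshed K G) (hD : IsCoefficientOn D G M m₂ m₃)
    (hu : u ∈ tensor U (plSpace K (closure G) B)) (hv : v ∈ tensor U (plSpace K (closure G) B)) :
    AEStronglyMeasurable (spacePart D u v) (volume.restrict G) := by
  obtain ⟨a, ha, haα⟩ := exists_stronglyMeasurable_caratheodory (μ := volume.restrict G)
    (f := fun x (p : ℝ × Space d) => D.α x p.1 p.2) (fun p => hD.meas_α p.1 p.2) (by
      filter_upwards [hD.lip] with x hx using hx.1.continuous)
  obtain ⟨b, hb, hbβ⟩ := exists_stronglyMeasurable_caratheodory (μ := volume.restrict G)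
    (f := fun x (p : ℝ × Space d) => D.β x p.1 p.2) (fun p => hD.meas_β p.1 p.2) (by
      filter_upwards [hD.lip] with x hx using hx.2.continuous)
  have harg : Measurable fun p : Space d × ℝ => ((jointValue U u p, jointGrad U u p), p.1) :=
    ((measurable_jointValue hM hu).prodMk (measurable_jointGrad u)).prodMk measurable_fst
  have hF : StronglyMeasurable (Function.uncurry fun (x : Space d) (t : ℝ) =>
      inner ℝ (a x (jointValue U u (x, t), jointGrad U u (x, t))) (jointGrad U v (x, t)) +
        b x (jointValue U u (x, t), jointGrad U u (x, t)) * jointValue U v (x, t)) := by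
    have h1 := ha.comp_measurable harg
    have h2 := hb.comp_measurable harg
    exact (h1.inner (measurable_jointGrad v).stronglyMeasurable).add
      (h2.mul (measurable_jointValue hM hv).stronglyMeasurable)
  refine (hF.integral_prod_right (ν := volume)).aestronglyMeasurable.congr ?_
  filter_upwards [haα, hbβ, hM.ae_regular] with x h1 h2 hx
  apply integral_congr_ae
  filter_upwards [ae_eq_jointValue hu x, ae_eq_jointValue hv x, ae_eq_jointGrad hu hx,
    ae_eq_jointGrad hv hx] with t e1 e2 e3 e4
  rw [h1, h2, e1, e2, e3, e4]

/-- The size of the value and the gradient of `u` at `x`. -/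
def jetNorm (u : Space d → TimeL2) (x : Space d) : ℝ := ‖u x‖ + ∑ j, ‖partialDeriv u j x‖

lemma jetNorm_nonneg (u : Space d → TimeL2) (x : Space d) : 0 ≤ jetNorm u x := by
  unfold jetNorm; positivity

lemma abs_spacePart_sub_le (hM : IsMeshed K G) (hD : IsCoefficientOn D G M m₂ m₃)
    (hu : u ∈ tensor U (plSpace K (closure G) B)) (hw : w ∈ tensor U (plSpace K (closure G) B))
    (v : Space d → TimeL2) :
    ∀ᵐ x ∂(volume.restrict G), |spacePart D u v x - spacePart D w v x| ≤
      M * jetNorm (u - w) x * jetNorm v x := by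
  filter_upwards [hD.lip, spacePart_eq hD u v, spacePart_eq hD w v, hM.ae_regular]
    with x hx h1 h2 hr
  rw [h1, h2]
  have h := abs_pairing_sub_le hx.1 hx.2 (u x) (w x) (fun j => partialDeriv u j x)
    (fun j => partialDeriv w j x) (v x) (fun j => partialDeriv v j x)
  unfold jetNorm
  simp_rw [partialDeriv_sub hu hw hr]
  exact h

lemma exists_jetNorm_bound (hM : IsMeshed K G) (hu : u ∈ tensor U (plSpace K (closure G) B)) :
    ∃ C, ∀ x ∈ regularSet K (closure G), jetNorm u x ≤ C := by
  obtain ⟨C, hC⟩ := exists_norm_bound hM hu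
  obtain ⟨C', hC'⟩ := exists_partialDeriv_bound hM hu
  exact ⟨C + ∑ _ : Fin d, C', fun x hx =>
    add_le_add (hC x) (Finset.sum_le_sum fun j _ => hC' x hx j)⟩

lemma integrable_spacePart (hM : IsMeshed K G) (hD : IsCoefficientOn D G M m₂ m₃)
    (hu : u ∈ tensor U (plSpace K (closure G) B)) (hv : v ∈ tensor U (plSpace K (closure G) B)) :
    IntegrableOn (spacePart D u v) G := by
  have := hM.isFiniteMeasure
  obtain ⟨C, hC⟩ := exists_jetNorm_bound hM hu
  obtain ⟨C', hC'⟩ := exists_jetNorm_bound hM hv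
  refine Integrable.of_bound (C := M * C * C') (aestronglyMeasurable_spacePart hM hD hu hv) ?_
  filter_upwards [hD.lip, spacePart_eq hD u v, hM.ae_regular] with x hx h1 hr
  -- Comparison with the zero function, at which the coefficients vanish.
  have h := abs_pairing_sub_le hx.1 hx.2 (u x) 0 (fun j => partialDeriv u j x) 0
    (v x) (fun j => partialDeriv v j x)
  rw [pairing_zero hx.1 hx.2, sub_zero, sub_zero, sub_zero] at h
  rw [h1]
  refine h.trans (mul_le_mul (mul_le_mul_of_nonneg_left (hC x hr) hx.1.nonneg) (hC' x hr)
    (jetNorm_nonneg v x) (mul_nonneg hx.1.nonneg ((jetNorm_nonneg u x).trans (hC x hr))))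

/-! ### Products of temporal operators, and the forms as linear functionals -/

lemma tensor_mem (hu : u ∈ tensor U (plSpace K (closure G) B)) (x : Space d) : u x ∈ U :=
  (mem_tensor.mp hu).1 x

/-- The measure is arbitrary because three are needed: volume in a domain, and surface measure on Γ
and on a whole boundary. -/
lemma integrable_inner_linear (hM : IsMeshed K G) {μ : Measure (Space d)} [IsFiniteMeasure μ]
    (S T : U →ₗ[ℝ] TimeL2)
    (hu : u ∈ tensor U (plSpace K (closure G) B)) (hv : v ∈ tensor U (plSpace K (closure G) B)) :
    Integrable (fun x => (inner ℝ (S ⟨u x, tensor_mem hu x⟩) (T ⟨v x, tensor_mem hv x⟩) : ℝ)) μ := by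
  have hexp : ∀ (L : U →ₗ[ℝ] TimeL2) {w : Space d → TimeL2}
      (hw : w ∈ tensor U (plSpace K (closure G) B)) (x : Space d),
      L ⟨w x, tensor_mem hw x⟩ = ∑ k, component U w k x • L ⟨timeBasis U k, timeBasis_mem U k⟩ := by
    intro L w hw x
    have : (⟨w x, tensor_mem hw x⟩ : U) =
        ∑ k, component U w k x • ⟨timeBasis U k, timeBasis_mem U k⟩ := by
      ext1
      simpa using tensor_apply hw x
    rw [this, map_sum]
    simp_rw [map_smul]
  have hmeas : ∀ (L : U →ₗ[ℝ] TimeL2) {w : Space d → TimeL2}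
      (hw : w ∈ tensor U (plSpace K (closure G) B)),
      StronglyMeasurable fun x => L ⟨w x, tensor_mem hw x⟩ := by
    intro L w hw
    simp_rw [hexp L hw]
    exact Finset.stronglyMeasurable_fun_sum _ fun k _ =>
      (measurable_component hM hw k).stronglyMeasurable.smul_const _
  obtain ⟨C, hC⟩ := exists_norm_bound hM hu
  obtain ⟨C', hC'⟩ := exists_norm_bound hM hv
  refine Integrable.of_bound
    (C := ‖LinearMap.toContinuousLinearMap S‖ * C * (‖LinearMap.toContinuousLinearMap T‖ * C'))
    ((hmeas S hu).inner (hmeas T hv)).aestronglyMeasurable (.of_forall fun x => ?_)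
  refine (norm_inner_le_norm _ _).trans ?_
  have h1 := (LinearMap.toContinuousLinearMap S).le_opNorm ⟨u x, tensor_mem hu x⟩
  have h2 := (LinearMap.toContinuousLinearMap T).le_opNorm ⟨v x, tensor_mem hv x⟩
  have h3 : ‖(⟨u x, tensor_mem hu x⟩ : U)‖ ≤ C := hC x
  have h4 : ‖(⟨v x, tensor_mem hv x⟩ : U)‖ ≤ C' := hC' x
  have hC0 : 0 ≤ C := (norm_nonneg _).trans h3
  have hS0 := ContinuousLinearMap.opNorm_nonneg (LinearMap.toContinuousLinearMap S)
  have hT0 := ContinuousLinearMap.opNorm_nonneg (LinearMap.toContinuousLinearMap T)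
  have h5 := h1.trans (mul_le_mul_of_nonneg_left h3 hS0)
  have h6 := h2.trans (mul_le_mul_of_nonneg_left h4 hT0)
  exact mul_le_mul h5 h6 (norm_nonneg _) (mul_nonneg hS0 hC0)

lemma integrable_timePart (hM : IsMeshed K G) (hU : U ≤ bandLimited κ)
    (hu : u ∈ tensor U (plSpace K (closure G) B)) (hv : v ∈ tensor U (plSpace K (closure G) B)) :
    IntegrableOn (fun x => (inner ℝ (halfPlus (u x)) (halfMinus (v x)) : ℝ)) G := by
  have := hM.isFiniteMeasure
  exact integrable_inner_linear hM (multL isSymbol_halfPlus hU) (multL isSymbol_halfPlus.conj hU)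
    hu hv

lemma form_eq_add (hM : IsMeshed K G) (hU : U ≤ bandLimited κ) (hD : IsCoefficientOn D G M m₂ m₃)
    (hu : u ∈ tensor U (plSpace K (closure G) B)) (hv : v ∈ tensor U (plSpace K (closure G) B)) :
    D.form G u v = (∫ x in G, (inner ℝ (halfPlus (u x)) (halfMinus (v x)) : ℝ)) +
      ∫ x in G, spacePart D u v x :=
  integral_add (integrable_timePart hM hU hu hv) (integrable_spacePart hM hD hu hv)

lemma integrable_form (hM : IsMeshed K G) (hU : U ≤ bandLimited κ)
    (hD : IsCoefficientOn D G M m₂ m₃)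
    (hu : u ∈ tensor U (plSpace K (closure G) B)) (hv : v ∈ tensor U (plSpace K (closure G) B)) :
    IntegrableOn (fun x => (inner ℝ (halfPlus (u x)) (halfMinus (v x)) : ℝ) +
      ∫ t, (inner ℝ (D.α x (u x t) (gradAt u x t)) (gradAt v x t) +
        D.β x (u x t) (gradAt u x t) * v x t)) G :=
  (integrable_timePart hM hU hu hv).add (integrable_spacePart hM hD hu hv)

/-- The form `∫ S u(x) · T v(x) dμ(x)` on a discrete space, for linear operators `S` and `T` acting
in time. -/
def pointBilin (hM : IsMeshed K G) (μ : Measure (Space d)) [IsFiniteMeasure μ]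
    (S T : U →ₗ[ℝ] TimeL2) (B : Set (Space d)) :
    LinearMap.BilinForm ℝ (tensor U (plSpace K (closure G) B)) :=
  LinearMap.mk₂ ℝ
    (fun u v => ∫ x, (inner ℝ (S ⟨u.1 x, tensor_mem u.2 x⟩) (T ⟨v.1 x, tensor_mem v.2 x⟩) : ℝ) ∂μ)
    (fun u u' v => by
      rw [← integral_add (integrable_inner_linear hM S T u.2 v.2)
        (integrable_inner_linear hM S T u'.2 v.2)]
      simp_rw [← inner_add_left, ← map_add]
      rfl)
    (fun c u v => by
      rw [smul_eq_mul, ← integral_const_mul]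
      simp_rw [← real_inner_smul_left, ← map_smul]
      rfl)
    (fun u v v' => by
      rw [← integral_add (integrable_inner_linear hM S T u.2 v.2)
        (integrable_inner_linear hM S T u.2 v'.2)]
      simp_rw [← inner_add_right, ← map_add]
      rfl)
    (fun c u v => by
      rw [smul_eq_mul, ← integral_const_mul]
      simp_rw [← real_inner_smul_right, ← map_smul]
      rfl)

/-- The time part of the form, as a bilinear form on the discrete space. -/
def timeBilin (hM : IsMeshed K G) (hU : U ≤ bandLimited κ) (B : Set (Space d)) :
    LinearMap.BilinForm ℝ (tensor U (plSpace K (closure G) B)) :=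
  have := hM.isFiniteMeasure
  pointBilin hM (volume.restrict G) (multL isSymbol_halfPlus hU) (multL isSymbol_halfPlus.conj hU) B

lemma timeBilin_self (hM : IsMeshed K G) (hU : U ≤ bandLimited κ)
    (u : tensor U (plSpace K (closure G) B)) : timeBilin hM hU B u u = 0 :=
  integral_eq_zero_of_ae (.of_forall fun x => inner_halfPlus_halfMinus_self (hU (tensor_mem u.2 x)))

lemma spacePart_add (hM : IsMeshed K G) (hD : IsCoefficientOn D G M m₂ m₃)
    (u : Space d → TimeL2) (hv : v ∈ tensor U (plSpace K (closure G) B))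
    (hw : w ∈ tensor U (plSpace K (closure G) B)) :
    ∀ᵐ x ∂(volume.restrict G),
      spacePart D u (v + w) x = spacePart D u v x + spacePart D u w x := by
  filter_upwards [spacePart_eq hD u v, spacePart_eq hD u w, spacePart_eq hD u (v + w),
    hM.ae_regular] with x h1 h2 h3 hr
  rw [h1, h2, h3, ← pairing_add]
  simp_rw [partialDeriv_add hv hw hr]
  rfl

lemma spacePart_smul (hM : IsMeshed K G) (hD : IsCoefficientOn D G M m₂ m₃)
    (u : Space d → TimeL2) (hv : v ∈ tensor U (plSpace K (closure G) B)) (c : ℝ) :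
    ∀ᵐ x ∂(volume.restrict G), spacePart D u (c • v) x = c * spacePart D u v x := by
  filter_upwards [spacePart_eq hD u v, spacePart_eq hD u (c • v), hM.ae_regular] with x h1 h3 hr
  rw [h1, h3, ← pairing_smul]
  simp_rw [partialDeriv_smul hv hr]
  rfl

/-- The spatial part of the form, as a linear functional of the test function. -/
def spaceForm (hM : IsMeshed K G) (hD : IsCoefficientOn D G M m₂ m₃)
    (u : tensor U (plSpace K (closure G) B)) : tensor U (plSpace K (closure G) B) →ₗ[ℝ] ℝ where
  toFun v := ∫ x in G, spacePart D u v x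
  map_add' v w := by
    rw [← integral_add (integrable_spacePart hM hD u.2 v.2) (integrable_spacePart hM hD u.2 w.2)]
    exact integral_congr_ae (spacePart_add hM hD u v.2 w.2)
  map_smul' c v := by
    rw [RingHom.id_apply, smul_eq_mul, ← integral_const_mul]
    exact integral_congr_ae (spacePart_smul hM hD u v.2 c)

/-- The form, as a linear functional of the test function. -/
def formL (hM : IsMeshed K G) (hU : U ≤ bandLimited κ) (hD : IsCoefficientOn D G M m₂ m₃)
    (u : tensor U (plSpace K (closure G) B)) : tensor U (plSpace K (closure G) B) →ₗ[ℝ] ℝ :=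
  timeBilin hM hU B u + spaceForm hM hD u

lemma formL_apply (hM : IsMeshed K G) (hU : U ≤ bandLimited κ)
    (hD : IsCoefficientOn D G M m₂ m₃) (u v : tensor U (plSpace K (closure G) B)) :
    formL hM hU hD u v = D.form G u v :=
  (form_eq_add hM hU hD u.2 v.2).symm

/-- Bounds of the values of discrete functions by the Dirichlet form. -/
lemma exists_jetNorm_le (hM : IsMeshed K G) (hg : IsInner (gradBilin hM U B)) :
    ∃ C > 0, ∀ x ∈ regularSet K (closure G), ∀ u : tensor U (plSpace K (closure G) B),
      jetNorm u x ≤ C * √(gradBilin hM U B u u) := by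
  have := finiteDimensional_plSpace (B := B) hM.finite hM.resolved
  have := finiteDimensional_tensor (U := U) (V := plSpace K (closure G) B)
  let T₀ : Space d → tensor U (plSpace K (closure G) B) →ₗ[ℝ] TimeL2 := fun x =>
    { toFun := fun u => (u : Space d → TimeL2) x, map_add' := fun _ _ => rfl,
      map_smul' := fun _ _ => rfl }
  -- The index runs over regular points because there all discrete functions are differentiable, and
  -- so differentiation is linear in `u`.
  let T₁ : regularSet K (closure G) × Fin d → tensor U (plSpace K (closure G) B) →ₗ[ℝ] TimeL2 :=
    fun p =>
    { toFun := fun u => partialDeriv u p.2 p.1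
      map_add' := fun u v => partialDeriv_add u.2 v.2 p.1.2 p.2
      map_smul' := fun c u => partialDeriv_smul u.2 p.1.2 p.2 c }
  obtain ⟨C₀, hC₀, h₀⟩ := hg.exists_uniform_bound T₀ fun u => exists_norm_bound hM u.2
  obtain ⟨C₁, hC₁, h₁⟩ := hg.exists_uniform_bound T₁ fun u => by
    obtain ⟨C, hC⟩ := exists_partialDeriv_bound hM u.2
    exact ⟨C, fun p => hC p.1 p.1.2 p.2⟩
  refine ⟨C₀ + d * C₁, by positivity, fun x hx u => ?_⟩
  rw [add_mul]
  refine add_le_add (h₀ x u) ?_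
  refine (Finset.sum_le_sum fun j _ => h₁ (⟨x, hx⟩, j) u).trans (le_of_eq ?_)
  simp [mul_assoc]

/-- Strong monotonicity of the discrete problem, given the coercivity of the quadratic form of
the monotonicity bound. -/
theorem isStronglyMonotone_formL (hM : IsMeshed K G) (hU : U ≤ bandLimited κ)
    (hD : IsCoefficientOn D G M m₂ m₃) (hM0 : 0 < M) (hg : IsInner (gradBilin hM U B))
    (ℓ : tensor U (plSpace K (closure G) B) →ₗ[ℝ] ℝ)
    (hcoer : ∃ c > 0, ∀ u ∈ tensor U (plSpace K (closure G) B),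
      c * gradForm G u u ≤ m₂ * gradForm G u u - m₃ * ∫ x in G, ‖u x‖ ^ 2) :
    IsStronglyMonotone (gradBilin hM U B) (fun u => formL hM hU hD u - ℓ) := by
  have := hM.isFiniteMeasure
  have := finiteDimensional_plSpace (B := B) hM.finite hM.resolved
  have := finiteDimensional_tensor (U := U) (V := plSpace K (closure G) B)
  obtain ⟨c, hc, hcoer⟩ := hcoer
  obtain ⟨C, hC, hjet⟩ := exists_jetNorm_le hM hg
  let tB := timeBilin hM hU B
  obtain ⟨C₁, hC₁, hT⟩ : ∃ C₁ > 0, ∀ u v, |tB u v| ≤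
      C₁ * (√(gradBilin hM U B u u) * √(gradBilin hM U B v v)) := by
    -- Riesz representation turns the time form into a linear map, which is bounded in finite
    -- dimensions.
    obtain ⟨Q, hQ⟩ : ∃ Q : tensor U (plSpace K (closure G) B) →ₗ[ℝ]
        tensor U (plSpace K (closure G) B), ∀ u v, gradBilin hM U B (Q u) v = tB u v := by
      choose q hq hq' using fun u => hg.existsUnique_riesz (tB u)
      refine ⟨{ toFun := q, map_add' := fun u v => ?_, map_smul' := fun a u => ?_ }, hq⟩
      · refine (hq' _ _ fun y => ?_).symm
        simp [hq]
      · refine (hq' _ _ fun y => ?_).symm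
        simp [hq]
    obtain ⟨C₁, hC₁, h⟩ := hg.exists_bound_map hg Q
    refine ⟨C₁, hC₁, fun u v => ?_⟩
    rw [← hQ, ← mul_assoc]
    exact (hg.cauchy_schwarz _ _).trans
      (mul_le_mul_of_nonneg_right (h u) (Real.sqrt_nonneg _))
  set vol := (volume.restrict G).real univ with hvol
  -- `C₁` bounds the time form; in the spatial part the pointwise bound M times two jet norms, each
  -- at most `C` times the Dirichlet norm, is integrated over `G`.
  refine ⟨c, hc, C₁ + M * C * C * vol, by positivity, fun u u' => ?_, fun u u' v => ?_⟩
  · have e : (formL hM hU hD u - ℓ) (u - u') - (formL hM hU hD u' - ℓ) (u - u') =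
        tB (u - u') (u - u') + (spaceForm hM hD u (u - u') - spaceForm hM hD u' (u - u')) := by
      simp only [formL, LinearMap.sub_apply, LinearMap.add_apply, map_sub, tB]
      ring
    -- The functional `ℓ` cancels in the difference, and the time form vanishes on the diagonal.
    rw [e, timeBilin_self, zero_add]
    refine (hcoer (u - u' : tensor U (plSpace K (closure G) B)) (u - u').2).trans ?_
    have hint := integrable_sum_inner_partialDeriv hM (u - u').2 (u - u').2
    have hint' : IntegrableOn (fun x => ‖(u - u' : tensor U (plSpace K (closure G) B)).1 x‖ ^ 2) G := by
      have := integrable_inner_linear hM (μ := volume.restrict G) U.subtype U.subtype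
        (u - u').2 (u - u').2
      refine this.congr (.of_forall fun x => ?_)
      exact real_inner_self_eq_norm_sq _
    change _ ≤ (∫ x in G, spacePart D u (u - u' : tensor U (plSpace K (closure G) B)) x) -
      ∫ x in G, spacePart D u' (u - u' : tensor U (plSpace K (closure G) B)) x
    rw [gradForm, ← integral_const_mul, ← integral_const_mul, ← integral_sub (hint.const_mul _)
      (hint'.const_mul _), ← integral_sub (integrable_spacePart hM hD u.2 (u - u').2)
      (integrable_spacePart hM hD u'.2 (u - u').2)]
    refine integral_mono_ae ((hint.const_mul _).sub (hint'.const_mul _))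
      ((integrable_spacePart hM hD u.2 (u - u').2).sub
        (integrable_spacePart hM hD u'.2 (u - u').2)) ?_
    filter_upwards [hD.lip, hD.mono, spacePart_eq hD u (u - u' : tensor U (plSpace K (closure G) B)),
      spacePart_eq hD u' (u - u' : tensor U (plSpace K (closure G) B)), hM.ae_regular]
      with x hx hm h1 h2 hr
    rw [h1, h2]
    have h := le_pairing_sub hx.1 hx.2 hm (u.1 x) (u'.1 x) (fun j => partialDeriv u j x)
      (fun j => partialDeriv u' j x)
    simp_rw [Submodule.coe_sub, partialDeriv_sub u.2 u'.2 hr, real_inner_self_eq_norm_sq]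
    exact h
  · have e : (formL hM hU hD u - ℓ) v - (formL hM hU hD u' - ℓ) v =
        tB (u - u') v + (spaceForm hM hD u v - spaceForm hM hD u' v) := by
      simp only [formL, LinearMap.sub_apply, LinearMap.add_apply, map_sub, tB]
      ring
    rw [e, add_mul]
    refine (abs_add_le _ _).trans (add_le_add (hT _ _) ?_)
    change |(∫ x in G, spacePart D u v x) - ∫ x in G, spacePart D u' v x| ≤ _
    rw [← integral_sub (integrable_spacePart hM hD u.2 v.2) (integrable_spacePart hM hD u'.2 v.2),
      ← Real.norm_eq_abs]
    have hb : ∀ᵐ x ∂(volume.restrict G), ‖spacePart D u v x - spacePart D u' v x‖ ≤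
        M * (C * √(gradBilin hM U B (u - u') (u - u'))) * (C * √(gradBilin hM U B v v)) := by
      filter_upwards [abs_spacePart_sub_le hM hD u.2 u'.2 v, hM.ae_regular] with x h1 hr
      refine h1.trans ?_
      have h2 := hjet x hr (u - u')
      have h3 := hjet x hr v
      exact mul_le_mul (mul_le_mul_of_nonneg_left h2 hM0.le) h3 (jetNorm_nonneg _ _) (by positivity)
    refine (norm_integral_le_of_norm_le_const hb).trans (le_of_eq ?_)
    rw [hvol]
    ring

/-! ### The source term -/

lemma memLp_jointValue (hM : IsMeshed K G) (hu : u ∈ tensor U (plSpace K (closure G) B)) :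
    MemLp (jointValue U u) 2 ((volume.restrict G).prod volume) := by
  have := hM.isFiniteMeasure
  refine memLp_finsetSum _ fun k _ => ?_
  have hc : MemLp (component U u k) 2 (volume.restrict G) := by
    obtain ⟨C, hC⟩ := pl_bounded hM.finite hM.resolved ((mem_tensor.mp hu).2 k)
    exact MemLp.of_bound (measurable_component hM hu k).aestronglyMeasurable C (.of_forall hC)
  have hb : MemLp (fun t => timeBasis U k t) 2 (volume : Measure ℝ) := Lp.memLp _
  have hmeas : AEStronglyMeasurable (fun p : Space d × ℝ =>
      component U u k p.1 * timeBasis U k p.2) ((volume.restrict G).prod volume) :=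
    (((measurable_component hM hu k).comp measurable_fst).mul
      ((measurable_timeBasis k).comp measurable_snd)).aestronglyMeasurable
  rw [memLp_two_iff_integrable_sq hmeas]
  refine ((hc.integrable_sq).mul_prod (hb.integrable_sq)).congr (.of_forall fun p => ?_)
  simp only [mul_pow]

lemma integrable_source (hM : IsMeshed K G) {f : Space d → ℝ → ℝ}
    (hf : MemLp (fun p : Space d × ℝ => f p.1 p.2) 2 ((volume.restrict G).prod volume))
    (hu : u ∈ tensor U (plSpace K (closure G) B)) :
    IntegrableOn (fun x => ∫ t, f x t * u x t) G ∧
      ∀ᵐ x ∂(volume.restrict G), Integrable fun t => f x t * u x t := by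
  have hint : Integrable (fun p : Space d × ℝ => f p.1 p.2 * jointValue U u p)
    ((volume.restrict G).prod volume) := hf.integrable_mul (memLp_jointValue hM hu)
  refine ⟨hint.integral_prod_left.congr (.of_forall fun x => ?_), ?_⟩
  · apply integral_congr_ae
    filter_upwards [ae_eq_jointValue hu x] with t ht
    rw [ht]
  · filter_upwards [hint.prod_right_ae] with x hx
    refine hx.congr ?_
    filter_upwards [ae_eq_jointValue hu x] with t ht
    rw [ht]

/-- The source term as a linear functional on the discrete space. -/
def sourceL (hM : IsMeshed K G)
    (hf : MemLp (fun p : Space d × ℝ => D.f p.1 p.2) 2 ((volume.restrict G).prod volume))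
    (U : Submodule ℝ TimeL2) [FiniteDimensional ℝ U] (B : Set (Space d)) :
    tensor U (plSpace K (closure G) B) →ₗ[ℝ] ℝ where
  toFun v := D.source G v
  map_add' v w := by
    rw [Problem.source, Problem.source, Problem.source,
      ← integral_add (integrable_source hM hf v.2).1 (integrable_source hM hf w.2).1]
    apply integral_congr_ae
    filter_upwards [(integrable_source hM hf v.2).2, (integrable_source hM hf w.2).2] with x h1 h2
    rw [← integral_add h1 h2]
    apply integral_congr_ae
    filter_upwards [Lp.coeFn_add (v.1 x) (w.1 x)] with t ht
    rw [Submodule.coe_add, Pi.add_apply, ht, Pi.add_apply, mul_add]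
  map_smul' c v := by
    rw [Problem.source, Problem.source, RingHom.id_apply, smul_eq_mul, ← integral_const_mul]
    congr 1
    ext x
    rw [← integral_const_mul]
    apply integral_congr_ae
    filter_upwards [Lp.coeFn_smul c (v.1 x)] with t ht
    rw [Submodule.coe_smul, Pi.smul_apply, ht, Pi.smul_apply, smul_eq_mul, mul_left_comm]

end Forms

/-! ### The subdomains and their meshes -/

namespace DiscreteProblem

variable {d : ℕ} {D : DiscreteProblem d}

/-- An open subset of the closure of Ω lies in the interior of that closure, which is contained in
Ω. -/
lemma sub_subset (hdom : D.DomainAssumption) (i : Fin 2) : D.sub i ⊆ D.Ω := by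
  have h : closure (D.sub i) ⊆ closure D.Ω := by
    rw [hdom.closure_eq]
    fin_cases i
    · exact subset_union_left
    · exact subset_union_right
  exact (interior_maximal (subset_closure.trans h) (hdom.lipschitz_sub i).1).trans
    (interior_closure_subset hdom.lipschitz)

lemma closure_sub_subset (hdom : D.DomainAssumption) (i : Fin 2) :
    closure (D.sub i) ⊆ closure D.Ω := closure_mono (sub_subset hdom i)

lemma disjoint_sub (hdom : D.DomainAssumption) {i j : Fin 2} (hij : i ≠ j) :
    Disjoint (D.sub i) (D.sub j) := by
  have h : Disjoint (D.sub 0) (D.sub 1) := disjoint_iff_inter_eq_empty.mpr hdom.disjoint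
  fin_cases i <;> fin_cases j
  · exact absurd rfl hij
  · exact h
  · exact h.symm
  · exact absurd rfl hij

lemma notMem_closure_sub (hdom : D.DomainAssumption) {i j : Fin 2} (hij : i ≠ j) {x : Space d}
    (hx : x ∈ D.sub i) : x ∉ closure (D.sub j) :=
  disjoint_left.mp ((disjoint_sub hdom hij).closure_right (hdom.lipschitz_sub i).1) hx

/-- A simplex that contains a point of Ω_i cannot lie in the closure of the other subdomain, which
is disjoint from the open set Ω_i. The simplices in the closure of Ω_i thus cover Ω_i, and their
finite union is closed. -/
lemma isMeshed_sub (hdom : D.DomainAssumption) (hmesh : D.MeshAssumption) (i : Fin 2) :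
    IsMeshed D.K (D.sub i) where
  isOpen := (hdom.lipschitz_sub i).1
  isBounded := (hdom.lipschitz_sub i).2.1
  finite := hmesh.finite
  resolved := by
    set C : Set (Space d) := ⋃ s ∈ {s ∈ D.K.faces | convexHull ℝ (s : Set (Space d)) ⊆
      closure (D.sub i)}, convexHull ℝ (s : Set (Space d)) with hC
    have hCc : IsClosed C := (hmesh.finite.subset (sep_subset _ _)).isClosed_biUnion fun s _ =>
      (s.finite_toSet.isCompact_convexHull ℝ).isClosed
    have hsub : D.sub i ⊆ C := by
      intro x hx
      have hxK : x ∈ D.K.space := by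
        rw [hmesh.space_eq]
        exact subset_closure (sub_subset hdom i hx)
      obtain ⟨s, hs, hxs⟩ := Geometry.SimplicialComplex.mem_space_iff.mp hxK
      obtain ⟨j, hj⟩ := hmesh.resolves s hs
      obtain rfl : j = i := by
        by_contra hji
        exact notMem_closure_sub hdom (Ne.symm hji) hx (hj hxs)
      exact mem_biUnion (show s ∈ {s ∈ D.K.faces | _} from ⟨hs, hj⟩) hxs
    intro x hx
    obtain ⟨s, hs, hxs⟩ := mem_iUnion₂.mp (closure_minimal hsub hCc hx)
    exact ⟨s, hs.1, hs.2, hxs⟩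

lemma isMeshed_domain (hdom : D.DomainAssumption) (hmesh : D.MeshAssumption) :
    IsMeshed D.K D.Ω where
  isOpen := hdom.lipschitz.1
  isBounded := hdom.lipschitz.2.1
  finite := hmesh.finite
  resolved x hx := by
    rw [← hmesh.space_eq] at hx ⊢
    obtain ⟨s, hs, hxs⟩ := Geometry.SimplicialComplex.mem_space_iff.mp hx
    exact ⟨s, hs, D.K.convexHull_subset_space hs, hxs⟩

/-- The point of ∂Ω that the component reaches is not in Ω_i, as Ω_i lies in the open set Ω, so it
is on ∂Ω_i; and Γ excludes ∂Ω by definition. -/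
lemma reaches_dirichlet_boundary (hdom : D.DomainAssumption) (i : Fin 2) :
    ∀ x ∈ D.sub i, (closure (connectedComponentIn (D.sub i) x) ∩
      (frontier (D.sub i) \ D.Γ)).Nonempty := by
  intro x hx
  obtain ⟨j, hij⟩ : ∃ j, i ≠ j := by
    fin_cases i
    · exact ⟨1, by decide⟩
    · exact ⟨0, by decide⟩
  obtain ⟨p, hp, hpΩ, -⟩ := hdom.reaches_boundary i j hij x hx
  refine ⟨p, hp, ?_, fun h => h.2 hpΩ⟩
  rw [(hdom.lipschitz_sub i).1.frontier_eq]
  refine ⟨closure_mono (connectedComponentIn_subset _ _) hp, fun h => ?_⟩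
  rw [hdom.lipschitz.1.frontier_eq] at hpΩ
  exact hpΩ.2 (sub_subset hdom i h)

lemma measurableSet_interface (D : DiscreteProblem d) : MeasurableSet D.Γ :=
  ((isClosed_frontier.inter isClosed_frontier).measurableSet).diff isClosed_frontier.measurableSet

end DiscreteProblem

/-! ### The Poincaré inequality for discrete functions -/

section Poincare

variable {d : ℕ} {K : Geometry.SimplicialComplex ℝ (Space d)} {G B : Set (Space d)}
  {U : Submodule ℝ TimeL2} [FiniteDimensional ℝ U] {u : Space d → TimeL2}

/-- The gradient of a scalar function, by its Cartesian components. -/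
def gradVec (φ : Space d → ℝ) (x : Space d) : Space d :=
  WithLp.toLp 2 fun j => fderiv ℝ φ x (EuclideanSpace.single j 1)

lemma inner_gradVec (φ : Space d → ℝ) (x e : Space d) :
    inner ℝ (gradVec φ x) e = fderiv ℝ φ x e := by
  have he : e = ∑ j, e j • EuclideanSpace.single j (1 : ℝ) := by
    simpa using ((EuclideanSpace.basisFun (Fin d) ℝ).sum_repr e).symm
  conv_rhs => rw [he, map_sum]
  simp [gradVec, PiLp.inner_apply]

lemma measurable_gradVec (φ : Space d → ℝ) : Measurable (gradVec φ) :=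
  (WithLp.measurable_toLp 2 (Fin d → ℝ)).comp
    (measurable_pi_lambda _ fun _ => measurable_fderiv_apply_const ℝ _ _)

lemma norm_gradVec_sq (φ : Space d → ℝ) (x : Space d) :
    ‖gradVec φ x‖ ^ 2 = ∑ j, fderiv ℝ φ x (EuclideanSpace.single j 1) ^ 2 := by
  simp [gradVec, EuclideanSpace.norm_sq_eq]

lemma norm_gradVec_le (φ : Space d → ℝ) (x : Space d) : ‖gradVec φ x‖ ≤ ‖fderiv ℝ φ x‖ := by
  rcases (norm_nonneg (gradVec φ x)).eq_or_lt with h | h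
  · rw [← h]; exact norm_nonneg _
  · have h1 : ‖gradVec φ x‖ * ‖gradVec φ x‖ ≤ ‖fderiv ℝ φ x‖ * ‖gradVec φ x‖ := by
      rw [← real_inner_self_eq_norm_mul_norm, inner_gradVec]
      exact (le_abs_self _).trans ((fderiv ℝ φ x).le_opNorm _)
    exact le_of_mul_le_mul_right h1 h

lemma memLp_pl (hM : IsMeshed K G) {φ : Space d → ℝ} (hφ : φ ∈ plSpace K (closure G) B)
    (μ : Measure (Space d)) [IsFiniteMeasure μ] : MemLp φ 2 μ := by
  obtain ⟨C, hC⟩ := pl_bounded hM.finite hM.resolved hφ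
  exact MemLp.of_bound (measurable_pl hM hφ).aestronglyMeasurable C (.of_forall hC)

lemma memLp_gradVec (hM : IsMeshed K G) {φ : Space d → ℝ} (hφ : φ ∈ plSpace K (closure G) B) :
    MemLp (gradVec φ) 2 (volume.restrict G) := by
  have := hM.isFiniteMeasure
  obtain ⟨C, hC⟩ := pl_fderiv_bound hM.finite hφ
  refine MemLp.of_bound (measurable_gradVec φ).aestronglyMeasurable C ?_
  filter_upwards [hM.ae_regular] with x hx
  exact (norm_gradVec_le φ x).trans (hC x hx)

lemma isH1_pl (hM : IsMeshed K G) {φ : Space d → ℝ} (hφ : φ ∈ plSpace K (closure G) B) :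
    IsH1 G φ (gradVec φ) := by
  have := hM.isFiniteMeasure
  refine ⟨memLp_pl hM hφ _, memLp_gradVec hM hφ, fun θ hθ hc hs e => ?_⟩
  obtain ⟨L, hL⟩ := pl_lipschitz hM.finite hM.resolved hφ
  -- The test function is supported in `G`, so any extension serves; a Lipschitz one permits
  -- integration by parts on the whole space.
  obtain ⟨ψ, hψ, hψφ⟩ := hL.extend_real
  obtain ⟨L', hL'⟩ := hθ.lipschitzWith_of_hasCompactSupport hc (by simp)
  have h := LipschitzWith.integral_lineDeriv_mul_eq (μ := volume) hψ hL' hc e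
  have hθd : ∀ x, lineDeriv ℝ θ x (-e) = -fderiv ℝ θ x e := fun x => by
    rw [(hθ.differentiable (by simp) x).lineDeriv_eq_fderiv, map_neg]
  have hsupp : ∀ x ∉ G, θ x = 0 ∧ fderiv ℝ θ x = 0 := fun x hx =>
    ⟨image_eq_zero_of_notMem_tsupport fun h => hx (hs h),
      image_eq_zero_of_notMem_tsupport fun h => hx (hs (tsupport_fderiv_subset ℝ h))⟩
  have h1 : ∫ x, lineDeriv ℝ ψ x e * θ x = ∫ x in G, inner ℝ (gradVec φ x) e * θ x := by
    rw [← setIntegral_eq_integral_of_forall_compl_eq_zero (s := G)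
      (fun x hx => by rw [(hsupp x hx).1, mul_zero])]
    apply setIntegral_congr_ae hM.isOpen.measurableSet
    filter_upwards [(ae_restrict_iff' hM.isOpen.measurableSet).mp hM.ae_regular] with x hx hxG
    have heq : ψ =ᶠ[𝓝 x] φ := by
      filter_upwards [hM.isOpen.mem_nhds hxG] with y hy using (hψφ (subset_closure hy)).symm
    rw [heq.lineDeriv_eq, (pl_differentiableAt hφ (hx hxG)).lineDeriv_eq_fderiv, inner_gradVec]
  have h2 : ∫ x, lineDeriv ℝ θ x (-e) * ψ x = -∫ x in G, φ x * fderiv ℝ θ x e := by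
    rw [← integral_neg, ← setIntegral_eq_integral_of_forall_compl_eq_zero (s := G)
      (fun x hx => by rw [hθd, (hsupp x hx).2]; simp)]
    apply setIntegral_congr_fun hM.isOpen.measurableSet
    intro x hx
    simp only [hθd]
    rw [hψφ (subset_closure hx)]
    ring
  rw [← h1, h, h2, neg_neg]

/-- A discrete function is continuous up to the boundary, so the constant sequence shows that it is
its own trace. -/
lemma isH1ZeroOn_pl (hM : IsMeshed K G) (hG : surface d (frontier G) < ⊤) (hB : MeasurableSet B)
    {φ : Space d → ℝ} (hφ : φ ∈ plSpace K (closure G) B) : IsH1ZeroOn G B φ (gradVec φ) := by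
  have : IsFiniteMeasure ((surface d).restrict (frontier G)) :=
    ⟨by rwa [Measure.restrict_apply_univ]⟩
  obtain ⟨L, hL⟩ := pl_lipschitz hM.finite hM.resolved hφ
  refine ⟨isH1_pl hM hφ, φ, ⟨memLp_pl hM hφ _, fun _ => φ, fun _ => gradVec φ,
    fun _ => ⟨isH1_pl hM hφ, hL.continuousOn⟩, ?_, ?_, ?_⟩,
    ae_restrict_of_forall_mem hB hφ.2.2⟩ <;> simp

lemma sq_integral_le_of_poincare (hM : IsMeshed K G) (hG : surface d (frontier G) < ⊤)
    (hB : MeasurableSet B) {C : ℝ≥0∞} (hC : C ≠ ⊤)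
    (h : ∀ v g, IsH1ZeroOn G B v g → ∫⁻ x in G, ‖v x‖ₑ ^ 2 ≤ C * ∫⁻ x in G, ‖g x‖ₑ ^ 2)
    {φ : Space d → ℝ} (hφ : φ ∈ plSpace K (closure G) B) :
    ∫ x in G, φ x ^ 2 ≤ C.toReal * ∫ x in G, ‖gradVec φ x‖ ^ 2 := by
  have := hM.isFiniteMeasure
  have h1 := h φ _ (isH1ZeroOn_pl hM hG hB hφ)
  have e1 : ∫⁻ x in G, ‖φ x‖ₑ ^ 2 = ENNReal.ofReal (∫ x in G, φ x ^ 2) := by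
    rw [ofReal_integral_eq_lintegral_ofReal (memLp_pl hM hφ _).integrable_sq
      (.of_forall fun x => sq_nonneg _)]
    congr 1
    ext x
    rw [← sq_abs, ENNReal.ofReal_pow (abs_nonneg _), ← Real.norm_eq_abs, ofReal_norm]
  have e2 : ∫⁻ x in G, ‖gradVec φ x‖ₑ ^ 2 = ENNReal.ofReal (∫ x in G, ‖gradVec φ x‖ ^ 2) := by
    rw [ofReal_integral_eq_lintegral_ofReal (memLp_gradVec hM hφ).norm.integrable_sq
      (.of_forall fun x => sq_nonneg _)]
    congr 1
    ext x
    rw [ENNReal.ofReal_pow (norm_nonneg _), ofReal_norm]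
  rw [e1, e2, ← ENNReal.ofReal_toReal hC, ← ENNReal.ofReal_mul ENNReal.toReal_nonneg,
    ENNReal.ofReal_le_ofReal_iff (mul_nonneg ENNReal.toReal_nonneg
      (integral_nonneg fun _ => sq_nonneg _))] at h1
  exact h1

lemma norm_sq_eq_sum_component {V : Submodule ℝ (Space d → ℝ)} (hu : u ∈ tensor U V)
    (x : Space d) : ‖u x‖ ^ 2 = ∑ k, component U u k x ^ 2 := by
  have h := (stdOrthonormalBasis ℝ U).sum_sq_norm_inner_right ⟨u x, (mem_tensor.mp hu).1 x⟩
  rw [show ‖u x‖ = ‖(⟨u x, (mem_tensor.mp hu).1 x⟩ : U)‖ from rfl, ← h]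
  refine Finset.sum_congr rfl fun k _ => ?_
  rw [Real.norm_eq_abs, sq_abs]
  rfl

/-- The scalar inequality holds for every component with the same constant, and both sides are sums
over components. -/
lemma integral_norm_sq_le (hM : IsMeshed K G) (hG : surface d (frontier G) < ⊤)
    (hB : MeasurableSet B) {C : ℝ≥0∞} (hC : C ≠ ⊤)
    (h : ∀ v g, IsH1ZeroOn G B v g → ∫⁻ x in G, ‖v x‖ₑ ^ 2 ≤ C * ∫⁻ x in G, ‖g x‖ₑ ^ 2)
    (hu : u ∈ tensor U (plSpace K (closure G) B)) :
    ∫ x in G, ‖u x‖ ^ 2 ≤ C.toReal * gradForm G u u := by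
  have := hM.isFiniteMeasure
  have hk := fun k => sq_integral_le_of_poincare hM hG hB hC h ((mem_tensor.mp hu).2 k)
  have e1 : ∫ x in G, ‖u x‖ ^ 2 = ∑ k, ∫ x in G, component U u k x ^ 2 := by
    rw [← integral_finsetSum _ fun k _ => (memLp_pl hM ((mem_tensor.mp hu).2 k) _).integrable_sq]
    simp_rw [norm_sq_eq_sum_component hu]
  have e2 : gradForm G u u = ∑ k, ∫ x in G, ‖gradVec (component U u k) x‖ ^ 2 := by
    rw [← integral_finsetSum _ fun k _ =>
      (memLp_gradVec hM ((mem_tensor.mp hu).2 k)).norm.integrable_sq]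
    apply integral_congr_ae
    filter_upwards [hM.ae_regular] with x hx
    rw [sum_inner_partialDeriv hu hu hx, Finset.sum_comm]
    refine Finset.sum_congr rfl fun k _ => ?_
    rw [norm_gradVec_sq]
    simp only [gradComp, sq]
  rw [e1, e2, Finset.mul_sum]
  exact Finset.sum_le_sum fun k _ => hk k

end Poincare

/-! ### Coefficients on the subdomains -/

section Coefficients

variable {d : ℕ} {D : DiscreteProblem d}

instance DiscreteProblem.finiteDimensional_U (D : DiscreteProblem d) : FiniteDimensional ℝ D.U :=
  finiteDimensional_spectralSpace D.N D.τ D.κ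

lemma ae_bound_of_memLp_top {α : Type*} [MeasurableSpace α] {μ : Measure α} {h : α → ℝ}
    (hh : MemLp h ⊤ μ) : ∃ C, ∀ᵐ x ∂μ, |h x| ≤ C := by
  have h2 : eLpNormEssSup h μ < ⊤ := by simpa using hh.2
  refine ⟨(eLpNormEssSup h μ).toReal, ?_⟩
  filter_upwards [enorm_ae_le_eLpNormEssSup h μ] with x hx
  have := ENNReal.toReal_mono h2.ne hx
  simpa using this

lemma exists_isCoefficientOn (hcoef : D.CoefficientAssumption) :
    ∃ M m₂ m₃, 0 < M ∧ D.Cp * ENNReal.ofReal m₃ < ENNReal.ofReal m₂ ∧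
      ∀ G ⊆ D.Ω, IsCoefficientOn D.toProblem G M m₂ m₃ := by
  obtain ⟨hα, hβ, h0, h₁, h₂, h₃, hnn, hb₁, hb₂, hb₃, hmain, hC⟩ := hcoef
  obtain ⟨C₁, hC₁⟩ := ae_bound_of_memLp_top hb₁
  obtain ⟨C₂, hC₂⟩ := ae_bound_of_memLp_top hb₂
  obtain ⟨C₃, hC₃⟩ := ae_bound_of_memLp_top hb₃
  -- Explicit bounds are needed since the reals are only conditionally complete.
  have hs₂ := ae_essInf_le (f := h₂) (μ := volume.restrict D.Ω)
    ⟨-C₂, by simpa using hC₂.mono fun x hx => (abs_le.mp hx).1⟩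
  have hs₃ := ae_le_essSup (f := h₃) (μ := volume.restrict D.Ω)
    ⟨C₃, by simpa using hC₃.mono fun x hx => (abs_le.mp hx).2⟩
  -- The blanks are ess inf h₂ and ess sup h₃, read off from `hC`; the maximum with 1 makes the
  -- Lipschitz bound positive.
  refine ⟨max C₁ 1, _, _, by positivity, hC, fun G hG => ?_⟩
  have hmono := ae_mono (Measure.restrict_mono_set (volume : Measure (Space d)) hG)
  refine ⟨fun y z => (hα y z).mono_set hG, fun y z => (hβ y z).mono_set hG, hmono ?_, hmono ?_⟩
  · filter_upwards [h0, hC₁, hmain] with x hx hx₁ hm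
    have hle : ∀ s : ℝ, 0 ≤ s → h₁ x * s ≤ max C₁ 1 * s := fun s hs =>
      mul_le_mul_of_nonneg_right ((le_abs_self _).trans (hx₁.trans (le_max_left _ _))) hs
    exact ⟨⟨by positivity, hx.1, fun y y' z z' => ((hm y y' z z').1).trans (hle _ (by positivity))⟩,
      ⟨by positivity, hx.2, fun y y' z z' => ((hm y y' z z').2.1).trans (hle _ (by positivity))⟩⟩
  · filter_upwards [hmain, hs₂, hs₃] with x hm h2 h3 y y' z z'
    refine le_trans ?_ (hm y y' z z').2.2
    exact sub_le_sub (mul_le_mul_of_nonneg_right h2 (sq_nonneg _))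
      (mul_le_mul_of_nonneg_right h3 (sq_nonneg _))

lemma exists_coercive (hd : 1 ≤ d) (hdom : D.DomainAssumption) (hmesh : D.MeshAssumption)
    {m₂ m₃ : ℝ} (hC : D.Cp * ENNReal.ofReal m₃ < ENNReal.ofReal m₂) (i : Fin 2) :
    ∃ c > 0, ∀ u ∈ D.Wsub i, c * gradForm (D.sub i) u u ≤
      m₂ * gradForm (D.sub i) u u - m₃ * ∫ x in D.sub i, ‖u x‖ ^ 2 := by
  have hm₂ : 0 < m₂ := ENNReal.ofReal_pos.mp (bot_lt_of_lt hC)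
  -- For m₃ ≤ 0 the gradient term alone suffices, and finiteness of the Poincaré constant is not
  -- needed.
  rcases le_or_gt m₃ 0 with hm₃ | hm₃
  · refine ⟨m₂, hm₂, fun u _ => ?_⟩
    have : m₃ * ∫ x in D.sub i, ‖u x‖ ^ 2 ≤ 0 :=
      mul_nonpos_of_nonpos_of_nonneg hm₃ (integral_nonneg fun _ => sq_nonneg _)
    linarith
  · have h1 : poincareConst (D.sub i) (frontier (D.sub i) \ D.Γ) < ENNReal.ofReal (m₂ / m₃) := by
      refine lt_of_le_of_lt ((le_iSup (fun i => poincareConst (D.sub i)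
        (frontier (D.sub i) \ D.Γ)) i).trans le_sup_right : _ ≤ D.Cp) ?_
      rw [ENNReal.ofReal_div_of_pos hm₃]
      exact (ENNReal.lt_div_iff_mul_lt (.inl (by simp [hm₃])) (.inl (by simp))).mpr hC
    -- Attainment of the infimum is not needed: the strict inequality leaves room for an admissible
    -- constant `C` with C m₃ < m₂.
    obtain ⟨C, hCmem, hClt⟩ := sInf_lt_iff.mp h1
    have hCtop : C ≠ ⊤ := hClt.ne_top
    have hCr : C.toReal * m₃ < m₂ := by
      rw [← lt_div_iff₀ hm₃]
      exact (ENNReal.lt_ofReal_iff_toReal_lt hCtop).mp hClt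
    refine ⟨m₂ - C.toReal * m₃, by linarith, fun u hu => ?_⟩
    have h2 := integral_norm_sq_le (DiscreteProblem.isMeshed_sub hdom hmesh i)
      (surface_frontier_lt_top (hdom.lipschitz_sub i) hd)
      (isClosed_frontier.measurableSet.diff (DiscreteProblem.measurableSet_interface D))
      hCtop hCmem hu
    nlinarith
end Coefficients

/-! ### Traces, extensions and the elliptic extension -/

section Tensor

variable {d : ℕ} {U : Submodule ℝ TimeL2} {V V' : Submodule ℝ (Space d → ℝ)}

lemma smul_mem_tensor {φ : Space d → ℝ} (hφ : φ ∈ V) {ψ : TimeL2} (hψ : ψ ∈ U) :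
    (fun x => φ x • ψ) ∈ tensor U V :=
  Submodule.subset_span ⟨φ, hφ, ψ, hψ, rfl⟩

lemma tensor_mono (h : V ≤ V') : tensor U V ≤ tensor U V' :=
  Submodule.span_mono fun _ ⟨φ, hφ, ψ, hψ, e⟩ => ⟨φ, h hφ, ψ, hψ, e⟩

lemma plSpace_anti (K : Geometry.SimplicialComplex ℝ (Space d)) (G : Set (Space d))
    {B B' : Set (Space d)} (h : B ⊆ B') : plSpace K G B' ≤ plSpace K G B :=
  fun _ hv => ⟨hv.1, hv.2.1, fun x hx => hv.2.2 x (h hx)⟩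

variable {K : Geometry.SimplicialComplex ℝ (Space d)} {G B B' : Set (Space d)}
  [FiniteDimensional ℝ U] {w : Space d → TimeL2}

lemma integrable_sum_fderiv_smul_partialDeriv (hM : IsMeshed K G)
    (hw : w ∈ tensor U (plSpace K (closure G) B)) {φ : Space d → ℝ}
    (hφ : φ ∈ plSpace K (closure G) B) :
    IntegrableOn (fun x => ∑ j, fderiv ℝ φ x (EuclideanSpace.single j 1) • partialDeriv w j x)
      G := by
  have := hM.isFiniteMeasure
  obtain ⟨M, hb⟩ := exists_partialDeriv_bound hM hw
  obtain ⟨M', hb'⟩ := pl_fderiv_bound hM.finite hφ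
  refine Integrable.of_bound (C := ∑ _ : Fin d, M' * M) ?_ ?_
  · have hmeas : StronglyMeasurable fun x => ∑ j, fderiv ℝ φ x (EuclideanSpace.single j 1) •
        ∑ k, gradComp U w j k x • timeBasis U k :=
      Finset.stronglyMeasurable_fun_sum _ fun j _ =>
        (measurable_fderiv_apply_const ℝ φ _).stronglyMeasurable.smul
          (Finset.stronglyMeasurable_fun_sum _ fun k _ =>
            (measurable_gradComp w j k).stronglyMeasurable.smul_const _)
    refine ⟨_, hmeas, ?_⟩
    filter_upwards [hM.ae_regular] with x hx
    simp_rw [partialDeriv_eq hw hx]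
  · filter_upwards [hM.ae_regular] with x hx
    refine (norm_sum_le _ _).trans (Finset.sum_le_sum fun j _ => ?_)
    rw [norm_smul]
    refine mul_le_mul ?_ (hb x hx j) (norm_nonneg _) ((norm_nonneg _).trans (hb' x hx))
    refine ((fderiv ℝ φ x).le_opNorm _).trans ?_
    simpa using hb' x hx

lemma gradForm_smul_right (hM : IsMeshed K G)
    (hw : w ∈ tensor U (plSpace K (closure G) B)) {φ : Space d → ℝ}
    (hφ : φ ∈ plSpace K (closure G) B) (ψ : TimeL2) :
    gradForm G w (fun x => φ x • ψ) = inner ℝ ψ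
      (∫ x in G, ∑ j, fderiv ℝ φ x (EuclideanSpace.single j 1) • partialDeriv w j x) := by
  rw [← integral_inner (integrable_sum_fderiv_smul_partialDeriv hM hw hφ)]
  apply integral_congr_ae
  filter_upwards [hM.ae_regular] with x hx
  rw [inner_sum]
  refine Finset.sum_congr rfl fun j _ => ?_
  have h := (pl_differentiableAt hφ hx).hasFDerivAt.smul_const ψ
  rw [inner_smul_right]
  conv_lhs => rw [partialDeriv, partialDeriv, h.fderiv, ContinuousLinearMap.smulRight_apply,
    inner_smul_right, real_inner_comm]
  rfl

/-- The integrand takes values in `U`, so the integral is orthogonal to the complement of `U`. -/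
lemma integral_sum_fderiv_smul_mem (hM : IsMeshed K G)
    (hw : w ∈ tensor U (plSpace K (closure G) B)) {φ : Space d → ℝ}
    (hφ : φ ∈ plSpace K (closure G) B) :
    ∫ x in G, ∑ j, fderiv ℝ φ x (EuclideanSpace.single j 1) • partialDeriv w j x ∈ U := by
  have hcl : IsClosed (U : Set TimeL2) := U.closed_of_finiteDimensional
  set I := ∫ x in G, ∑ j, fderiv ℝ φ x (EuclideanSpace.single j 1) • partialDeriv w j x
  have h : Uᗮᗮ = U := U.orthogonal_orthogonal
  rw [← h, Submodule.mem_orthogonal]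
  intro ψ hψ
  rw [← integral_inner (integrable_sum_fderiv_smul_partialDeriv hM hw hφ)]
  apply integral_eq_zero_of_ae
  filter_upwards [hM.ae_regular] with x hx
  have : ∑ j, fderiv ℝ φ x (EuclideanSpace.single j 1) • partialDeriv w j x ∈ U :=
    U.sum_mem fun j _ => U.smul_mem _ (partialDeriv_mem hw hx j)
  exact (Submodule.mem_orthogonal' _ _).mp hψ _ this

/-- The equation in L²(ℝ) and the scalar equation tested with tensors are the same: in one direction
by linearity, in the other by taking φ ⊗ ψ with ψ the vector integral itself, which is admissible
because it lies in `U`. -/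
lemma forall_integral_eq_zero_iff (hM : IsMeshed K G) (hB : B ⊆ B')
    (hw : w ∈ tensor U (plSpace K (closure G) B)) :
    (∀ φ ∈ plSpace K (closure G) B',
      ∫ x in G, ∑ j, fderiv ℝ φ x (EuclideanSpace.single j 1) • partialDeriv w j x = 0) ↔
      ∀ v ∈ tensor U (plSpace K (closure G) B'), gradForm G w v = 0 := by
  have hle := plSpace_anti K (closure G) hB
  constructor
  · intro h v hv
    let g := gradBilin hM U B ⟨w, hw⟩
    suffices hs : ∀ (v) (hv : v ∈ tensor U (plSpace K (closure G) B')),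
      g ⟨v, tensor_mono hle hv⟩ = 0 from hs v hv
    intro v hv
    induction hv using Submodule.span_induction with
    | mem v hv =>
      obtain ⟨φ, hφ, ψ, hψ, rfl⟩ := hv
      change gradForm G w _ = 0
      rw [gradForm_smul_right hM hw (hle hφ), h φ hφ, inner_zero_right]
    | zero => exact map_zero g
    | add u v hu hv h1 h2 =>
      have := map_add g ⟨u, tensor_mono hle hu⟩ ⟨v, tensor_mono hle hv⟩
      rw [h1, h2, add_zero] at this
      exact this
    | smul c u hu h1 =>
      have := map_smul g c ⟨u, tensor_mono hle hu⟩
      rw [h1, smul_zero] at this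
      exact this
  · intro h φ hφ
    have hI := integral_sum_fderiv_smul_mem hM hw (hle hφ)
    have h1 := h _ (smul_mem_tensor hφ hI)
    rw [gradForm_smul_right hM hw (hle hφ)] at h1
    exact inner_self_eq_zero.mp h1

end Tensor

/-- The assumptions on the problem and its discretization, with constant bounds of the
coefficients. -/
structure DiscreteProblem.IsAdmissible {d : ℕ} (D : DiscreteProblem d) (M m₂ m₃ : ℝ) : Prop where
  two_le : 2 ≤ d
  dom : D.DomainAssumption
  mesh : D.MeshAssumption
  bound_pos : 0 < M
  coef : ∀ G ⊆ D.Ω, IsCoefficientOn D.toProblem G M m₂ m₃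
  poincare : D.Cp * ENNReal.ofReal m₃ < ENNReal.ofReal m₂
  source : D.SourceAssumption
  matching : D.MatchingTraces

namespace DiscreteProblem

variable {d : ℕ} {D : DiscreteProblem d} {M m₂ m₃ : ℝ}

lemma U_le_bandLimited (D : DiscreteProblem d) : D.U ≤ bandLimited D.κ :=
  spectralSpace_le_bandLimited D.N D.τ D.κ

lemma interface_subset_frontier (D : DiscreteProblem d) (i : Fin 2) :
    D.Γ ⊆ frontier (D.sub i) := by
  fin_cases i
  · exact fun x hx => hx.1.1
  · exact fun x hx => hx.1.2

lemma trace_apply_of_mem {u : Space d → TimeL2} {x : Space d} (hx : x ∈ D.Γ) :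
    D.trace u x = u x := indicator_of_mem hx u

lemma trace_apply_of_notMem {u : Space d → TimeL2} {x : Space d} (hx : x ∉ D.Γ) :
    D.trace u x = 0 := indicator_of_notMem hx u

/-- Γ and ∂Ω_i \ Γ make up ∂Ω_i. Hence the test space of the Dirichlet problem is the kernel of the
trace, as the abstract lemmas require. -/
lemma mem_Wsub0_iff {i : Fin 2} {u : Space d → TimeL2} :
    u ∈ D.Wsub0 i ↔ u ∈ D.Wsub i ∧ D.trace u = 0 := by
  constructor
  · intro hu
    refine ⟨tensor_mono (plSpace_anti _ _ sdiff_subset) hu, ?_⟩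
    ext1 x
    by_cases hx : x ∈ D.Γ
    · rw [trace_apply_of_mem hx]
      exact (tensor_eq_zero_iff hu).mpr fun k =>
        ((mem_tensor.mp hu).2 k).2.2 x (D.interface_subset_frontier i hx)
    · rw [trace_apply_of_notMem hx]; rfl
  · rintro ⟨hu, h0⟩
    refine mem_tensor.mpr ⟨(mem_tensor.mp hu).1, fun k => ?_⟩
    have hk := (mem_tensor.mp hu).2 k
    refine ⟨hk.1, hk.2.1, fun x hx => ?_⟩
    by_cases hxΓ : x ∈ D.Γ
    · have h1 : u x = 0 := by
        rw [← trace_apply_of_mem (D := D) (u := u) hxΓ, h0]; rfl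
      simp [component, h1]
    · exact hk.2.2 x ⟨hx, hxΓ⟩

lemma eq_zero_of_mem_Wsub {i : Fin 2} {u : Space d → TimeL2} (hu : u ∈ D.Wsub i) {x : Space d}
    (hx : x ∈ frontier (D.sub i)) (hxΓ : x ∉ D.Γ) : u x = 0 :=
  (tensor_eq_zero_iff hu).mpr fun k => ((mem_tensor.mp hu).2 k).2.2 x ⟨hx, hxΓ⟩

lemma Z_eq (htr : D.MatchingTraces) (i : Fin 2) : D.Z = (D.Wsub i).map D.trace := by
  fin_cases i
  · rfl
  · exact htr

/-- The trace as a map onto the discrete trace space. -/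
def traceL (htr : D.MatchingTraces) (i : Fin 2) : D.Wsub i →ₗ[ℝ] D.Z :=
  (D.trace.domRestrict (D.Wsub i)).codRestrict D.Z fun u => by
    rw [Z_eq htr i]; exact ⟨u, u.2, rfl⟩

lemma coe_traceL (htr : D.MatchingTraces) (i : Fin 2) (u : D.Wsub i) :
    (traceL htr i u : Space d → TimeL2) = D.trace u := rfl

lemma traceL_eq_zero_iff (htr : D.MatchingTraces) {i : Fin 2} {u : D.Wsub i} :
    traceL htr i u = 0 ↔ (u : Space d → TimeL2) ∈ D.Wsub0 i := by
  rw [mem_Wsub0_iff, ← coe_traceL htr, Subtype.ext_iff]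
  exact ⟨fun h => ⟨u.2, h⟩, fun h => h.2⟩

/-- A right inverse of the trace as a map from the discrete trace space. -/
def extL {i : Fin 2} {R : (Space d → TimeL2) →ₗ[ℝ] (Space d → TimeL2)} (hR : D.IsExtension i R) :
    D.Z →ₗ[ℝ] D.Wsub i :=
  (R.domRestrict D.Z).codRestrict (D.Wsub i) fun η => (hR η η.2).1

lemma traceL_extL (htr : D.MatchingTraces) {i : Fin 2}
    {R : (Space d → TimeL2) →ₗ[ℝ] (Space d → TimeL2)} (hR : D.IsExtension i R) (z : D.Z) :
    traceL htr i (extL hR z) = z := Subtype.ext (hR z z.2).2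

/-- Off Γ both sides vanish. So boundary integrals of `z` can be computed with a function that is
Lipschitz up to the boundary. -/
lemma extL_eq_on_frontier {i : Fin 2} {R : (Space d → TimeL2) →ₗ[ℝ] (Space d → TimeL2)}
    (hR : D.IsExtension i R) (z : D.Z) {x : Space d} (hx : x ∈ frontier (D.sub i)) :
    (extL hR z : Space d → TimeL2) x = (z : Space d → TimeL2) x := by
  have h := (hR z z.2).2
  by_cases hxΓ : x ∈ D.Γ
  · have := congrFun h x
    rwa [trace_apply_of_mem hxΓ] at this
  · have := congrFun h x
    rw [trace_apply_of_notMem hxΓ] at this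
    rw [← this]
    exact eq_zero_of_mem_Wsub (extL hR z).2 hx hxΓ

/-! ### The Hilbert transform on the trace space -/

lemma hilbert_mem_U {v : TimeL2} (hv : v ∈ D.U) : hilbert v ∈ D.U := hilbert_mem_spectralSpace hv

lemma hilbert_mem_tensor {V : Submodule ℝ (Space d → ℝ)} {u : Space d → TimeL2}
    (hu : u ∈ tensor D.U V) : (fun x => hilbert (u x)) ∈ tensor D.U V := by
  let H : D.U →ₗ[ℝ] TimeL2 := multL isSymbol_hilbert D.U_le_bandLimited
  have h : (fun x => hilbert (u x)) =
      ∑ k, fun x => component D.U u k x • hilbert (timeBasis D.U k) := by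
    ext1 x
    rw [Finset.sum_apply]
    have h1 : (⟨u x, (mem_tensor.mp hu).1 x⟩ : D.U) =
        ∑ k, component D.U u k x • ⟨timeBasis D.U k, timeBasis_mem D.U k⟩ := by
      ext1
      simpa using tensor_apply hu x
    change H ⟨u x, (mem_tensor.mp hu).1 x⟩ = _
    rw [h1, map_sum]
    simp_rw [map_smul]
    rfl
  rw [h]
  exact Submodule.sum_mem _ fun k _ =>
    smul_mem_tensor ((mem_tensor.mp hu).2 k) (hilbert_mem_U (timeBasis_mem D.U k))

lemma mem_U_of_mem_Z {z : Space d → TimeL2} (hz : z ∈ D.Z) (x : Space d) : z x ∈ D.U := by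
  obtain ⟨w, hw, rfl⟩ := hz
  by_cases hx : x ∈ D.Γ
  · rw [trace_apply_of_mem hx]; exact (mem_tensor.mp hw).1 x
  · rw [trace_apply_of_notMem hx]; exact D.U.zero_mem

lemma hilbert_mem_Z {z : Space d → TimeL2} (hz : z ∈ D.Z) : (fun x => hilbert (z x)) ∈ D.Z := by
  obtain ⟨w, hw, rfl⟩ := hz
  refine ⟨_, hilbert_mem_tensor hw, ?_⟩
  ext1 x
  by_cases hx : x ∈ D.Γ
  · rw [trace_apply_of_mem hx, trace_apply_of_mem hx]
  · rw [trace_apply_of_notMem hx, trace_apply_of_notMem hx]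
    exact (map_zero (multL isSymbol_hilbert D.U_le_bandLimited)).symm

/-- The Hilbert transform on the discrete trace space. -/
def hilbertZ (D : DiscreteProblem d) : D.Z →ₗ[ℝ] D.Z where
  toFun z := ⟨fun x => hilbert (z.1 x), hilbert_mem_Z z.2⟩
  map_add' z z' := Subtype.ext <| funext fun x =>
    timeMult_add isSymbol_hilbert (D.U_le_bandLimited (mem_U_of_mem_Z z.2 x))
      (D.U_le_bandLimited (mem_U_of_mem_Z z'.2 x))
  map_smul' c z := Subtype.ext <| funext fun x =>
    timeMult_smul isSymbol_hilbert (D.U_le_bandLimited (mem_U_of_mem_Z z.2 x)) c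

lemma coe_rotate (φ : ℝ) (z : D.Z) :
    ((Real.cos φ • z - Real.sin φ • hilbertZ D z : D.Z) : Space d → TimeL2) = rotate φ z := rfl

/-! ### The problems on the subdomains -/

namespace IsAdmissible

variable (h : D.IsAdmissible M m₂ m₃)
include h

lemma meshed (i : Fin 2) : IsMeshed D.K (D.sub i) := isMeshed_sub h.dom h.mesh i

lemma finiteDimensional_Wsub (i : Fin 2) : FiniteDimensional ℝ (D.Wsub i) := by
  have : FiniteDimensional ℝ (D.Vsub i) :=
    finiteDimensional_plSpace (h.meshed i).finite (h.meshed i).resolved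
  exact finiteDimensional_tensor

lemma finiteDimensional_Z : FiniteDimensional ℝ D.Z := by
  have := h.finiteDimensional_Wsub 0
  exact inferInstanceAs (FiniteDimensional ℝ ((D.Wsub 0).map D.trace))

/-- The Dirichlet form on `Wᵢʰ`. -/
def grad (i : Fin 2) : LinearMap.BilinForm ℝ (D.Wsub i) :=
  gradBilin (h.meshed i) D.U (frontier (D.sub i) \ D.Γ)

lemma isInner_grad (i : Fin 2) : IsInner (h.grad i) :=
  isInner_gradBilin (h.meshed i) (reaches_dirichlet_boundary h.dom i)

lemma memLp_source (i : Fin 2) : MemLp (fun p : Space d × ℝ => D.f p.1 p.2) 2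
    ((volume.restrict (D.sub i)).prod volume) :=
  h.source.mono_measure (Measure.prod_mono (Measure.restrict_mono_set _ (sub_subset h.dom i)) le_rfl)

/-- The residual `a_i(u, ·) - (f, ·)` on `Wᵢʰ`. -/
def residual (i : Fin 2) (u : D.Wsub i) : D.Wsub i →ₗ[ℝ] ℝ :=
  formL (h.meshed i) D.U_le_bandLimited (h.coef _ (sub_subset h.dom i)) u -
    sourceL (D := D.toProblem) (h.meshed i) (h.memLp_source i) D.U (frontier (D.sub i) \ D.Γ)

lemma residual_apply (i : Fin 2) (u v : D.Wsub i) :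
    h.residual i u v = D.form (D.sub i) u v - D.source (D.sub i) v :=
  congrArg (· - D.source (D.sub i) v)
    (formL_apply (h.meshed i) D.U_le_bandLimited (h.coef _ (sub_subset h.dom i)) u v)

lemma isStronglyMonotone_residual (i : Fin 2) :
    IsStronglyMonotone (h.grad i) (h.residual i) :=
  isStronglyMonotone_formL (h.meshed i) D.U_le_bandLimited (h.coef _ (sub_subset h.dom i))
    h.bound_pos (h.isInner_grad i) _
    (exists_coercive (one_le_two.trans h.two_le) h.dom h.mesh h.poincare i)

lemma isDirichletSolution_iff {i : Fin 2} {z : D.Z} {u : Space d → TimeL2} :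
    D.IsDirichletSolution i z u ↔ ∃ hu : u ∈ D.Wsub i, traceL h.matching i ⟨u, hu⟩ = z ∧
      ∀ v, traceL h.matching i v = 0 → h.residual i ⟨u, hu⟩ v = 0 := by
  constructor
  · rintro ⟨hu, ht, hv⟩
    refine ⟨hu, Subtype.ext ht, fun v hv0 => ?_⟩
    rw [residual_apply, sub_eq_zero]
    exact hv v ((traceL_eq_zero_iff _).mp hv0)
  · rintro ⟨hu, ht, hv⟩
    refine ⟨hu, congrArg Subtype.val ht, fun v hv0 => ?_⟩
    have := hv ⟨v, (mem_Wsub0_iff.mp hv0).1⟩ ((traceL_eq_zero_iff _).mpr hv0)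
    rwa [residual_apply, sub_eq_zero] at this

/-- Serves both the nonlinear Dirichlet problem and the elliptic extension; `R` supplies a function
with the given trace. -/
lemma existsUnique_lift (i : Fin 2) {R : (Space d → TimeL2) →ₗ[ℝ] (Space d → TimeL2)}
    (hR : D.IsExtension i R) {a : D.Wsub i → D.Wsub i →ₗ[ℝ] ℝ}
    (ha : IsStronglyMonotone (h.grad i) a) (z : D.Z) :
    ∃! u, ∃ hu : u ∈ D.Wsub i, traceL h.matching i ⟨u, hu⟩ = z ∧
      ∀ v, traceL h.matching i v = 0 → a ⟨u, hu⟩ v = 0 := by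
  have := h.finiteDimensional_Wsub i
  obtain ⟨u, ⟨h1, h2⟩, h3⟩ := existsUnique_dirichlet (h.isInner_grad i) ha
    (traceL h.matching i) (r := extL hR z)
  rw [traceL_extL] at h1
  refine ⟨u, ⟨u.2, h1, h2⟩, ?_⟩
  rintro u' ⟨hu', h1', h2'⟩
  exact congrArg Subtype.val (h3 ⟨u', hu'⟩ ⟨by rw [traceL_extL, h1'], h2'⟩)

lemma existsUnique_isDirichletSolution (i : Fin 2)
    {R : (Space d → TimeL2) →ₗ[ℝ] (Space d → TimeL2)}
    (hR : D.IsExtension i R) (z : D.Z) : ∃! u, D.IsDirichletSolution i z u := by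
  simp_rw [h.isDirichletSolution_iff]
  exact h.existsUnique_lift i hR (h.isStronglyMonotone_residual i) z

lemma isStronglyMonotone_grad (i : Fin 2) :
    IsStronglyMonotone (h.grad i) (fun u => h.grad i u) := by
  refine ⟨1, one_pos, 1, one_pos, fun x y => ?_, fun x y v => ?_⟩
  · rw [one_mul, ← LinearMap.sub_apply, ← map_sub]
  · rw [one_mul, ← LinearMap.sub_apply, ← map_sub]
    exact (h.isInner_grad i).cauchy_schwarz _ _

lemma isEllipticExtension_iff {z : D.Z} {w : Space d → TimeL2} :
    D.IsEllipticExtension z w ↔ ∃ hw : w ∈ D.Wsub 1, traceL h.matching 1 ⟨w, hw⟩ = z ∧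
      ∀ v, traceL h.matching 1 v = 0 → h.grad 1 ⟨w, hw⟩ v = 0 := by
  have key : ∀ hw : w ∈ D.Wsub 1, _ := fun hw => forall_integral_eq_zero_iff (h.meshed 1)
    (B' := frontier (D.sub 1)) (sdiff_subset : frontier (D.sub 1) \ D.Γ ⊆ _) hw
  constructor
  · rintro ⟨hw, ht, hv⟩
    exact ⟨hw, Subtype.ext ht, fun v hv0 => (key hw).mp hv v ((traceL_eq_zero_iff _).mp hv0)⟩
  · rintro ⟨hw, ht, hv⟩
    exact ⟨hw, congrArg Subtype.val ht, (key hw).mpr fun v hv0 =>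
      hv ⟨v, (mem_Wsub0_iff.mp hv0).1⟩ ((traceL_eq_zero_iff _).mpr hv0)⟩

lemma existsUnique_isEllipticExtension
    {R : (Space d → TimeL2) →ₗ[ℝ] (Space d → TimeL2)}
    (hR : D.IsExtension 1 R) (z : D.Z) : ∃! w, D.IsEllipticExtension z w := by
  simp_rw [h.isEllipticExtension_iff]
  exact h.existsUnique_lift 1 hR (h.isStronglyMonotone_grad 1) z

end IsAdmissible

end DiscreteProblem

/-! ### The preconditioners -/

lemma IsInner.compl₁₂ {E F : Type*} [AddCommGroup E] [Module ℝ E] [AddCommGroup F] [Module ℝ F]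
    {B : LinearMap.BilinForm ℝ F} (hB : IsInner B) {T : E →ₗ[ℝ] F}
    (hT : ∀ e, T e = 0 → e = 0) : IsInner (B.compl₁₂ T T) :=
  ⟨fun _ _ => hB.symm _ _, fun x hx => hB.pos _ fun h => hx (hT x h)⟩

lemma IsInner.add_nonneg {E : Type*} [AddCommGroup E] [Module ℝ E]
    {B B' : LinearMap.BilinForm ℝ E} (hB : IsInner B) (hs : ∀ x y, B' x y = B' y x)
    (hn : ∀ x, 0 ≤ B' x x) : IsInner (B' + B) :=
  ⟨fun x y => by rw [LinearMap.add_apply, LinearMap.add_apply, LinearMap.add_apply,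
      LinearMap.add_apply, hs, hB.symm],
    fun x hx => by
      rw [LinearMap.add_apply, LinearMap.add_apply]
      exact add_pos_of_nonneg_of_pos (hn x) (hB.pos x hx)⟩

section PointBilin

variable {d : ℕ} {K : Geometry.SimplicialComplex ℝ (Space d)} {G B : Set (Space d)}
  {U : Submodule ℝ TimeL2} [FiniteDimensional ℝ U]

lemma pointBilin_symm (hM : IsMeshed K G) (μ : Measure (Space d)) [IsFiniteMeasure μ]
    (S : U →ₗ[ℝ] TimeL2) (u v : tensor U (plSpace K (closure G) B)) :
    pointBilin hM μ S S B u v = pointBilin hM μ S S B v u :=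
  integral_congr_ae (.of_forall fun _ => real_inner_comm _ _)

lemma pointBilin_self_nonneg (hM : IsMeshed K G) (μ : Measure (Space d)) [IsFiniteMeasure μ]
    (S : U →ₗ[ℝ] TimeL2) (u : tensor U (plSpace K (closure G) B)) :
    0 ≤ pointBilin hM μ S S B u u :=
  integral_nonneg fun _ => real_inner_self_nonneg

end PointBilin

lemma DiscreteProblem.le_normZ {d : ℕ} {D : DiscreteProblem d} (i : Fin 2) (z : D.Z) :
    √(∫ x in frontier (D.sub i), ‖(z : Space d → TimeL2) x‖ ^ 2 ∂(surface d)) ≤ D.normZ i z := by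
  refine Real.sqrt_le_sqrt ?_
  have h1 : 0 ≤ ∫ x in D.Γ, sobolevSq (1 / 4) ((z : Space d → TimeL2) x) ∂(surface d) :=
    integral_nonneg fun x => sobolevSq_nonneg _ _
  have h2 : 0 ≤ ∫ x in frontier (D.sub i), ∫ y in frontier (D.sub i),
      ‖(z : Space d → TimeL2) x - (z : Space d → TimeL2) y‖ ^ 2 / dist x y ^ d
      ∂(surface d) ∂(surface d) :=
    integral_nonneg fun x => integral_nonneg fun y => by positivity
  linarith

namespace DiscreteProblem.IsAdmissible

variable {d : ℕ} {D : DiscreteProblem d} {M m₂ m₃ : ℝ} (h : D.IsAdmissible M m₂ m₃)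
include h

lemma isEllipticExtension_H₂ {R : (Space d → TimeL2) →ₗ[ℝ] (Space d → TimeL2)}
    (hR : D.IsExtension 1 R) (z : D.Z) : D.IsEllipticExtension z (D.H₂ z) :=
  Classical.epsilon_spec (h.existsUnique_isEllipticExtension hR z).exists

/-- The elliptic extension as a linear map. -/
def ellipticL {R : (Space d → TimeL2) →ₗ[ℝ] (Space d → TimeL2)} (hR : D.IsExtension 1 R) :
    D.Z →ₗ[ℝ] D.Wsub 1 where
  toFun z := ⟨D.H₂ z, (h.isEllipticExtension_H₂ hR z).1⟩
  map_add' z z' := by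
    -- `H₂` is a choice; uniqueness forces it to be additive, as the sum of two extensions extends
    -- the sum.
    refine Subtype.ext ((h.existsUnique_isEllipticExtension hR (z + z')).unique
      (h.isEllipticExtension_H₂ hR _) (h.isEllipticExtension_iff.mpr ⟨Subtype.property _, ?_⟩))
    obtain ⟨h1, h2, h3⟩ := h.isEllipticExtension_iff.mp (h.isEllipticExtension_H₂ hR z)
    obtain ⟨h1', h2', h3'⟩ := h.isEllipticExtension_iff.mp (h.isEllipticExtension_H₂ hR z')
    refine ⟨?_, fun v hv => ?_⟩
    · exact (map_add (traceL h.matching 1) ⟨_, h1⟩ ⟨_, h1'⟩).trans (congrArg₂ (· + ·) h2 h2')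
    · have := congrArg₂ (· + ·) (h3 v hv) (h3' v hv)
      simp only [← LinearMap.add_apply, ← map_add, add_zero] at this
      exact this
  map_smul' c z := by
    refine Subtype.ext ((h.existsUnique_isEllipticExtension hR (c • z)).unique
      (h.isEllipticExtension_H₂ hR _) (h.isEllipticExtension_iff.mpr ⟨Subtype.property _, ?_⟩))
    obtain ⟨h1, h2, h3⟩ := h.isEllipticExtension_iff.mp (h.isEllipticExtension_H₂ hR z)
    refine ⟨?_, fun v hv => ?_⟩
    · exact (map_smul (traceL h.matching 1) c ⟨_, h1⟩).trans (congrArg (c • ·) h2)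
    · have := LinearMap.congr_fun (map_smul (h.grad 1) c ⟨_, h1⟩) v
      rw [LinearMap.smul_apply, h3 v hv, smul_zero] at this
      exact this

lemma isFiniteMeasure_frontier (i : Fin 2) :
    IsFiniteMeasure ((surface d).restrict (frontier (D.sub i))) :=
  ⟨by
    rw [Measure.restrict_apply_univ]
    exact surface_frontier_lt_top (h.dom.lipschitz_sub i) (one_le_two.trans h.two_le)⟩

lemma isFiniteMeasure_interface : IsFiniteMeasure ((surface d).restrict D.Γ) :=
  ⟨by
    rw [Measure.restrict_apply_univ]
    exact (measure_mono (D.interface_subset_frontier 0)).trans_lt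
      (surface_frontier_lt_top (h.dom.lipschitz_sub 0) (one_le_two.trans h.two_le))⟩

/-- The temporal part, with the same operator in both slots, is symmetric and nonnegative; the
gradient part is definite because an extension has a left inverse, the trace. -/
lemma exists_isInner_P₁ {R : (Space d → TimeL2) →ₗ[ℝ] (Space d → TimeL2)}
    (hR : D.IsExtension 1 R) :
    ∃ B : LinearMap.BilinForm ℝ D.Z, IsInner B ∧ ∀ z μ : D.Z, D.P₁ R z μ = B z μ := by
  have := (h.meshed 1).isFiniteMeasure
  let Q : LinearMap.BilinForm ℝ (D.Wsub 1) := pointBilin (h.meshed 1)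
    (volume.restrict (D.sub 1)) (multL isSymbol_halfPlus D.U_le_bandLimited)
    (multL isSymbol_halfPlus D.U_le_bandLimited) (frontier (D.sub 1) \ D.Γ)
  refine ⟨Q.compl₁₂ (extL hR) (extL hR) + (h.grad 1).compl₁₂ (extL hR) (extL hR),
    ((h.isInner_grad 1).compl₁₂ fun z hz => ?_).add_nonneg
      (fun z z' => pointBilin_symm (h.meshed 1) _ _ _ _)
      (fun z => pointBilin_self_nonneg (h.meshed 1) _ _ _), fun z μ => rfl⟩
  rw [← traceL_extL h.matching hR z, hz, map_zero]

/-- As for the first preconditioner, with the elliptic extension in the gradient part. On Γ the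
extension by `R` has the values of `z`, so it may stand in for `z` in the temporal part. -/
lemma exists_isInner_P₂ {R : (Space d → TimeL2) →ₗ[ℝ] (Space d → TimeL2)}
    (hR : D.IsExtension 1 R) :
    ∃ B : LinearMap.BilinForm ℝ D.Z, IsInner B ∧ ∀ z μ : D.Z, D.P₂ z μ = B z μ := by
  have := h.isFiniteMeasure_interface
  let Q : LinearMap.BilinForm ℝ (D.Wsub 1) := pointBilin (h.meshed 1)
    ((surface d).restrict D.Γ) (multL isSymbol_quarterDeriv D.U_le_bandLimited)
    (multL isSymbol_quarterDeriv D.U_le_bandLimited) (frontier (D.sub 1) \ D.Γ)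
  refine ⟨Q.compl₁₂ (extL hR) (extL hR) + (h.grad 1).compl₁₂ (h.ellipticL hR) (h.ellipticL hR),
    ((h.isInner_grad 1).compl₁₂ fun z hz => ?_).add_nonneg
      (fun z z' => pointBilin_symm (h.meshed 1) _ _ _ _)
      (fun z => pointBilin_self_nonneg (h.meshed 1) _ _ _), fun z μ => ?_⟩
  · have h2 := (h.isEllipticExtension_H₂ hR z).2.1
    have h3 : D.H₂ z = 0 := congrArg Subtype.val hz
    rw [h3, map_zero] at h2
    exact Subtype.ext h2.symm
  · refine congrArg (· + gradForm (D.sub 1) (D.H₂ z) (D.H₂ μ)) ?_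
    refine setIntegral_congr_fun (measurableSet_interface D) fun x hx => ?_
    have hx' := D.interface_subset_frontier 1 hx
    change _ = inner ℝ (quarterDeriv ((extL hR z : Space d → TimeL2) x))
      (quarterDeriv ((extL hR μ : Space d → TimeL2) x))
    rw [extL_eq_on_frontier hR z hx', extL_eq_on_frontier hR μ hx']

/-! ### Norms -/

lemma exists_norm_le (i : Fin 2) : ∃ C > 0, ∀ (x : Space d) (w : D.Wsub i),
    ‖(w : Space d → TimeL2) x‖ ≤ C * √(h.grad i w w) := by
  have := h.finiteDimensional_Wsub i
  let T : Space d → D.Wsub i →ₗ[ℝ] TimeL2 := fun x =>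
    { toFun := fun u => (u : Space d → TimeL2) x, map_add' := fun _ _ => rfl,
      map_smul' := fun _ _ => rfl }
  exact (h.isInner_grad i).exists_uniform_bound T fun u => exists_norm_bound (h.meshed i) u.2

/-- Point values are bounded by the Dirichlet norm in finite dimensions, and the band limit bounds
the temporal Sobolev weight. -/
lemma exists_normW_le (i : Fin 2) : ∃ C > 0, ∀ w : D.Wsub i,
    D.normW i w ≤ C * √(h.grad i w w) := by
  obtain ⟨C, hC, hb⟩ := h.exists_norm_le i
  have := (h.meshed i).isFiniteMeasure
  set V := volume.real (D.sub i) with hV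
  set Q := (1 + D.κ ^ 2) ^ (1 / 2 : ℝ) with hQ
  have hQ0 : 0 ≤ Q := by positivity
  have hVt : volume (D.sub i) < ⊤ := (h.meshed i).isBounded.measure_lt_top
  have hsq : ∀ (w : D.Wsub i) x, ‖(w : Space d → TimeL2) x‖ ^ 2 ≤ C ^ 2 * h.grad i w w :=
    fun w x => by
    have := pow_le_pow_left₀ (norm_nonneg _) (hb x w) 2
    rwa [mul_pow, Real.sq_sqrt ((h.isInner_grad i).nonneg w)] at this
  refine ⟨√(Q * C ^ 2 * V + (1 + C ^ 2 * V)), by positivity, fun w => ?_⟩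
  rw [← Real.sqrt_mul (by positivity)]
  refine Real.sqrt_le_sqrt ?_
  have h1 : ∫ x in D.sub i, sobolevSq (1 / 2) ((w : Space d → TimeL2) x) ≤
      Q * (C ^ 2 * h.grad i w w) * V := by
    refine (Real.le_norm_self _).trans (norm_setIntegral_le_of_norm_le_const hVt fun x _ => ?_)
    rw [Real.norm_eq_abs, abs_of_nonneg (sobolevSq_nonneg _ _)]
    exact (sobolevSq_le (by norm_num) (D.U_le_bandLimited (tensor_mem w.2 x))).trans
      (mul_le_mul_of_nonneg_left (hsq w x) hQ0)
  have h2 : ∫ x in D.sub i, ‖(w : Space d → TimeL2) x‖ ^ 2 ≤ C ^ 2 * h.grad i w w * V := by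
    refine (Real.le_norm_self _).trans (norm_setIntegral_le_of_norm_le_const hVt fun x _ => ?_)
    rw [Real.norm_eq_abs, abs_of_nonneg (sq_nonneg _)]
    exact hsq w x
  have h3 : gradForm (D.sub i) w w = h.grad i w w := rfl
  rw [h3]
  linarith

/-- The squared `L²`-norm on `∂Ωᵢ`, as a positive definite form on the trace space. -/
lemma exists_isInner_boundary {i : Fin 2} {R : (Space d → TimeL2) →ₗ[ℝ] (Space d → TimeL2)}
    (hR : D.IsExtension i R) :
    ∃ B : LinearMap.BilinForm ℝ D.Z, IsInner B ∧ ∀ z : D.Z,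
      B z z = ∫ x in frontier (D.sub i), ‖(z : Space d → TimeL2) x‖ ^ 2 ∂(surface d) := by
  have := h.isFiniteMeasure_frontier i
  let Q : LinearMap.BilinForm ℝ (D.Wsub i) := pointBilin (h.meshed i)
    ((surface d).restrict (frontier (D.sub i))) D.U.subtype D.U.subtype (frontier (D.sub i) \ D.Γ)
  refine ⟨Q.compl₁₂ (extL hR) (extL hR),
    ⟨fun z z' => pointBilin_symm (h.meshed i) _ _ _ _, fun z hz => ?_⟩, fun z => ?_⟩
  · set w := extL hR z with hw
    have hint := integrable_inner_linear (h.meshed i)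
      (μ := (surface d).restrict (frontier (D.sub i))) D.U.subtype D.U.subtype w.2 w.2
    change 0 < ∫ x in frontier (D.sub i), inner ℝ ((w : Space d → TimeL2) x)
      ((w : Space d → TimeL2) x) ∂(surface d)
    refine (integral_pos_iff_support_of_nonneg (fun x => real_inner_self_nonneg) hint).mpr ?_
    obtain ⟨x, hx⟩ : ∃ x, (z : Space d → TimeL2) x ≠ 0 := by
      by_contra hcon
      push Not at hcon
      exact hz (Subtype.ext (funext hcon))
    have hxΓ : x ∈ D.Γ := by
      by_contra hxΓ
      apply hx
      rw [← congrFun (hR z z.2).2 x, trace_apply_of_notMem hxΓ]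
    have hxf := D.interface_subset_frontier i hxΓ
    rw [← extL_eq_on_frontier hR z hxf] at hx
    -- A nonzero value at a point of Γ persists on a relatively open part of Γ, which has positive
    -- surface measure.
    obtain ⟨L, hL⟩ := tensor_lipschitz (h.meshed i) w.2
    have hev := (hL.continuousOn x (frontier_subset_closure hxf)).eventually_ne hx
    obtain ⟨V, hV, hxV, hVs⟩ := mem_nhdsWithin.mp hev
    refine (surface_pos_of_manifold h.dom.interface hxΓ hV hxV).trans_le
      (le_trans (measure_mono ?_) (Measure.le_restrict_apply _ _))
    intro y hy
    have hyf := D.interface_subset_frontier i hy.1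
    refine ⟨?_, hyf⟩
    have : (w : Space d → TimeL2) y ≠ 0 := hVs ⟨hy.2, frontier_subset_closure hyf⟩
    exact (real_inner_self_pos.mpr this).ne'
  · refine setIntegral_congr_fun isClosed_frontier.measurableSet fun x hx => ?_
    change inner ℝ ((extL hR z : Space d → TimeL2) x) ((extL hR z : Space d → TimeL2) x) = _
    rw [extL_eq_on_frontier hR z hx, real_inner_self_eq_norm_sq]

/-- Values and difference quotients are bounded by the norm of `P`, uniformly in the points. Thus
the double integral is at most a multiple of the integral of |x - y|^(2-d), which is finite on a
boundary of dimension d - 1. -/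
lemma exists_normZ_le {i : Fin 2} {R : (Space d → TimeL2) →ₗ[ℝ] (Space d → TimeL2)}
    (hR : D.IsExtension i R) {P : LinearMap.BilinForm ℝ D.Z} (hP : IsInner P) :
    ∃ C > 0, ∀ z : D.Z, D.normZ i z ≤ C * √(P z z) := by
  have := h.finiteDimensional_Z
  have := h.isFiniteMeasure_frontier i
  set E := frontier (D.sub i) with hE
  have hval : ∀ (z : D.Z) {x}, x ∈ E → (z : Space d → TimeL2) x = (extL hR z).1 x :=
    fun z x hx => (extL_eq_on_frontier hR z hx).symm
  let T₀ : E → D.Z →ₗ[ℝ] TimeL2 := fun x =>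
    { toFun := fun z => (z : Space d → TimeL2) x, map_add' := fun _ _ => rfl,
      map_smul' := fun _ _ => rfl }
  -- Difference quotients; on the diagonal the inverse of 0 is 0, so no pair has to be excluded.
  let T₁ : E × E → D.Z →ₗ[ℝ] TimeL2 := fun p =>
    (dist (p.1 : Space d) p.2)⁻¹ • (T₀ p.1 - T₀ p.2)
  obtain ⟨C₀, hC₀, h₀⟩ := hP.exists_uniform_bound T₀ fun z => by
    obtain ⟨C, hC⟩ := exists_norm_bound (h.meshed i) (extL hR z).2
    exact ⟨C, fun x => (congrArg norm (hval z x.2)).le.trans (hC x)⟩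
  obtain ⟨C₁, hC₁, h₁⟩ := hP.exists_uniform_bound T₁ fun z => by
    obtain ⟨L, hL⟩ := tensor_lipschitz (h.meshed i) (extL hR z).2
    refine ⟨L, fun p => ?_⟩
    change ‖(dist (p.1 : Space d) p.2)⁻¹ • (z.1 p.1 - z.1 p.2)‖ ≤ L
    rw [hval z p.1.2, hval z p.2.2, norm_smul, norm_inv, Real.norm_of_nonneg dist_nonneg,
      ← dist_eq_norm]
    have hd := hL.dist_le_mul _ (frontier_subset_closure p.1.2) _ (frontier_subset_closure p.2.2)
    rcases (dist_nonneg (x := (p.1 : Space d)) (y := p.2)).eq_or_lt with h0 | h0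
    · rw [← h0]; simp
    · rw [inv_mul_le_iff₀ h0, mul_comm]; exact hd
  obtain ⟨K, hK, hsing⟩ := lintegral_singular_le (h.dom.lipschitz_sub i) h.two_le
  have hsq₀ : ∀ (z : D.Z), ∀ x ∈ E, ‖(z : Space d → TimeL2) x‖ ^ 2 ≤ C₀ ^ 2 * P z z :=
    fun z x hx => by
    have := pow_le_pow_left₀ (norm_nonneg _) (h₀ ⟨x, hx⟩ z) 2
    rwa [mul_pow, Real.sq_sqrt (hP.nonneg z)] at this
  have hsq₁ : ∀ (z : D.Z), ∀ x ∈ E, ∀ y ∈ E,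
      ‖(z : Space d → TimeL2) x - (z : Space d → TimeL2) y‖ ^ 2 / dist x y ^ d ≤
        C₁ ^ 2 * P z z * (dist x y ^ 2 / dist x y ^ d) := fun z x hx y hy => by
    have h2 : ‖(dist x y)⁻¹ • ((z : Space d → TimeL2) x - (z : Space d → TimeL2) y)‖ ≤
      C₁ * √(P z z) := h₁ (⟨x, hx⟩, ⟨y, hy⟩) z
    rw [← mul_div_assoc]
    refine div_le_div_of_nonneg_right ?_ (by positivity)
    rcases (dist_nonneg (x := x) (y := y)).eq_or_lt with h0 | h0
    · have : x = y := dist_eq_zero.mp h0.symm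
      simp [this]
    · rw [norm_smul, norm_inv, Real.norm_of_nonneg dist_nonneg, inv_mul_le_iff₀ h0] at h2
      have := pow_le_pow_left₀ (norm_nonneg _) h2 2
      rw [mul_pow, mul_pow, Real.sq_sqrt (hP.nonneg z)] at this
      linarith
  have hEt : surface d E < ⊤ :=
    surface_frontier_lt_top (h.dom.lipschitz_sub i) (one_le_two.trans h.two_le)
  have hΓt : surface d D.Γ < ⊤ := (measure_mono (D.interface_subset_frontier i)).trans_lt hEt
  set Q := (1 + D.κ ^ 2) ^ (1 / 4 : ℝ) with hQ
  have hQ0 : 0 ≤ Q := by positivity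
  refine ⟨√(Q * C₀ ^ 2 * (surface d).real D.Γ + (C₁ ^ 2 * K.toReal * (surface d).real E +
    C₀ ^ 2 * (surface d).real E)) + 1, by positivity, fun z => ?_⟩
  have e1 : ∫ x in D.Γ, sobolevSq (1 / 4) ((z : Space d → TimeL2) x) ∂(surface d) ≤
      Q * (C₀ ^ 2 * P z z) * (surface d).real D.Γ := by
    refine (Real.le_norm_self _).trans (norm_setIntegral_le_of_norm_le_const hΓt fun x hx => ?_)
    rw [Real.norm_eq_abs, abs_of_nonneg (sobolevSq_nonneg _ _)]
    exact (sobolevSq_le (by norm_num) (D.U_le_bandLimited (mem_U_of_mem_Z z.2 x))).trans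
      (mul_le_mul_of_nonneg_left (hsq₀ z x (D.interface_subset_frontier i hx)) hQ0)
  have e2 : ∫ x in E, ‖(z : Space d → TimeL2) x‖ ^ 2 ∂(surface d) ≤
      C₀ ^ 2 * P z z * (surface d).real E := by
    refine (Real.le_norm_self _).trans (norm_setIntegral_le_of_norm_le_const hEt fun x hx => ?_)
    rw [Real.norm_eq_abs, abs_of_nonneg (sq_nonneg _)]
    exact hsq₀ z x hx
  have e3 : ∫ x in E, ∫ y in E,
      ‖(z : Space d → TimeL2) x - (z : Space d → TimeL2) y‖ ^ 2 / dist x y ^ d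
      ∂(surface d) ∂(surface d) ≤ C₁ ^ 2 * P z z * K.toReal * (surface d).real E := by
    refine (Real.le_norm_self _).trans (norm_setIntegral_le_of_norm_le_const hEt fun x hx => ?_)
    have hP0 : 0 ≤ C₁ ^ 2 * P z z := mul_nonneg (sq_nonneg _) (hP.nonneg z)
    -- The estimate in extended reals holds for every integrand, integrable or not.
    have hle : ‖∫ y in E, ‖(z : Space d → TimeL2) x - (z : Space d → TimeL2) y‖ ^ 2 / dist x y ^ d
        ∂(surface d)‖ₑ ≤ ENNReal.ofReal (C₁ ^ 2 * P z z) * K := by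
      refine (enorm_integral_le_lintegral_enorm _).trans ?_
      refine le_trans ?_ (mul_le_mul' le_rfl (hsing x hx))
      rw [← lintegral_const_mul' _ _ ENNReal.ofReal_ne_top]
      refine setLIntegral_mono' isClosed_frontier.measurableSet fun y hy => ?_
      rw [← ENNReal.ofReal_mul hP0, Real.enorm_of_nonneg (by positivity)]
      exact ENNReal.ofReal_le_ofReal (hsq₁ z x hx y hy)
    have := ENNReal.toReal_mono (ENNReal.mul_ne_top ENNReal.ofReal_ne_top hK) hle
    rwa [toReal_enorm, ENNReal.toReal_mul, ENNReal.toReal_ofReal hP0] at this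
  refine le_trans (Real.sqrt_le_sqrt (add_le_add e1 (add_le_add e3 e2))) ?_
  rw [add_mul, ← Real.sqrt_mul (by positivity)]
  refine le_trans (le_of_eq ?_) (le_add_of_nonneg_right (by positivity))
  congr 1
  ring

/-- The L² part of the norm on ∂Ω_i is already positive definite, and in finite dimensions it
dominates `P`. -/
lemma exists_le_normZ {i : Fin 2} {R : (Space d → TimeL2) →ₗ[ℝ] (Space d → TimeL2)}
    (hR : D.IsExtension i R) {P : LinearMap.BilinForm ℝ D.Z} (hP : IsInner P) :
    ∃ C > 0, ∀ z : D.Z, √(P z z) ≤ C * D.normZ i z := by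
  have := h.finiteDimensional_Z
  obtain ⟨B, hB, hBz⟩ := h.exists_isInner_boundary hR
  obtain ⟨C, hC, hb⟩ := hB.exists_bound_map hP LinearMap.id
  refine ⟨C, hC, fun z => (hb z).trans (mul_le_mul_of_nonneg_left ?_ hC.le)⟩
  rw [hBz]
  exact le_normZ i z

end DiscreteProblem.IsAdmissible

/-! ### Restriction to the subdomains and gluing -/

namespace DiscreteProblem

variable {d : ℕ} {D : DiscreteProblem d}

lemma mem_closure_iff_sub (hdom : D.DomainAssumption) {x : Space d} :
    x ∈ closure D.Ω ↔ ∃ i, x ∈ closure (D.sub i) := by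
  rw [hdom.closure_eq, Fin.exists_fin_two]
  rfl

lemma eq_or_eq_of_ne {i j : Fin 2} (hij : i ≠ j) (k : Fin 2) : k = i ∨ k = j := by
  omega

/-- Inside Ω, a boundary point of Ω_i away from the closure of the other subdomain would be interior
to the closure of Ω_i, hence in Ω_i. So it is on both boundaries, that is, on Γ. -/
lemma mem_frontier_of_notMem_interface (hdom : D.DomainAssumption) {i : Fin 2} {x : Space d}
    (hx : x ∈ frontier (D.sub i)) (hxΓ : x ∉ D.Γ) : x ∈ frontier D.Ω := by
  by_contra hxΩ
  have hxcl : x ∈ closure D.Ω := closure_sub_subset hdom i (frontier_subset_closure hx)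
  have hxo : x ∈ D.Ω := by
    by_contra hn
    exact hxΩ (hdom.lipschitz.1.frontier_eq ▸ ⟨hxcl, hn⟩)
  obtain ⟨j, hij⟩ : ∃ j, i ≠ j := (exists_ne i).imp fun _ => Ne.symm
  have hxi : x ∉ D.sub i := by
    rw [(hdom.lipschitz_sub i).1.frontier_eq] at hx
    exact hx.2
  have hxj : x ∈ closure (D.sub j) := by
    by_contra hn
    apply hxi
    apply interior_closure_subset (hdom.lipschitz_sub i)
    rw [mem_interior_iff_mem_nhds]
    filter_upwards [hdom.lipschitz.1.mem_nhds hxo, isClosed_closure.isOpen_compl.mem_nhds hn]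
      with y hy hyj
    obtain ⟨k, hk⟩ := (mem_closure_iff_sub hdom).mp (subset_closure hy)
    rcases eq_or_eq_of_ne hij k with rfl | rfl
    · exact hk
    · exact absurd hk hyj
  have hxj' : x ∈ frontier (D.sub j) := by
    rw [(hdom.lipschitz_sub j).1.frontier_eq]
    exact ⟨hxj, fun hn => notMem_closure_sub hdom hij.symm hn (frontier_subset_closure hx)⟩
  refine hxΓ ⟨?_, hxΩ⟩
  have hall : ∀ k, x ∈ frontier (D.sub k) := fun k => by
    rcases eq_or_eq_of_ne hij k with rfl | rfl
    · exact hx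
    · exact hxj'
  exact ⟨hall 0, hall 1⟩

/-- Restriction to a subdomain. -/
def restr (D : DiscreteProblem d) (i : Fin 2) (u : Space d → TimeL2) : Space d → TimeL2 :=
  (closure (D.sub i)).indicator u

lemma restr_of_mem {i : Fin 2} {u : Space d → TimeL2} {x : Space d}
    (hx : x ∈ closure (D.sub i)) : D.restr i u x = u x := indicator_of_mem hx u

lemma restr_mem (hdom : D.DomainAssumption) {u : Space d → TimeL2} (hu : u ∈ D.W) (i : Fin 2) :
    D.restr i u ∈ D.Wsub i := by
  have hval : ∀ x, D.restr i u x = u x ∨ D.restr i u x = 0 := fun x => by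
    by_cases hx : x ∈ closure (D.sub i)
    · exact .inl (restr_of_mem hx)
    · exact .inr (indicator_of_notMem hx u)
  refine mem_tensor.mpr ⟨fun x => ?_, fun k => ?_⟩
  · rcases hval x with h | h
    · rw [h]; exact (mem_tensor.mp hu).1 x
    · rw [h]; exact D.U.zero_mem
  · have hk := (mem_tensor.mp hu).2 k
    refine ⟨fun s hs hsi => ?_, fun x hx => ?_, fun x hx => ?_⟩
    · obtain ⟨A, hA⟩ := hk.1 s hs (hsi.trans (closure_sub_subset hdom i))
      refine ⟨A, fun x hx => ?_⟩
      rw [← hA hx, component, restr_of_mem (hsi hx)]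
      rfl
    · have : D.restr i u x = 0 := indicator_of_notMem hx u
      simp [component, this]
    · have h0 := hk.2.2 x (mem_frontier_of_notMem_interface hdom hx.1 hx.2)
      rw [component, restr_of_mem (frontier_subset_closure hx.1)]
      exact h0

lemma trace_restr (i : Fin 2) (u : Space d → TimeL2) : D.trace (D.restr i u) = D.trace u := by
  ext1 x
  by_cases hx : x ∈ D.Γ
  · rw [trace_apply_of_mem hx, trace_apply_of_mem hx,
      restr_of_mem (frontier_subset_closure (D.interface_subset_frontier i hx))]
  · rw [trace_apply_of_notMem hx, trace_apply_of_notMem hx]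

lemma ext_of_restr (hdom : D.DomainAssumption) {u v : Space d → TimeL2} (hu : u ∈ D.W)
    (hv : v ∈ D.W) (huv : ∀ i, D.restr i u = D.restr i v) : u = v := by
  ext1 x
  by_cases hx : x ∈ closure D.Ω
  · obtain ⟨i, hi⟩ := (mem_closure_iff_sub hdom).mp hx
    rw [← restr_of_mem (u := u) hi, huv, restr_of_mem hi]
  · rw [(tensor_eq_zero_iff hu).mpr fun k => ((mem_tensor.mp hu).2 k).2.1 x hx,
      (tensor_eq_zero_iff hv).mpr fun k => ((mem_tensor.mp hv).2 k).2.1 x hx]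

/-- The closures overlap only in common boundary points: on Γ the values agree by the trace
condition, elsewhere both are zero. Every simplex lies in one closure, so the glued function is
again affine on it. -/
lemma exists_glue (hdom : D.DomainAssumption) (hmesh : D.MeshAssumption)
    {w : Fin 2 → Space d → TimeL2} (hw : ∀ i, w i ∈ D.Wsub i)
    (htr : D.trace (w 0) = D.trace (w 1)) : ∃ u ∈ D.W, ∀ i, D.restr i u = w i := by
  classical
  have hfront : ∀ {i j : Fin 2} {x}, i ≠ j → x ∈ closure (D.sub i) → x ∈ closure (D.sub j) →
      x ∈ frontier (D.sub i) := fun {i j x} hij hi hj => by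
    rw [(hdom.lipschitz_sub i).1.frontier_eq]
    exact ⟨hi, fun h => notMem_closure_sub hdom hij h hj⟩
  have hoff : ∀ i x, x ∉ closure (D.sub i) → w i x = 0 := fun i x hx =>
    (tensor_eq_zero_iff (hw i)).mpr fun k => ((mem_tensor.mp (hw i)).2 k).2.1 x hx
  let u : Space d → TimeL2 := (closure (D.sub 0)).piecewise (w 0) (w 1)
  have hu : ∀ i, ∀ x ∈ closure (D.sub i), u x = w i x := by
    have h0 : ∀ x ∈ closure (D.sub 0), u x = w 0 x := fun x hx => piecewise_eq_of_mem _ _ _ hx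
    have h1 : ∀ x ∈ closure (D.sub 1), u x = w 1 x := fun x hx => by
      by_cases hx0 : x ∈ closure (D.sub 0)
      · rw [h0 x hx0]
        have hf0 := hfront (by decide) hx0 hx
        have hf1 := hfront (by decide) hx hx0
        by_cases hxΓ : x ∈ D.Γ
        · rw [← trace_apply_of_mem (D := D) (u := w 0) hxΓ, htr, trace_apply_of_mem hxΓ]
        · rw [eq_zero_of_mem_Wsub (hw 0) hf0 hxΓ, eq_zero_of_mem_Wsub (hw 1) hf1 hxΓ]
      · exact piecewise_eq_of_notMem _ _ _ hx0
    intro i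
    fin_cases i
    · exact h0
    · exact h1
  have huoff : ∀ x ∉ closure D.Ω, u x = 0 := fun x hx => by
    have hn : ∀ i, x ∉ closure (D.sub i) := fun i hi => hx (closure_sub_subset hdom i hi)
    rw [show u x = w 1 x from piecewise_eq_of_notMem _ _ _ (hn 0), hoff 1 x (hn 1)]
  refine ⟨u, mem_tensor.mpr ⟨fun x => ?_, fun k => ⟨fun s hs _ => ?_, fun x hx => ?_,
    fun x hx => ?_⟩⟩, fun i => ?_⟩
  · by_cases hx : x ∈ closure D.Ω
    · obtain ⟨i, hi⟩ := (mem_closure_iff_sub hdom).mp hx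
      rw [hu i x hi]; exact (mem_tensor.mp (hw i)).1 x
    · rw [huoff x hx]; exact D.U.zero_mem
  · obtain ⟨i, hi⟩ := hmesh.resolves s hs
    obtain ⟨A, hA⟩ := ((mem_tensor.mp (hw i)).2 k).1 s hs hi
    refine ⟨A, fun x hx => ?_⟩
    rw [← hA hx, component, hu i x (hi hx)]
    rfl
  · simp [component, huoff x hx]
  · obtain ⟨i, hi⟩ := (mem_closure_iff_sub hdom).mp (frontier_subset_closure hx)
    have hxΩ : x ∉ D.Ω := by
      rw [hdom.lipschitz.1.frontier_eq] at hx
      exact hx.2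
    have hxf : x ∈ frontier (D.sub i) := by
      rw [(hdom.lipschitz_sub i).1.frontier_eq]
      exact ⟨hi, fun hn => hxΩ (sub_subset hdom i hn)⟩
    have : u x = 0 := by
      rw [hu i x hi]
      exact eq_zero_of_mem_Wsub (hw i) hxf fun hΓ => hΓ.2 hx
    simp [component, this]
  · ext1 x
    by_cases hx : x ∈ closure (D.sub i)
    · rw [restr_of_mem hx, hu i x hx]
    · rw [hoff i x hx]
      exact indicator_of_notMem hx u

/-! ### Splitting of the forms -/

/-- Almost every point is interior to a simplex, hence to the closure of one subdomain, hence in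
that subdomain. -/
lemma setIntegral_domain (hdom : D.DomainAssumption) (hmesh : D.MeshAssumption)
    {f : Space d → ℝ} (hf : IntegrableOn f D.Ω) :
    ∫ x in D.Ω, f x = ∑ i, ∫ x in D.sub i, f x := by
  have hae : D.Ω =ᵐ[volume] (D.sub 0 ∪ D.sub 1 : Set (Space d)) := by
    have h := (ae_restrict_iff' hdom.lipschitz.1.measurableSet).mp
      (isMeshed_domain hdom hmesh).ae_regular
    filter_upwards [h] with x hx
    refine propext ⟨fun hxΩ => ?_, fun hx' => ?_⟩
    · obtain ⟨s, hs, -, hxs⟩ := hx hxΩ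
      obtain ⟨i, hi⟩ := hmesh.resolves s hs
      have hxi : x ∈ D.sub i :=
        interior_closure_subset (hdom.lipschitz_sub i) (interior_mono hi hxs)
      have : ∃ i, x ∈ D.sub i := ⟨i, hxi⟩
      rwa [Fin.exists_fin_two] at this
    · rcases hx' with h0 | h1
      · exact sub_subset hdom 0 h0
      · exact sub_subset hdom 1 h1
  rw [setIntegral_congr_set hae, Fin.sum_univ_two,
    setIntegral_union (disjoint_sub hdom (by decide)) (hdom.lipschitz_sub 1).1.measurableSet
      (hf.mono_set (sub_subset hdom 0)) (hf.mono_set (sub_subset hdom 1))]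

lemma partialDeriv_restr (hdom : D.DomainAssumption) {i : Fin 2} (u : Space d → TimeL2)
    {x : Space d} (hx : x ∈ D.sub i) (j : Fin d) :
    partialDeriv (D.restr i u) j x = partialDeriv u j x := by
  have : D.restr i u =ᶠ[𝓝 x] u := by
    filter_upwards [(hdom.lipschitz_sub i).1.mem_nhds hx] with y hy
    exact restr_of_mem (subset_closure hy)
  rw [partialDeriv, this.fderiv_eq]
  rfl

lemma form_restr (hdom : D.DomainAssumption) (i : Fin 2) (u v : Space d → TimeL2) :
    D.form (D.sub i) (D.restr i u) (D.restr i v) = D.form (D.sub i) u v := by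
  refine setIntegral_congr_fun (hdom.lipschitz_sub i).1.measurableSet fun x hx => ?_
  have hg : ∀ (u : Space d → TimeL2) t, gradAt (D.restr i u) x t = gradAt u x t := fun u t => by
    simp only [gradAt, partialDeriv_restr hdom u hx]
  simp only [hg, restr_of_mem (subset_closure hx)]

lemma source_restr (hdom : D.DomainAssumption) (i : Fin 2) (v : Space d → TimeL2) :
    D.source (D.sub i) (D.restr i v) = D.source (D.sub i) v := by
  refine setIntegral_congr_fun (hdom.lipschitz_sub i).1.measurableSet fun x hx => ?_
  simp only [restr_of_mem (subset_closure hx)]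

namespace IsAdmissible

variable {M m₂ m₃ : ℝ} (h : D.IsAdmissible M m₂ m₃)
include h

lemma form_sub_source {u v : Space d → TimeL2} (hu : u ∈ D.W) (hv : v ∈ D.W) :
    D.form D.Ω u v - D.source D.Ω v =
      ∑ i, h.residual i ⟨_, restr_mem h.dom hu i⟩ ⟨_, restr_mem h.dom hv i⟩ := by
  have hM := isMeshed_domain h.dom h.mesh
  simp_rw [residual_apply, Finset.sum_sub_distrib, form_restr h.dom, source_restr h.dom]
  refine congrArg₂ (· - ·) ?_ ?_
  · exact setIntegral_domain h.dom h.mesh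
      (integrable_form hM D.U_le_bandLimited (h.coef _ subset_rfl) hu hv)
  · exact setIntegral_domain h.dom h.mesh (integrable_source hM h.source hv).1

variable {R : Fin 2 → (Space d → TimeL2) →ₗ[ℝ] (Space d → TimeL2)}
  (hR : ∀ i, D.IsExtension i (R i))
include hR

lemma isDirichletSolution_F (i : Fin 2) (z : D.Z) : D.IsDirichletSolution i z (D.F i z) :=
  Classical.epsilon_spec (h.existsUnique_isDirichletSolution i (hR i) z).exists

/-- The solution operator `Fᵢʰ` with values in `Wᵢʰ`. -/
def solve (i : Fin 2) (z : D.Z) : D.Wsub i := ⟨D.F i z, (h.isDirichletSolution_F hR i z).1⟩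

lemma solve_spec (i : Fin 2) (z : D.Z) : traceL h.matching i (h.solve hR i z) = z ∧
    ∀ v, traceL h.matching i v = 0 → h.residual i (h.solve hR i z) v = 0 :=
  (h.isDirichletSolution_iff.mp (h.isDirichletSolution_F hR i z)).2

/-- The Steklov–Poincaré operator on the discrete trace space. -/
def steklov (z : D.Z) : D.Z →ₗ[ℝ] ℝ :=
  (h.residual 0 (h.solve hR 0 z)).comp (extL (hR 0)) +
    (h.residual 1 (h.solve hR 1 z)).comp (extL (hR 1))

lemma steklov_eq_sum (z μ : D.Z) :
    h.steklov hR z μ = ∑ i, h.residual i (h.solve hR i z) (extL (hR i) μ) := by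
  rw [Fin.sum_univ_two]
  rfl

lemma steklov_apply (z μ : D.Z) : h.steklov hR z μ = D.S R z μ := by
  rw [steklov_eq_sum, S]
  simp_rw [residual_apply]
  rfl

lemma isStronglyMonotone_steklov {P : LinearMap.BilinForm ℝ D.Z} (hP : IsInner P) :
    IsStronglyMonotone P (h.steklov hR) := by
  have := h.finiteDimensional_Wsub 0
  have := h.finiteDimensional_Wsub 1
  have := h.finiteDimensional_Z
  exact MDN.isStronglyMonotone_steklov (h.isInner_grad 0) (h.isInner_grad 1) hP
    (h.isStronglyMonotone_residual 0) (h.isStronglyMonotone_residual 1)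
    (traceL h.matching 0) (extL (hR 0)) (traceL_extL h.matching (hR 0))
    (traceL h.matching 1) (extL (hR 1)) (traceL_extL h.matching (hR 1))
    (h.solve_spec hR 0) (h.solve_spec hR 1)

/-- The discrete weak equation is equivalent to the discrete Steklov–Poincaré equation. -/
lemma isWeakSolution_iff {u : Space d → TimeL2} :
    D.IsWeakSolution u ↔ u ∈ D.W ∧ ∃ z : D.Z, (∀ μ, h.steklov hR z μ = 0) ∧
      ∀ i, D.restr i u = D.F i z := by
  constructor
  · rintro ⟨hu, hv⟩
    have hres : ∀ v (hv : v ∈ D.W),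
        ∑ i, h.residual i ⟨_, restr_mem h.dom hu i⟩ ⟨_, restr_mem h.dom hv i⟩ = 0 :=
      fun v hvW => by rw [← h.form_sub_source hu hvW, hv v hvW, sub_self]
    -- Pairs of local test functions with equal traces are exactly the restrictions of global ones.
    have hglue : ∀ v : ∀ i, D.Wsub i, D.trace (v 0) = D.trace (v 1) →
        ∑ i, h.residual i ⟨_, restr_mem h.dom hu i⟩ (v i) = 0 := fun v htr => by
      obtain ⟨v', hv', hvi⟩ := exists_glue h.dom h.mesh (w := fun i => (v i : Space d → TimeL2))
        (fun i => (v i).2) htr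
      rw [← hres v' hv']
      refine Finset.sum_congr rfl fun i _ => ?_
      congr 1
      exact Subtype.ext (hvi i).symm
    let z : D.Z := traceL h.matching 0 ⟨_, restr_mem h.dom hu 0⟩
    have hz : ∀ i, traceL h.matching i ⟨_, restr_mem h.dom hu i⟩ = z := fun i =>
      Subtype.ext ((trace_restr i u).trans (trace_restr 0 u).symm)
    have hsol : ∀ i, D.restr i u = D.F i z := fun i => by
      refine (h.existsUnique_isDirichletSolution i (hR i) z).unique
        (h.isDirichletSolution_iff.mpr ⟨restr_mem h.dom hu i, hz i, fun v hv => ?_⟩)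
        (h.isDirichletSolution_F hR i z)
      have htv : D.trace (v : Space d → TimeL2) = 0 := congrArg Subtype.val hv
      -- Test pair that is `v` on Ω_i and zero on the other subdomain.
      have hall : ∀ k, D.trace ((Pi.single i v : ∀ k, D.Wsub k) k : Space d → TimeL2) = 0 := by
        intro k
        by_cases hk : k = i
        · subst hk; rw [Pi.single_eq_same, htv]
        · rw [Pi.single_eq_of_ne hk]; exact map_zero _
      have := hglue (Pi.single i v) (by rw [hall, hall])
      rw [Finset.sum_eq_single i (fun k _ hk => by rw [Pi.single_eq_of_ne hk, map_zero])
        (fun hn => absurd (Finset.mem_univ i) hn), Pi.single_eq_same] at this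
      exact this
    refine ⟨hu, z, fun μ => ?_, hsol⟩
    rw [steklov_eq_sum, ← hglue (fun i => extL (hR i) μ)
      (by rw [← coe_traceL h.matching, ← coe_traceL h.matching, traceL_extL, traceL_extL])]
    refine Finset.sum_congr rfl fun i _ => ?_
    congr 2
    exact Subtype.ext (hsol i).symm
  · rintro ⟨hu, z, hz, hi⟩
    refine ⟨hu, fun v hv => ?_⟩
    rw [← sub_eq_zero, h.form_sub_source hu hv]
    let μ : D.Z := traceL h.matching 0 ⟨_, restr_mem h.dom hv 0⟩
    rw [← hz μ, steklov_eq_sum]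
    refine Finset.sum_congr rfl fun i _ => ?_
    have e : (⟨_, restr_mem h.dom hu i⟩ : D.Wsub i) = h.solve hR i z := Subtype.ext (hi i)
    -- The restriction of `v` and the extension of its trace `μ` differ by a function of zero trace,
    -- which the local equation does not see.
    rw [e, ← sub_eq_zero, ← map_sub]
    refine (h.solve_spec hR i z).2 _ ?_
    rw [map_sub, traceL_extL, sub_eq_zero]
    exact Subtype.ext ((trace_restr i v).trans (trace_restr 0 v).symm)

lemma existsUnique_isWeakSolution {z : D.Z} (hz : ∀ μ, h.steklov hR z μ = 0)
    (huniq : ∀ z' : D.Z, (∀ μ, h.steklov hR z' μ = 0) → z' = z) :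
    ∃ u, (∀ u', D.IsWeakSolution u' ↔ u' = u) ∧ ∀ i, D.restr i u = D.F i z := by
  obtain ⟨u, hu, hi⟩ := exists_glue h.dom h.mesh
    (w := fun i => (h.solve hR i z : Space d → TimeL2)) (fun i => (h.solve hR i z).2) (by
      rw [← coe_traceL h.matching, ← coe_traceL h.matching, (h.solve_spec hR 0 z).1,
        (h.solve_spec hR 1 z).1])
  refine ⟨u, fun u' => ⟨fun hu' => ?_, ?_⟩, hi⟩
  · obtain ⟨huW, z', hz', hi'⟩ := (h.isWeakSolution_iff hR).mp hu'
    obtain rfl := huniq z' hz'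
    exact ext_of_restr h.dom huW hu fun i => (hi' i).trans (hi i).symm
  · rintro rfl
    exact (h.isWeakSolution_iff hR).mpr ⟨hu, z, hz, hi⟩

end IsAdmissible

end DiscreteProblem

/-! ### The iteration -/

/-- The preconditioned iteration with a rotated test function defines a unique sequence, which
converges linearly to the zero of a strongly monotone operator. -/
theorem IsStronglyMonotone.exists_iteration {E : Type*} [AddCommGroup E] [Module ℝ E]
    [FiniteDimensional ℝ E] {B : LinearMap.BilinForm ℝ E} (hB : IsInner B)
    {A : E → E →ₗ[ℝ] ℝ} (hA : IsStronglyMonotone B A) (J : E →ₗ[ℝ] E) {xh : E}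
    (hxh : ∀ v, A xh v = 0) :
    ∃ φ₀ > 0, ∃ s₀ > 0, ∀ φ ∈ Ioo (0 : ℝ) φ₀, ∀ s ∈ Ioo (0 : ℝ) s₀, ∃ L ∈ Ioo (0 : ℝ) 1,
      ∀ x₀ : E, ∃ x : ℕ → E,
        (∀ x' : ℕ → E, (x' 0 = x₀ ∧ ∀ n v, B (x' (n + 1) - x' n) v =
          s * (0 - A (x' n) (Real.cos φ • v - Real.sin φ • J v))) ↔ x' = x) ∧
        ∀ n, √(B (x n - xh) (x n - xh)) ≤ L ^ n * √(B (x₀ - xh) (x₀ - xh)) := by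
  obtain ⟨φ₀, hφ₀, s₀, hs₀, h⟩ := hA.exists_rotated_rate hB J
  refine ⟨φ₀, hφ₀, s₀, hs₀, fun φ hφ s hs => ?_⟩
  obtain ⟨L, hL, hrate⟩ := h φ hφ s hs
  refine ⟨L, hL, fun x₀ => ?_⟩
  let Q : E →ₗ[ℝ] E := Real.cos φ • LinearMap.id - Real.sin φ • J
  -- `r x` is the increment of the iteration at `x`, by Riesz representation in the form `B`.
  choose r hr hr' using fun x => hB.existsUnique_riesz (-s • (A x).comp Q)
  have hstep : ∀ x x' : E, (∀ v, B (x' - x) v =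
      s * (0 - A x (Real.cos φ • v - Real.sin φ • J v))) ↔ x' = x + r x := fun x x' => by
    constructor
    · intro hx
      rw [← hr' x (x' - x) fun v => by
        rw [hx]
        simp [Q]
        ring]
      abel
    · rintro rfl v
      rw [add_sub_cancel_left, hr]
      simp [Q]
      ring
  let x : ℕ → E := fun n => (fun y => y + r y)^[n] x₀
  have hx : ∀ n, x (n + 1) = x n + r (x n) := fun n => Function.iterate_succ_apply' _ n x₀
  refine ⟨x, fun x' => ⟨fun ⟨h0, h1⟩ => ?_, ?_⟩, fun n => ?_⟩
  · funext n
    induction n with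
    | zero => exact h0
    | succ n ih => rw [hx, ← ih]; exact (hstep _ _).mp (h1 n)
  · rintro rfl
    exact ⟨rfl, fun n => (hstep _ _).mpr (hx n)⟩
  · induction n with
    | zero => simp [x]
    | succ n ih =>
      -- The constant sequence at the zero of `A` is itself an iteration, so contraction towards it
      -- gives the rate.
      have h1 := hrate (x n) xh (x (n + 1)) xh
        (fun v => by rw [(hstep _ _).mpr (hx n) v]; ring) (fun v => by simp [hxh])
      refine h1.trans ((mul_le_mul_of_nonneg_left ih hL.1.le).trans (le_of_eq ?_))
      ring

namespace DiscreteProblem.IsAdmissible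

variable {d : ℕ} {D : DiscreteProblem d} {M m₂ m₃ : ℝ} (h : D.IsAdmissible M m₂ m₃)
  {R : Fin 2 → (Space d → TimeL2) →ₗ[ℝ] (Space d → TimeL2)}
  (hR : ∀ i, D.IsExtension i (R i))
include h hR

lemma exists_iteration {P : (Space d → TimeL2) → (Space d → TimeL2) → ℝ}
    (hP : ∃ B : LinearMap.BilinForm ℝ D.Z, IsInner B ∧ ∀ z μ : D.Z, P z μ = B z μ) {zh : D.Z}
    (hzh : ∀ μ, h.steklov hR zh μ = 0) :
    ∃ φ₀ > 0, ∃ s₀ > 0, ∀ φ ∈ Ioo (0 : ℝ) φ₀, ∀ s ∈ Ioo (0 : ℝ) s₀,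
      ∃ C > 0, ∃ L ∈ Ioo (0 : ℝ) 1, ∀ η₀ ∈ D.Z,
        ∃ η, (∀ η', D.IsMDNIteration R P φ s η₀ η' ↔ η' = η) ∧
          ∀ n : ℕ, ∀ i : Fin 2,
            D.normZ i (η n - zh) ≤ C * L ^ n * D.normZ i (η₀ - zh) ∧
            D.normW i (D.F i (η n) - D.F i zh) ≤ C * L ^ n * D.normZ i (η₀ - zh) := by
  have := h.finiteDimensional_Z
  obtain ⟨B, hB, hPB⟩ := hP
  obtain ⟨φ₀, hφ₀, s₀, hs₀, hit⟩ :=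
    (h.isStronglyMonotone_steklov hR hB).exists_iteration hB (hilbertZ D) hzh
  refine ⟨φ₀, hφ₀, s₀, hs₀, fun φ hφ s hs => ?_⟩
  obtain ⟨L, hL, hconv⟩ := hit φ hφ s hs
  choose C₁ hC₁ h₁ using fun i => h.exists_normZ_le (hR i) hB
  choose C₂ hC₂ h₂ using fun i => h.exists_le_normZ (hR i) hB
  choose C₃ hC₃ h₃ using fun i => h.exists_normW_le i
  choose C₄ hC₄ h₄ using fun i => exists_lipschitz_dirichlet (h.isInner_grad i) hB
    (h.isStronglyMonotone_residual i) (traceL h.matching i) (extL (hR i))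
    (traceL_extL h.matching (hR i)) (h.solve_spec hR i)
  -- The error starts in the norm of Z, passes to that of the preconditioner (`C₂`), and returns to
  -- the norm of Z (`C₁`) or, through the Lipschitz map F_i (`C₄`), to that of W_i (`C₃`).
  let c : Fin 2 → ℝ := fun i => (C₁ i + C₃ i * C₄ i) * C₂ i
  have hc : ∀ i, 0 < c i := fun i =>
    mul_pos (add_pos (hC₁ i) (mul_pos (hC₃ i) (hC₄ i))) (hC₂ i)
  refine ⟨∑ i, c i, Finset.sum_pos (fun i _ => hc i) Finset.univ_nonempty, L, hL,
    fun η₀ hη₀ => ?_⟩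
  obtain ⟨x, hx, hrate⟩ := hconv ⟨η₀, hη₀⟩
  refine ⟨fun n => x n, fun η' => ?_, fun n i => ?_⟩
  · constructor
    · rintro ⟨h0, hZ, hn⟩
      have := (hx fun n => ⟨η' n, hZ n⟩).mp ⟨Subtype.ext h0, fun n v => ?_⟩
      · funext n
        exact congrArg Subtype.val (congrFun this n)
      · rw [← hPB, steklov_apply, coe_rotate]
        exact hn n v v.2
    · rintro rfl
      obtain ⟨h0, hn⟩ := (hx x).mpr rfl
      refine ⟨congrArg Subtype.val h0, fun n => (x n).2, fun n μ hμ => ?_⟩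
      have := hn n ⟨μ, hμ⟩
      rw [← hPB, steklov_apply, coe_rotate] at this
      exact this
  · set e₀ := √(B (⟨η₀, hη₀⟩ - zh) (⟨η₀, hη₀⟩ - zh)) with he₀
    have hLn : 0 ≤ L ^ n := pow_nonneg hL.1.le n
    have hN : e₀ ≤ C₂ i * D.normZ i (η₀ - zh) := h₂ i (⟨η₀, hη₀⟩ - zh)
    have hN0 : 0 ≤ D.normZ i (η₀ - zh) := Real.sqrt_nonneg _
    have hkey : ∀ b, 0 ≤ b → b ≤ C₁ i + C₃ i * C₄ i → ∀ a,
        a ≤ b * √(B (x n - zh) (x n - zh)) →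
        a ≤ (∑ i, c i) * L ^ n * D.normZ i (η₀ - zh) := fun b hb hbc a ha => by
      calc a ≤ b * (L ^ n * (C₂ i * D.normZ i (η₀ - zh))) := ha.trans
            (mul_le_mul_of_nonneg_left ((hrate n).trans (mul_le_mul_of_nonneg_left hN hLn)) hb)
        _ = b * C₂ i * (L ^ n * D.normZ i (η₀ - zh)) := by ring
        _ ≤ (∑ i, c i) * (L ^ n * D.normZ i (η₀ - zh)) := by
            refine mul_le_mul_of_nonneg_right ?_ (mul_nonneg hLn hN0)
            exact (mul_le_mul_of_nonneg_right hbc (hC₂ i).le).trans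
              (Finset.single_le_sum (fun i _ => (hc i).le) (Finset.mem_univ i))
        _ = _ := by ring
    have hC₃₄ := mul_pos (hC₃ i) (hC₄ i)
    refine ⟨hkey (C₁ i) (hC₁ i).le (by linarith) _ (h₁ i (x n - zh)),
      hkey (C₃ i * C₄ i) hC₃₄.le (by linarith [hC₁ i]) _ ?_⟩
    refine (h₃ i (h.solve hR i (x n) - h.solve hR i zh)).trans ?_
    rw [mul_assoc]
    exact mul_le_mul_of_nonneg_left (h₄ i (x n) zh) (hC₃ i).le

end DiscreteProblem.IsAdmissible

end MDN

end

/-! ### Assembly of the theorem -/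

theorem mainTheorem4 (d : ℕ) (hd : 2 ≤ d) (D : MDN.DiscreteProblem d)
    (hdom : D.DomainAssumption) (hcoef : D.CoefficientAssumption) (hsrc : D.SourceAssumption)
    (hmesh : D.MeshAssumption) (hτ : 0 < D.τ) (hκ : D.N * D.τ ≤ D.κ)
    (htr : D.MatchingTraces)
    (R : Fin 2 → (MDN.Space d → MDN.TimeL2) →ₗ[ℝ] (MDN.Space d → MDN.TimeL2))
    (hR : ∀ i, D.IsExtension i (R i)) :
    (∀ i, ∀ η ∈ D.Z, ∃! u, D.IsDirichletSolution i η u) ∧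
    (∀ η ∈ D.Z, ∃! w, D.IsEllipticExtension η w) ∧
    ∃ ηh ∈ D.Z, (∀ η ∈ D.Z, (∀ μ ∈ D.Z, D.S R η μ = 0) ↔ η = ηh) ∧
    ∃ uh, (∀ u, D.IsWeakSolution u ↔ u = uh) ∧
    ∃ φ₀ > 0, ∃ s₀ > 0, ∀ φ ∈ Set.Ioo (0 : ℝ) φ₀, ∀ s ∈ Set.Ioo (0 : ℝ) s₀,
      ∀ P, (P = D.P₁ (R 1) ∨ P = D.P₂) →
        ∃ C > 0, ∃ L ∈ Set.Ioo (0 : ℝ) 1, ∀ η₀ ∈ D.Z,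
          ∃ η, (∀ η', D.IsMDNIteration R P φ s η₀ η' ↔ η' = η) ∧
            ∀ n : ℕ, ∀ i : Fin 2,
              D.normZ i (η n - ηh) ≤ C * L ^ n * D.normZ i (η₀ - ηh) ∧
              D.normW i (D.F i (η n) - (closure (D.sub i)).indicator uh) ≤
                C * L ^ n * D.normZ i (η₀ - ηh) := by
  obtain ⟨M, m₂, m₃, hM, hCp, hco⟩ := MDN.exists_isCoefficientOn hcoef
  have h : D.IsAdmissible M m₂ m₃ := ⟨hd, hdom, hmesh, hM, hco, hCp, hsrc, htr⟩
  have := h.finiteDimensional_Z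
  obtain ⟨B₁, hB₁, hPB₁⟩ := h.exists_isInner_P₁ (hR 1)
  -- The equation S = 0 does not involve the preconditioner; the inner product of the first one only
  -- serves to solve it.
  obtain ⟨zh, hzh, huniq⟩ := (h.isStronglyMonotone_steklov hR hB₁).existsUnique hB₁
  obtain ⟨uh, huh, hrestr⟩ := h.existsUnique_isWeakSolution hR hzh huniq
  obtain ⟨φ₁, hφ₁, s₁, hs₁, h₁⟩ := h.exists_iteration hR ⟨B₁, hB₁, hPB₁⟩ hzh
  obtain ⟨φ₂, hφ₂, s₂, hs₂, h₂⟩ := h.exists_iteration hR (h.exists_isInner_P₂ (hR 1)) hzh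
  refine ⟨fun i η hη => h.existsUnique_isDirichletSolution i (hR i) ⟨η, hη⟩,
    fun η hη => h.existsUnique_isEllipticExtension (hR 1) ⟨η, hη⟩,
    zh, zh.2, fun η hη => ⟨fun hS => ?_, ?_⟩, uh, huh, min φ₁ φ₂, lt_min hφ₁ hφ₂,
    min s₁ s₂, lt_min hs₁ hs₂, fun φ hφ s hs P hP => ?_⟩
  · refine congrArg Subtype.val (huniq ⟨η, hη⟩ fun μ => ?_)
    rw [MDN.DiscreteProblem.IsAdmissible.steklov_apply]
    exact hS μ μ.2
  · rintro rfl μ hμ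
    exact (h.steklov_apply hR zh ⟨μ, hμ⟩).symm.trans (hzh _)
  · have hF : ∀ i, (closure (D.sub i)).indicator uh = D.F i zh := hrestr
    simp_rw [hF]
    rcases hP with rfl | rfl
    · exact h₁ φ ⟨hφ.1, hφ.2.trans_le (min_le_left _ _)⟩ s ⟨hs.1, hs.2.trans_le (min_le_left _ _)⟩
    · exact h₂ φ ⟨hφ.1, hφ.2.trans_le (min_le_right _ _)⟩ s
        ⟨hs.1, hs.2.trans_le (min_le_right _ _)⟩
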